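/- Let $g>1$ be an integer and let $K$ be an algebraically closed field such that either (a) $\mathrm{char}(K)=0$, or (b) $q=2g+1$ is a prime and $p=\mathrm{char}(K)$ is an odd prime that is a primitive root modulo $q$. A *marked genus $g$ odd degree hyperelliptic curve* over $K$ is a pair $(\mathcal C,\mathcal O)$ where $\mathcal C$ is a smooth irreducible projective curve of genus $g$ over $K$ that admits a degree $2$ morphism to $\mathbb P^1$, and $\mathcal O\in\mathcal C(K)$ is one of its Weierstrass points, i.e. a ramification point of this morphism. An isomorphism of marked curves is an isomorphism of the curves over $K$ that carries one marked point to the other. Let $J$ be the Jacobian of $\mathcal C$; embed $\mathcal C(K)$ into $J(K)=\mathrm{Pic}^0(\mathcal C)$ by sending $P$ to the linear equivalence class of $(P)-(\mathcal O)$, and let $\mathcal C^*_{2g+1}(K)$ be the set of points $P\in\mathcal C(K)$ whose image in the group $J(K)$ has order exactly $2g+1$. Then there exists a finite (possibly empty) set $S(g,K)$ of marked genus $g$ odd degree hyperelliptic curves over $K$ such that (1) $\#S(g,K)\le 9\,(4g-1)\binom{2g}{g}^2$; (2) every marked genus $g$ odd degree hyperelliptic curve $(\mathcal C,\mathcal O)$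 over $K$ with $\#\,\mathcal C^*_{2g+1}(K)>4$ is isomorphic, as a marked curve, to a member of $S(g,K)$. -/

import Mathlib

open AlgebraicGeometry CategoryTheory
open scoped IntermediateField

universe u

namespace HyperellipticTorsion

/-- A smooth irreducible projective curve over a field `K` (meant for `K` algebraically closed): an
integral scheme, proper and smooth of relative dimension one over `K`.  Proper curves over a field
are projective. -/
structure Curve (K : Type u) [Field K] where
  X : Scheme.{u}
  str : X ⟶ Spec (.of K)
  [isIntegral : IsIntegral X]
  [isProper : IsProper str]
  [isSmooth : SmoothOfRelativeDimension 1 str]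

attribute [instance] Curve.isIntegral Curve.isProper Curve.isSmooth

namespace Curve

variable {K : Type u} [Field K]

instance isLocallyNoetherian (C : Curve K) : IsLocallyNoetherian C.X :=
  LocallyOfFiniteType.isLocallyNoetherian C.str

/-- The points of `C(K)`.  Over an algebraically closed field these are the closed points of the
scheme, see `AlgebraicGeometry.pointEquivClosedPoint`. -/
abbrev Point (C : Curve K) : Type u := closedPoints C.X

/-- The field `K(C)` of rational functions. -/
abbrev FunctionField (C : Curve K) : Type u := C.X.functionField

/-- The local ring `O_{C,x}`. -/
abbrev LocalRing (C : Curve K) (x : C.X) : Type u := C.X.presheaf.stalk x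

/-- The structure map `K → Γ(C, O_C) → O_{C,x}`; for `x` the generic point, this is the inclusion
of the constants in `K(C)`. -/
noncomputable def constants (C : Curve K) (x : C.X) : K →+* C.LocalRing x :=
  ((Scheme.ΓSpecIso (.of K)).inv ≫ C.str.appTop ≫ C.X.presheaf.germ ⊤ x trivial).hom

noncomputable instance algebraStalk (C : Curve K) (x : C.X) :
    Algebra K (C.X.presheaf.stalk x) :=
  (C.constants x).toAlgebra

instance isScalarTower (C : Curve K) (x : C.X) :
    IsScalarTower K (C.X.presheaf.stalk x) C.X.functionField := by
  refine IsScalarTower.of_algebraMap_eq' ?_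
  simp only [RingHom.algebraMap_toAlgebra, constants]
  rw [← CommRingCat.hom_comp]
  simp only [Category.assoc]
  congr 3
  exact (C.X.presheaf.germ_stalkSpecializes (U := ⊤) (y := x) trivial
    ((genericPoint_spec C.X).specializes trivial)).symm

/-! ### Genus -/

/-- The space `H⁰(C, Ω¹)` of regular differentials: the rational differentials which at every
point `P` come from the Kähler differentials of the local ring at `P`. -/
noncomputable def regularDifferentials (C : Curve K) :
    Submodule K (Ω[C.FunctionField⁄K]) :=
  ⨅ P : C.Point,
    (LinearMap.range
      (KaehlerDifferential.map K K (C.LocalRing P.1) C.FunctionField)).restrictScalars K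

/-- The genus of a smooth projective curve, `dim H⁰(C, Ω¹)`. -/
noncomputable def genus (C : Curve K) : ℕ := Module.finrank K C.regularDifferentials

/-! ### Divisors and the group of points of the Jacobian -/

/-- The order of the rational function `h` at the point `P` (positive at zeros of `h`). -/
noncomputable def ord (C : Curve K) (h : C.FunctionField) (P : C.Point) : ℤ :=
  Scheme.ord h P.1

/-- The group of divisors. -/
abbrev Divisor (C : Curve K) : Type u := C.Point →₀ ℤ

/-- The degree of a divisor (all points have degree one when `K` is algebraically closed). -/
noncomputable def degree (C : Curve K) : C.Divisor →+ ℤ :=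
  Finsupp.liftAddHom fun _ => AddMonoidHom.id ℤ

/-- The divisors of nonzero rational functions. -/
def principalDivisors (C : Curve K) : AddSubgroup C.Divisor where
  carrier := {D | ∃ h : C.FunctionField, h ≠ 0 ∧ ∀ P, D P = C.ord h P}
  zero_mem' := by
    refine ⟨1, one_ne_zero, fun P => ?_⟩
    have h := Scheme.ord_mul (X := C.X) (x := P.1) (f := 1) (g := 1) one_ne_zero one_ne_zero
    rw [mul_one] at h
    simp only [Finsupp.coe_zero, Pi.zero_apply, ord]
    omega
  add_mem' := by
    rintro D E ⟨h, h0, hD⟩ ⟨k, k0, hE⟩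
    exact ⟨h * k, mul_ne_zero h0 k0, fun P => by
      simp [hD, hE, ord, Scheme.ord_mul h0 k0]⟩
  neg_mem' := by
    rintro D ⟨h, h0, hD⟩
    refine ⟨h⁻¹, inv_ne_zero h0, fun P => ?_⟩
    have h1 := Scheme.ord_mul (X := C.X) (x := P.1) (f := 1) (g := 1) one_ne_zero one_ne_zero
    have h2 := Scheme.ord_mul (x := P.1) h0 (inv_ne_zero h0)
    rw [mul_one] at h1
    rw [mul_inv_cancel₀ h0] at h2
    simp only [Finsupp.coe_neg, Pi.neg_apply, hD, ord]
    omega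

/-- The group `J(K)` of points of the Jacobian of `C`: divisors of degree zero modulo linear
equivalence. -/
abbrev Jacobian (C : Curve K) : Type u :=
  C.degree.ker ⧸ C.principalDivisors.addSubgroupOf C.degree.ker

/-- The embedding `C(K) → J(K)` with base point `O`, sending `P` to the class of `(P) - (O)`. -/
noncomputable def abelJacobi (C : Curve K) (O P : C.Point) : C.Jacobian :=
  QuotientAddGroup.mk ⟨Finsupp.single P 1 - Finsupp.single O 1, by
    rw [AddMonoidHom.mem_ker, map_sub]
    simp [degree]⟩

/-! ### Double covers of the projective line -/

/-- The rational function `x`, seen as a morphism `C → ℙ¹`, has degree two: `[K(C) : K(x)] = 2`. -/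
def IsDoubleCover (C : Curve K) (x : C.FunctionField) : Prop :=
  Module.finrank K⟮x⟯ C.FunctionField = 2

/-- The morphism `x : C → ℙ¹` is ramified at `P`: either `x` takes a finite value `c` at `P` with
multiplicity at least two, or `x` has a multiple pole at `P`. -/
def IsRamifiedAt (C : Curve K) (x : C.FunctionField) (P : C.Point) : Prop :=
  (∃ c : K, 2 ≤ C.ord (x - algebraMap K C.FunctionField c) P) ∨ C.ord x P ≤ -2

end Curve

/-- A marked genus `g` odd degree hyperelliptic curve over `K` (meant for `g > 1` and `K`
algebraically closed of characteristic not two): a smooth projective curve of genus `g` which is a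
double cover of the projective line, together with one of its Weierstrass points, that is, of the
ramification points of the double cover. -/
structure MarkedHyperellipticCurve (K : Type u) [Field K] (g : ℕ) extends Curve K where
  genus_eq : toCurve.genus = g
  /-- the marked point -/
  pt : toCurve.Point
  exists_doubleCover : ∃ x : toCurve.FunctionField,
    toCurve.IsDoubleCover x ∧ toCurve.IsRamifiedAt x pt

namespace MarkedHyperellipticCurve

variable {K : Type u} [Field K] {g : ℕ}

/-- The points of `C(K)`, embedded in `J(K)` with the marked point as origin, that have order
exactly `d` in the group `J(K)`. -/
def pointsOfOrder (C : MarkedHyperellipticCurve K g) (d : ℕ) : Set C.toCurve.Point :=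
  {P | addOrderOf (C.toCurve.abelJacobi C.pt P) = d}

/-- Isomorphism of marked curves: an isomorphism of `K`-schemes that respects marked points. -/
def IsIsomorphic (C D : MarkedHyperellipticCurve K g) : Prop :=
  ∃ φ : C.X ≅ D.X, φ.hom ≫ D.str = C.str ∧ φ.hom C.pt.1 = D.pt.1

end MarkedHyperellipticCurve

end HyperellipticTorsion

/-!
Write `n = 2 g + 1`. A marked curve has an equation `y² = f(x)` with `f` monic of degree `n` and the
marked point at infinity (`MarkedHyperellipticCurve.exists_model`), and it is determined by `f`
(`MarkedHyperellipticCurve.isIsomorphic_of_model`). If `P` has order `n`, a function with divisor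
`n (P - ∞)` is, up to a constant, `y + v(x)` with `deg v ≤ g`, and its norm shows that
`f = (x - a)^n + v²` with `a = x(P)` (`Curve.exists_eq_pow_add_sq`). At most two points have the
same `x`, so more than four points of order `n` give three such representations with distinct `a`.

For two representations, `(v₀ - v₁) (v₀ + v₁) = (x - a₁)^n - (x - a₀)^n`. The right-hand side is a
product of linear factors whose roots are known up to an affine transformation, so the two factors
on the left are given by a set `I` of `g` of the `2 g` roots and by the leading coefficients `μ`,
`μ'`; then `2 v₀` is the polynomial `splitSum g I μ μ'`. The third representation gives
`splitSum g I μ μ' = splitSum g J ν ν'`. After a change of coordinates `a₀ = 0` and `μ = 1`, and the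
curve depends only on `I` and `s = μ'` (`normalForm`), while the coefficients of the last identity
are polynomial equations for the point `(s, ν)` of the plane.

The solutions are counted by Bézout's inequality (`Plane.finite_and_ncard_le`), which applies
because no solution lies on a common component of the equations. This follows from a rigidity
theorem, `exists_eq_mul_of_splitSum_eq`: if `μ μ' ≠ ν ν'`, the ratio `μ' / μ` is a constant, over
every extension of `K`. Otherwise `μ` vanishes at some valuation at which the other parameters,
suitably scaled, are integral and do not all vanish. The reduced identity says that
`c X^(2g) + X^n - (X - β)^n` is a square, with `β` proportional to `ν ν'`, which forces `β = 0`, so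
that, say, `ν` vanishes as well. Then the roots given by the complements of `I` and `J` agree up to
the factor `τ = ν / μ` after reduction. Here the hypothesis on `K` enters, through `IsAdmissible`: a
relation between four roots of unity which is preserved by inversion gives `τ = 1` and `I = J`. The
next terms of the equations then say `X q' = g q` for the separable polynomial `q` with these roots,
which is absurd.

Finally, one of the equations has degree at most three and all have degree at most `n`. This bounds
the number of solutions for given `I` and `J` by `3 n`, except when the equation of degree three may
vanish, which happens only if the roots in `I` have sum zero; this concerns at most one `g`-th of
the sets `I`, for which the bound is `n²` (`exists_finset_solutions`).
-/

namespace HyperellipticTorsion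

/-! ### Local rings of a smooth curve -/

open IsLocalRing in
/-- The derivation `z ↦ z - z(P)` from a local ring with residue field `K` to its cotangent
space. -/
noncomputable def cotangentDerivation (K O : Type*) [Field K] [CommRing O] [IsLocalRing O]
    [Algebra K O] (hres : Function.Bijective (algebraMap K (ResidueField O))) :
    Derivation K O (maximalIdeal O).Cotangent :=
  let e : K ≃ₐ[K] ResidueField O := AlgEquiv.ofBijective (Algebra.ofId K _) hres
  let c : O →ₐ[K] K := (e.symm : ResidueField O →ₐ[K] K).comp
    (IsScalarTower.toAlgHom K O (ResidueField O))
  have hc (z : O) : z - algebraMap K O (c z) ∈ maximalIdeal O := by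
    rw [← residue_eq_zero_iff, map_sub, sub_eq_zero]
    exact (e.apply_symm_apply (algebraMap O (ResidueField O) z)).symm
  let l : O →ₗ[K] maximalIdeal O :=
    { toFun := fun z => ⟨z - algebraMap K O (c z), hc z⟩
      map_add' := fun x y => by ext; simp; ring
      map_smul' := fun a x => by ext; simp [Algebra.smul_def]; ring }
  Derivation.mk' ((maximalIdeal O).toCotangent.restrictScalars K ∘ₗ l) (by
    intro a b
    simp only [LinearMap.comp_apply, LinearMap.restrictScalars_apply]
    rw [← map_smul (maximalIdeal O).toCotangent a (l b),
      ← map_smul (maximalIdeal O).toCotangent b (l a), ← map_add, Ideal.toCotangent_eq]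
    simp only [l, LinearMap.coe_mk, AddHom.coe_mk, map_mul, Submodule.coe_add, Submodule.coe_smul,
      smul_eq_mul]
    have h := Ideal.mul_mem_mul (hc a) (hc b)
    rw [← pow_two] at h
    rw [← neg_mem_iff]
    convert h using 1
    ring)

open IsLocalRing in
theorem cotangentDerivation_apply_of_mem (K O : Type*) [Field K] [CommRing O] [IsLocalRing O]
    [Algebra K O] (hres : Function.Bijective (algebraMap K (ResidueField O)))
    (z : maximalIdeal O) : cotangentDerivation K O hres z = (maximalIdeal O).toCotangent z := by
  simp only [cotangentDerivation, Derivation.coe_mk', LinearMap.comp_apply,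
    LinearMap.restrictScalars_apply]
  congr 1
  ext
  have : residue O (z : O) = 0 := (residue_eq_zero_iff _).2 z.2
  simp [-residue_eq_zero_iff, this]

open IsLocalRing in
/-- A Noetherian local domain with residue field `K` whose module of differentials is free of
rank one is a discrete valuation ring: the derivation `cotangentDerivation` makes the cotangent
space a quotient of the module of differentials. -/
theorem isDiscreteValuationRing_of_basis (K O : Type*) [Field K] [CommRing O] [IsDomain O]
    [IsLocalRing O] [IsNoetherianRing O] [Algebra K O] (b : Module.Basis Unit O (Ω[O⁄K]))
    (hres : Function.Bijective (algebraMap K (ResidueField O))) :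
    IsDiscreteValuationRing O := by
  have hnf : ¬ IsField O := by
    intro hf
    let := hf.toField
    have h1 : Function.Surjective (algebraMap K O) := fun z => by
      obtain ⟨c, hc⟩ := hres.2 (algebraMap O _ z)
      refine ⟨c, ?_⟩
      rw [IsScalarTower.algebraMap_apply K O (ResidueField O)] at hc
      exact (algebraMap O (ResidueField O)).injective hc
    have : Subsingleton (Ω[O⁄K]) := KaehlerDifferential.subsingleton_of_surjective K O h1
    exact b.ne_zero () (Subsingleton.elim _ _)
  rw [← finrank_CotangentSpace_eq_one_iff]
  have hle : Module.finrank (ResidueField O) (CotangentSpace O) ≤ 1 := by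
    let δ := cotangentDerivation K O hres
    refine finrank_le_one (δ.liftKaehlerDifferential (b ())) fun w => ?_
    obtain ⟨z, rfl⟩ := (maximalIdeal O).toCotangent_surjective w
    rw [← cotangentDerivation_apply_of_mem K O hres, ← Derivation.liftKaehlerDifferential_comp_D]
    rw [← b.sum_repr (KaehlerDifferential.D K O z)]
    simp only [Finset.univ_unique, PUnit.default_eq_unit, Finset.sum_singleton, map_smul]
    exact ⟨residue O _, rfl⟩
  rcases Nat.le_one_iff_eq_zero_or_eq_one.1 hle with h | h
  · exact absurd (finrank_cotangentSpace_eq_zero_iff.1 h) hnf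
  · exact h

namespace Curve
variable {K : Type u} [Field K]

theorem ofHom_constants (C : Curve K) (x : C.X) :
    CommRingCat.ofHom (C.constants x) = (Scheme.ΓSpecIso (.of K)).inv ≫ C.str.appTop ≫
      C.X.presheaf.germ ⊤ x (TopologicalSpace.Opens.mem_top x) :=
  rfl

theorem fromSpecStalk_str (C : Curve K) (x : C.X) :
    C.X.fromSpecStalk x ≫ C.str = Spec.map (CommRingCat.ofHom (C.constants x)) := by
  have h1 : C.str = C.X.toSpecΓ ≫ Spec.map C.str.appTop ≫
      Spec.map (Scheme.ΓSpecIso (.of K)).inv := by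
    rw [← Scheme.toSpecΓ_naturality_assoc]
    simp
  rw [ofHom_constants, Spec.map_comp, Spec.map_comp]
  conv_lhs => rw [h1]
  rw [Scheme.fromSpecStalk_toSpecΓ_assoc, Category.assoc]

theorem exists_basis_kaehlerDifferential (C : Curve K) (x : C.X) :
    Nonempty (Module.Basis Unit (C.LocalRing x) (Ω[C.LocalRing x⁄K])) := by
  -- A standard smooth affine neighbourhood of `x`, where the differentials are free of rank one.
  obtain ⟨U, hU, V, hV, hx, e, hs⟩ :=
    SmoothOfRelativeDimension.exists_isStandardSmoothOfRelativeDimension (n := 1) (f := C.str) x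
  have hUt : U = ⊤ := by
    ext z
    simp only [TopologicalSpace.Opens.coe_top, Set.mem_univ, iff_true]
    rw [Subsingleton.elim z (C.str x)]
    exact e hx
  subst hUt
  let φ : K →+* Γ(C.X, V) :=
    ((Scheme.ΓSpecIso (.of K)).inv ≫ C.str.appLE ⊤ V e).hom
  have hφ : φ.IsStandardSmoothOfRelativeDimension 1 := by
    have := hs.comp (RingHom.IsStandardSmoothOfRelativeDimension.equiv
      (Scheme.ΓSpecIso (.of K)).symm.commRingCatIsoToRingEquiv)
    exact this
  let := φ.toAlgebra
  let : Algebra Γ(C.X, V) (C.LocalRing x) := (C.X.presheaf.germ V x hx).hom.toAlgebra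
  have : IsScalarTower K Γ(C.X, V) (C.LocalRing x) := by
    refine IsScalarTower.of_algebraMap_eq' ?_
    have h : CommRingCat.ofHom (C.constants x) =
        CommRingCat.ofHom φ ≫ C.X.presheaf.germ V x hx := by
      rw [ofHom_constants, CommRingCat.ofHom_hom, Scheme.Hom.appLE, Category.assoc, Category.assoc,
        C.X.presheaf.germ_res]
      rfl
    exact congrArg CommRingCat.Hom.hom h
  have : Algebra.IsStandardSmoothOfRelativeDimension 1 K Γ(C.X, V) := hφ
  have := hV.isLocalization_stalk ⟨x, hx⟩
  have : Nontrivial Γ(C.X, V) := (C.X.presheaf.germ V x hx).hom.domain_nontrivial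
  obtain ⟨_, _, _, _, ⟨P, hP⟩⟩ := ‹Algebra.IsStandardSmoothOfRelativeDimension 1 K Γ(C.X, V)›
  have := P.free_kaehlerDifferential
  have hr : Module.rank Γ(C.X, V) (Ω[Γ(C.X, V)⁄K]) = 1 := by
    simpa using Algebra.IsStandardSmoothOfRelativeDimension.rank_kaehlerDifferential (R := K)
      (S := Γ(C.X, V)) 1
  have b0 : Module.Basis Unit Γ(C.X, V) (Ω[Γ(C.X, V)⁄K]) :=
    Module.basisUnique Unit (Module.rank_eq_one_iff_finrank_eq_one.1 hr)
  exact ⟨b0.ofIsLocalizedModule (C.LocalRing x)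
    (hV.primeIdealOf ⟨x, hx⟩).asIdeal.primeCompl
    (KaehlerDifferential.map K K Γ(C.X, V) (C.LocalRing x))⟩

variable [IsAlgClosed K]

open IsLocalRing in
theorem bijective_algebraMap_residueField (C : Curve K) (P : C.Point) :
    Function.Bijective (algebraMap K (ResidueField (C.LocalRing P.1))) := by
  have h : (residueFieldIsoBase C.str P.1 P.2).inv =
      CommRingCat.ofHom (C.constants P.1) ≫ C.X.residue P.1 := by
    apply Spec.map_injective
    rw [Spec.map_comp, ← fromSpecStalk_str]
    exact (SpecMap_residueFieldIsoBase_inv C.str P.1 P.2).trans (Category.assoc _ _ _)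
  have h2 := ConcreteCategory.bijective_of_isIso (residueFieldIsoBase C.str P.1 P.2).inv
  rw [h] at h2
  exact h2

instance isDiscreteValuationRing (C : Curve K) (P : C.Point) :
    IsDiscreteValuationRing (C.LocalRing P.1) :=
  isDiscreteValuationRing_of_basis K _ (C.exists_basis_kaehlerDifferential P.1).some
    (C.bijective_algebraMap_residueField P)

theorem coheight_point (C : Curve K) (P : C.Point) : Order.coheight P.1 = 1 := by
  have := ringKrullDim_stalk_eq_coheight P.1
  rw [IsDiscreteValuationRing.ringKrullDim_eq_one] at this
  exact_mod_cast this.symm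

end Curve

/-! ### Points and places of the function field -/

/-- A discrete place of the field `L` over `K` with residue field `K`, given by its normalised
order function.  The value of `ord` at `0` is irrelevant. -/
structure Place (K L : Type*) [Field K] [Field L] [Algebra K L] where
  ord : L → ℤ
  ord_mul : ∀ {a b : L}, a ≠ 0 → b ≠ 0 → ord (a * b) = ord a + ord b
  min_le_ord_add : ∀ {a b : L}, a ≠ 0 → b ≠ 0 → a + b ≠ 0 → min (ord a) (ord b) ≤ ord (a + b)
  exists_ord_eq_one : ∃ t : L, t ≠ 0 ∧ ord t = 1
  exists_const : ∀ {a : L}, a ≠ 0 → 0 ≤ ord a →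
    ∃ c : K, a - algebraMap K L c ≠ 0 → 0 < ord (a - algebraMap K L c)
  ord_algebraMap : ∀ {c : K}, c ≠ 0 → ord (algebraMap K L c) = 0

namespace Curve
variable {K : Type u} [Field K]

theorem ofHom_algebraMap_stalk (C : Curve K) (x : C.X) :
    CommRingCat.ofHom (algebraMap (C.LocalRing x) C.FunctionField) =
      C.X.presheaf.stalkSpecializes ((genericPoint_spec C.X).specializes (Set.mem_univ _)) :=
  rfl

instance (C : Curve K) : CompactSpace C.X := by
  have : QuasiCompact C.str := inferInstance
  exact (quasiCompact_iff_compactSpace C.str).1 this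

instance (C : Curve K) : IsDominant (C.X.fromSpecStalk (genericPoint C.X)) := by
  constructor
  refine Dense.mono (s₁ := {genericPoint C.X}) ?_ ?_
  · rintro _ rfl
    rw [Scheme.range_fromSpecStalk]
    exact specializes_rfl
  · exact dense_iff_closure_eq.2 (genericPoint_spec C.X)

theorem exists_point_specializes (C : Curve K) (x : C.X) : ∃ P : C.Point, x ⤳ P.1 := by
  obtain ⟨y, hy, hc⟩ := isClosed_closure.exists_closed_singleton
    (⟨x, subset_closure rfl⟩ : (closure {x} : Set C.X).Nonempty)
  exact ⟨⟨y, hc⟩, specializes_iff_mem_closure.2 hy⟩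

variable [IsAlgClosed K]

theorem ord_eq_iff (C : Curve K) (P : C.Point) {h : C.FunctionField} (h0 : h ≠ 0) (n : ℤ) :
    C.ord h P = n ↔ Ring.ordFrac (C.LocalRing P.1) h = Multiplicative.ofAdd n :=
  Scheme.ord_eq_iff (C.coheight_point P) h0

theorem le_ord_iff (C : Curve K) (P : C.Point) {h : C.FunctionField} (h0 : h ≠ 0) (n : ℤ) :
    n ≤ C.ord h P ↔ ((Multiplicative.ofAdd n : Multiplicative ℤ) : WithZero (Multiplicative ℤ)) ≤
      Ring.ordFrac (C.LocalRing P.1) h :=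
  Scheme.le_ord_iff (C.coheight_point P) h0

theorem ord_nonneg_iff (C : Curve K) (P : C.Point) {h : C.FunctionField} (h0 : h ≠ 0) :
    0 ≤ C.ord h P ↔ ∃ z : C.LocalRing P.1, algebraMap _ C.FunctionField z = h := by
  constructor
  · intro h1
    rcases ValuationRing.isInteger_or_isInteger (C.LocalRing P.1) h with ⟨z, hz⟩ | ⟨z, hz⟩
    · exact ⟨z, hz⟩
    · have hz0 : z ≠ 0 := by
        rintro rfl
        rw [map_zero] at hz
        exact inv_ne_zero h0 hz.symm
      have h2 : 0 ≤ C.ord h⁻¹ P := by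
        rw [le_ord_iff C P (inv_ne_zero h0), ← hz]
        exact Ring.ordFrac_ge_one_of_ne_zero hz0
      have h3 : C.ord (h * h⁻¹) P = C.ord h P + C.ord h⁻¹ P :=
        Scheme.ord_mul h0 (inv_ne_zero h0)
      rw [mul_inv_cancel₀ h0] at h3
      have h4 : C.ord (1 : C.FunctionField) P = 0 := by
        rw [ord_eq_iff C P one_ne_zero, map_one]; rfl
      have h5 : C.ord h⁻¹ P = 0 := by omega
      rw [ord_eq_iff C P (inv_ne_zero h0), ← hz] at h5
      have h6 : IsUnit z := Ring.isUnit_iff_ordFrac_one_of_isDiscreteValuationRing.2 h5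
      obtain ⟨w, rfl⟩ := h6
      refine ⟨(w⁻¹ : (C.LocalRing P.1)ˣ), ?_⟩
      refine (mul_inv_eq_one₀ h0).1 ?_
      rw [← hz, ← map_mul]
      simp
  · rintro ⟨z, rfl⟩
    rw [le_ord_iff C P h0]
    exact Ring.ordFrac_ge_one_of_ne_zero (by rintro rfl; exact h0 (map_zero _))

theorem ord_pos_iff (C : Curve K) (P : C.Point) (z : C.LocalRing P.1) (h0 : z ≠ 0) :
    0 < C.ord (algebraMap _ C.FunctionField z) P ↔ z ∈ IsLocalRing.maximalIdeal _ := by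
  have h1 : algebraMap _ C.FunctionField z ≠ 0 := by
    rwa [Ne, FaithfulSMul.algebraMap_eq_zero_iff]
  have h2 := (C.ord_nonneg_iff P h1).2 ⟨z, rfl⟩
  have h3 : C.ord (algebraMap _ C.FunctionField z) P = 0 ↔ IsUnit z := by
    rw [ord_eq_iff C P h1]
    exact (Ring.isUnit_iff_ordFrac_one_of_isDiscreteValuationRing
      (R := C.LocalRing P.1) (K := C.FunctionField) (x := z)).symm
  rw [IsLocalRing.mem_maximalIdeal, mem_nonunits_iff, ← h3]
  omega

/-- The place of the function field given by a point of a curve. -/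
noncomputable def place (C : Curve K) (P : C.Point) : Place K C.FunctionField where
  ord h := C.ord h P
  ord_mul h1 h2 := Scheme.ord_mul h1 h2
  min_le_ord_add _ _ h := Scheme.ord_add h
  exists_ord_eq_one := by
    obtain ⟨t, ht⟩ := IsDiscreteValuationRing.exists_irreducible (C.LocalRing P.1)
    have h1 : algebraMap _ C.FunctionField t ≠ 0 := by
      rw [Ne, FaithfulSMul.algebraMap_eq_zero_iff]
      exact ht.ne_zero
    exact ⟨_, h1, (C.ord_eq_iff P h1 1).2 (Ring.ordFrac_irreducible ht)⟩
  exists_const := by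
    intro a h0 ha
    obtain ⟨z, rfl⟩ := (C.ord_nonneg_iff P h0).1 ha
    obtain ⟨c, hc⟩ := (C.bijective_algebraMap_residueField P).2 (IsLocalRing.residue _ z)
    refine ⟨c, fun hne => ?_⟩
    rw [IsScalarTower.algebraMap_apply K (C.LocalRing P.1) C.FunctionField, ← map_sub] at hne ⊢
    rw [C.ord_pos_iff P _ (by rintro h; rw [h, map_zero] at hne; exact hne rfl),
      ← IsLocalRing.residue_eq_zero_iff, map_sub, ← hc]
    exact sub_self _
  ord_algebraMap := by
    intro c hc
    rw [C.ord_eq_iff P (by simpa using hc), IsScalarTower.algebraMap_apply K (C.LocalRing P.1)]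
    exact (Ring.isUnit_iff_ordFrac_one_of_isDiscreteValuationRing
      (R := C.LocalRing P.1) (K := C.FunctionField)).1 ((isUnit_iff_ne_zero.2 hc).map _)

/-- Properness, in valuation-theoretic form: a nontrivial valuation ring of the function field over
`K` is the local ring of a point. -/
theorem exists_point_of_valuationSubring (C : Curve K) (V : ValuationSubring C.FunctionField)
    (hK : ∀ c : K, algebraMap K C.FunctionField c ∈ V) (hV : V ≠ ⊤) :
    ∃ P : C.Point, ∀ z : C.FunctionField, z ≠ 0 → (z ∈ V ↔ 0 ≤ C.ord z P) := by
  let κ : K →+* V := (algebraMap K C.FunctionField).codRestrict V.toSubring hK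
  -- The valuative criterion extends the generic point to `Spec V`; `P` is a closed point in the
  -- closure of the image `x` of the closed point of `Spec V`.
  let S : ValuativeCommSq C.str :=
    { R := V
      K := C.FunctionField
      i₁ := C.X.fromSpecStalk (genericPoint C.X)
      i₂ := Spec.map (CommRingCat.ofHom κ)
      commSq := ⟨by
        rw [fromSpecStalk_str, ← Spec.map_comp]
        rfl⟩ }
  have hS : S.commSq.HasLift :=
    (UniversallyClosed.eq_valuativeCriterion ▸ (inferInstance : UniversallyClosed C.str)).1 S
  obtain ⟨⟨l, hl, -⟩⟩ := hS.exists_lift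
  let x := l (IsLocalRing.closedPoint V)
  have h1 : (algebraMap V C.FunctionField).comp (Scheme.stalkClosedPointTo l).hom =
      algebraMap (C.LocalRing x) C.FunctionField := by
    have : Scheme.stalkClosedPointTo l ≫ CommRingCat.ofHom (algebraMap V C.FunctionField) =
        CommRingCat.ofHom (algebraMap (C.LocalRing x) C.FunctionField) := by
      apply Spec.map_injective
      rw [← cancel_mono (C.X.fromSpecStalk x), Spec.map_comp, Category.assoc,
        Scheme.Spec_stalkClosedPointTo_fromSpecStalk, ofHom_algebraMap_stalk,
        Scheme.SpecMap_stalkSpecializes_fromSpecStalk]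
      exact hl
    exact congrArg CommRingCat.Hom.hom this
  obtain ⟨P, hP⟩ := C.exists_point_specializes x
  have h2 : ∀ z : C.FunctionField, z ≠ 0 → 0 ≤ C.ord z P → z ∈ V := by
    intro z hz h
    obtain ⟨w, rfl⟩ := (C.ord_nonneg_iff P hz).1 h
    have h3 : algebraMap (C.LocalRing P.1) C.FunctionField w =
        algebraMap (C.LocalRing x) C.FunctionField (C.X.presheaf.stalkSpecializes hP w) := by
      have : CommRingCat.ofHom (algebraMap (C.LocalRing P.1) C.FunctionField) =
          C.X.presheaf.stalkSpecializes hP ≫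
            CommRingCat.ofHom (algebraMap (C.LocalRing x) C.FunctionField) :=
        (TopCat.Presheaf.stalkSpecializes_comp C.X.presheaf
          ((genericPoint_spec C.X).specializes (Set.mem_univ x)) hP).symm
      exact congrArg (fun f => f.hom w) this
    rw [h3, ← h1]
    exact ((Scheme.stalkClosedPointTo l).hom _ : V).2
  refine ⟨P, fun z hz => ⟨fun hzV => ?_, h2 z hz⟩⟩
  -- Otherwise `V` contains a function `z` with a pole at `P`, and with it every function `w`, since
  -- `w / z ^ k` is regular at `P` for large `k`.
  by_contra hneg
  apply hV
  rw [eq_top_iff]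
  rintro w -
  by_cases hw : w = 0
  · rw [hw]; exact V.zero_mem
  let p := C.place P
  have hzi : z⁻¹ ≠ 0 := inv_ne_zero hz
  have hinv : p.ord z⁻¹ = - p.ord z := by
    have := p.ord_mul hz hzi
    rw [mul_inv_cancel₀ hz, ← map_one (algebraMap K _), p.ord_algebraMap one_ne_zero] at this
    omega
  have hpow : ∀ n : ℕ, p.ord (z⁻¹ ^ n) = n * p.ord z⁻¹ := by
    intro n
    induction n with
    | zero => simpa using p.ord_algebraMap (one_ne_zero (α := K))
    | succ n ih => rw [pow_succ, p.ord_mul (pow_ne_zero _ hzi) hzi, ih]; push_cast; ring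
  have hz' : p.ord z < 0 := not_le.1 hneg
  have h3 : w * z⁻¹ ^ (p.ord w).natAbs ∈ V := by
    refine h2 _ (mul_ne_zero hw (pow_ne_zero _ hzi)) ?_
    change 0 ≤ p.ord _
    rw [p.ord_mul hw (pow_ne_zero _ hzi), hpow, hinv]
    have h4 : (1 : ℤ) ≤ - p.ord z := by omega
    have h5 : ((p.ord w).natAbs : ℤ) * 1 ≤ (p.ord w).natAbs * (- p.ord z) :=
      mul_le_mul_of_nonneg_left h4 (by positivity)
    omega
  have h6 := V.mul_mem _ _ h3 (V.pow_mem hzV (p.ord w).natAbs)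
  rwa [mul_assoc, ← mul_pow, inv_mul_cancel₀ hz, one_pow, mul_one] at h6

end Curve

/-! ### Curves with isomorphic function fields -/

namespace Curve
variable {K : Type u} [Field K]

instance (C : Curve K) : C.X.IsSeparated :=
  ⟨by
    rw [← Limits.terminal.comp_from C.str]
    infer_instance⟩

/-- Morphisms from a curve to a separated scheme which agree at the generic point are equal. -/
theorem hom_ext (C : Curve K) {Y : Scheme.{u}} [Y.IsSeparated] {f g : C.X ⟶ Y}
    (h : C.X.fromSpecStalk (genericPoint C.X) ≫ f = C.X.fromSpecStalk (genericPoint C.X) ≫ g) :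
    f = g :=
  ext_of_isDominant (C.X.fromSpecStalk (genericPoint C.X)) h

theorem isIso_ι_of_eq_top {X : Scheme.{u}} {U : X.Opens} (h : U = ⊤) : IsIso U.ι := by
  subst h
  exact (inferInstance : IsIso X.topIso.hom)

theorem SpecMap_fromSpecStalk (C : Curve K) (x : C.X) :
    Spec.map (CommRingCat.ofHom (algebraMap (C.LocalRing x) C.FunctionField)) ≫
      C.X.fromSpecStalk x = C.X.fromSpecStalk (genericPoint C.X) :=
  C.X.SpecMap_stalkSpecializes_fromSpecStalk ((genericPoint_spec C.X).specializes (Set.mem_univ x))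

theorem SpecMap_fromSpecStalkOfMem (C : Curve K) {Y : Scheme.{u}} (f : C.X.PartialMap Y) {x : C.X}
    (hx : x ∈ f.domain) :
    Spec.map (CommRingCat.ofHom (algebraMap (C.LocalRing x) C.FunctionField)) ≫
      f.fromSpecStalkOfMem hx = f.fromFunctionField := by
  simp only [Scheme.PartialMap.fromFunctionField, Scheme.PartialMap.fromSpecStalkOfMem]
  rw [← Category.assoc]
  congr 1
  rw [← cancel_mono f.domain.ι, Category.assoc, Scheme.Opens.fromSpecStalkOfMem_ι,
    Scheme.Opens.fromSpecStalkOfMem_ι, SpecMap_fromSpecStalk]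

/-- The local homomorphism `O_Q → O_P` induced by an embedding of function fields. -/
theorem exists_stalk_hom (C D : Curve K) (θ : D.FunctionField →ₐ[K] C.FunctionField)
    (x : C.X) (y : D.X) (h : ∀ z : D.LocalRing y, ∃ w : C.LocalRing x,
      algebraMap _ C.FunctionField w = θ (algebraMap _ D.FunctionField z)) :
    ∃ ψ : D.LocalRing y →+* C.LocalRing x,
      (algebraMap (C.LocalRing x) C.FunctionField).comp ψ =
        θ.toRingHom.comp (algebraMap (D.LocalRing y) D.FunctionField) := by
  have hinj : Function.Injective (algebraMap (C.LocalRing x) C.FunctionField) :=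
    FaithfulSMul.algebraMap_injective _ _
  choose ψ hψ using h
  refine ⟨{ toFun := ψ, map_one' := hinj ?_, map_zero' := hinj ?_, map_add' := fun a b => hinj ?_,
            map_mul' := fun a b => hinj ?_ }, RingHom.ext hψ⟩ <;> simp [hψ]

variable [IsAlgClosed K]

/-- An isomorphism of function fields is induced by a morphism of curves: the rational map that it
defines extends to every point `P`, because the local ring at `P` corresponds to the local ring of a
point `Q` of the other curve. -/
theorem exists_hom (C D : Curve K) (θ : D.FunctionField ≃ₐ[K] C.FunctionField) :
    ∃ f : C.X ⟶ D.X, f ≫ D.str = C.str ∧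
      C.X.fromSpecStalk (genericPoint C.X) ≫ f =
        Spec.map (CommRingCat.ofHom (θ : D.FunctionField →ₐ[K] C.FunctionField).toRingHom) ≫
          D.X.fromSpecStalk (genericPoint D.X) := by
  set g := Spec.map (CommRingCat.ofHom (θ : D.FunctionField →ₐ[K] C.FunctionField).toRingHom) ≫
          D.X.fromSpecStalk (genericPoint D.X) with hg
  have hgs : g ≫ D.str = C.X.fromSpecStalk _ ≫ C.str := by
    rw [hg, Category.assoc, fromSpecStalk_str, fromSpecStalk_str, ← Spec.map_comp,
      ← CommRingCat.ofHom_comp]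
    congr 2
    exact (θ : D.FunctionField →ₐ[K] C.FunctionField).comp_algebraMap
  let r : C.X ⤏ D.X := Scheme.RationalMap.ofFunctionField C.str D.str g hgs
  have hr : r.fromFunctionField = g :=
    Scheme.RationalMap.fromFunctionField_ofFunctionField C.str D.str g hgs
  have hmem : ∀ P : C.Point, P.1 ∈ r.domain := by
    intro P
    let V : ValuationSubring D.FunctionField :=
      (ValuationRing.valuation (C.LocalRing P.1) C.FunctionField).valuationSubring.comap
        (θ : D.FunctionField →ₐ[K] C.FunctionField).toRingHom
    have hmV : ∀ z, z ∈ V ↔ ∃ w : C.LocalRing P.1, algebraMap _ C.FunctionField w = θ z := by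
      intro z
      exact ValuationRing.mem_integer_iff _ _ _
    obtain ⟨Q, hQ⟩ := D.exists_point_of_valuationSubring V (fun c => by
      rw [hmV]
      exact ⟨algebraMap K _ c, by
        rw [← IsScalarTower.algebraMap_apply K (C.LocalRing P.1) C.FunctionField,
          AlgEquiv.commutes]⟩)
      (fun htop => by
        obtain ⟨t, ht0, ht⟩ := (C.place P).exists_ord_eq_one
        have h1 : C.ord t⁻¹ P < 0 := by
          have := (C.place P).ord_mul ht0 (inv_ne_zero ht0)
          rw [mul_inv_cancel₀ ht0, ← map_one (algebraMap K _),
            (C.place P).ord_algebraMap one_ne_zero, ht] at this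
          change 0 = 1 + C.ord t⁻¹ P at this
          omega
        have h2 : θ.symm t⁻¹ ∈ V := htop ▸ trivial
        rw [hmV, AlgEquiv.apply_symm_apply, ← C.ord_nonneg_iff P (inv_ne_zero ht0)] at h2
        omega)
    obtain ⟨ψ, hψ⟩ := exists_stalk_hom C D (θ : D.FunctionField →ₐ[K] C.FunctionField) P.1 Q.1
      (fun z => by
        by_cases hz : z = 0
        · exact ⟨0, by simp [hz]⟩
        refine (hmV _).1 ((hQ _ ?_).2 ((D.ord_nonneg_iff Q ?_).2 ⟨z, rfl⟩)) <;>
        rwa [Ne, FaithfulSMul.algebraMap_eq_zero_iff])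
    have hψK : CommRingCat.ofHom (D.constants Q.1) ≫ CommRingCat.ofHom ψ =
        CommRingCat.ofHom (C.constants P.1) := by
      rw [← CommRingCat.ofHom_comp]
      congr 1
      ext c
      apply FaithfulSMul.algebraMap_injective (C.LocalRing P.1) C.FunctionField
      have := congrArg (fun f => f (algebraMap K _ c)) hψ
      simp only [RingHom.comp_apply] at this
      refine this.trans ?_
      rw [← IsScalarTower.algebraMap_apply]
      refine (θ.commutes c).trans ?_
      exact IsScalarTower.algebraMap_apply K (C.LocalRing P.1) C.FunctionField c
    have hcomm : (Spec.map (CommRingCat.ofHom ψ) ≫ D.X.fromSpecStalk Q.1) ≫ D.str =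
        C.X.fromSpecStalk P.1 ≫ C.str := by
      rw [Category.assoc, fromSpecStalk_str, fromSpecStalk_str, ← Spec.map_comp, hψK]
    let p : C.X.PartialMap D.X := Scheme.PartialMap.ofFromSpecStalk C.str D.str _ hcomm
    have hpP : P.1 ∈ p.domain := Scheme.PartialMap.mem_domain_ofFromSpecStalk C.str D.str _ hcomm
    rw [Scheme.RationalMap.mem_domain]
    refine ⟨p, hpP, Scheme.RationalMap.eq_of_fromFunctionField_eq _ _ ?_⟩
    rw [hr, Scheme.RationalMap.fromFunctionField_toRationalMap,
      ← C.SpecMap_fromSpecStalkOfMem p hpP,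
      Scheme.PartialMap.fromSpecStalkOfMem_ofFromSpecStalk, hg, ← D.SpecMap_fromSpecStalk Q.1,
      ← Category.assoc, ← Category.assoc, ← Spec.map_comp, ← Spec.map_comp,
      ← CommRingCat.ofHom_comp, ← CommRingCat.ofHom_comp, hψ]
  have htop : r.domain = ⊤ := by
    rw [eq_top_iff]
    rintro x -
    obtain ⟨P, hP⟩ := C.exists_point_specializes x
    exact hP.mem_open r.domain.2 (hmem P)
  have hiso : IsIso r.toPartialMap.domain.ι := isIso_ι_of_eq_top htop
  let f : C.X ⟶ D.X := inv r.toPartialMap.domain.ι ≫ r.toPartialMap.hom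
  have hf : C.X.fromSpecStalk (genericPoint C.X) ≫ f = g := by
    rw [← hr]
    conv_rhs => rw [← r.toRationalMap_toPartialMap]
    rw [Scheme.RationalMap.fromFunctionField_toRationalMap, Scheme.PartialMap.fromFunctionField,
      Scheme.PartialMap.fromSpecStalkOfMem]
    have h1 : r.toPartialMap.hom = r.toPartialMap.domain.ι ≫ f := (IsIso.hom_inv_id_assoc _ _).symm
    rw [h1]
    refine Eq.trans ?_ (Category.assoc _ _ _)
    rw [Scheme.Opens.fromSpecStalkOfMem_ι]
  refine ⟨f, C.hom_ext ?_, hf⟩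
  rw [← Category.assoc, hf, hgs]

/-- Two curves whose function fields are isomorphic over `K` are isomorphic; the isomorphism sends
`P` to `Q` as soon as the local ring at `Q` is mapped into the local ring at `P`. -/
theorem exists_iso (C D : Curve K) (θ : D.FunctionField ≃ₐ[K] C.FunctionField) :
    ∃ φ : C.X ≅ D.X, φ.hom ≫ D.str = C.str ∧ ∀ (P : C.Point) (Q : D.Point),
      (∀ z : D.FunctionField, z ≠ 0 → 0 ≤ D.ord z Q → 0 ≤ C.ord (θ z) P) → φ.hom P.1 = Q.1 := by
  obtain ⟨f, hf, hfg⟩ := exists_hom C D θ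
  obtain ⟨f', hf', hfg'⟩ := exists_hom D C θ.symm
  have h1 : f ≫ f' = 𝟙 _ := by
    refine C.hom_ext ?_
    rw [← Category.assoc, hfg, Category.assoc, hfg', ← Category.assoc, ← Spec.map_comp,
      ← CommRingCat.ofHom_comp]
    have : (θ : D.FunctionField →ₐ[K] C.FunctionField).toRingHom.comp
        (θ.symm : C.FunctionField →ₐ[K] D.FunctionField).toRingHom = RingHom.id _ :=
      RingHom.ext fun z => θ.apply_symm_apply z
    rw [this, CommRingCat.ofHom_id, Spec.map_id]
    exact (Category.id_comp _).trans (Category.comp_id _).symm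
  have h2 : f' ≫ f = 𝟙 _ := by
    refine D.hom_ext ?_
    rw [← Category.assoc, hfg', Category.assoc, hfg, ← Category.assoc, ← Spec.map_comp,
      ← CommRingCat.ofHom_comp]
    have : (θ.symm : C.FunctionField →ₐ[K] D.FunctionField).toRingHom.comp
        (θ : D.FunctionField →ₐ[K] C.FunctionField).toRingHom = RingHom.id _ :=
      RingHom.ext fun z => θ.symm_apply_apply z
    rw [this, CommRingCat.ofHom_id, Spec.map_id]
    exact (Category.id_comp _).trans (Category.comp_id _).symm
  let φ : C.X ≅ D.X := ⟨f, f', h1, h2⟩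
  refine ⟨φ, hf, fun P Q h => ?_⟩
  obtain ⟨ψ, hψ⟩ := exists_stalk_hom C D (θ : D.FunctionField →ₐ[K] C.FunctionField) P.1 Q.1
    (fun z => by
      by_cases hz : z = 0
      · exact ⟨0, by simp [hz]⟩
      have hz' : algebraMap (D.LocalRing Q.1) D.FunctionField z ≠ 0 := by
        rwa [Ne, FaithfulSMul.algebraMap_eq_zero_iff]
      exact (C.ord_nonneg_iff P ((map_ne_zero θ).2 hz')).1
        (h _ hz' ((D.ord_nonneg_iff Q hz').2 ⟨z, rfl⟩)))
  have h3 : C.X.fromSpecStalk P.1 ≫ f = Spec.map (CommRingCat.ofHom ψ) ≫ D.X.fromSpecStalk Q.1 := by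
    have hdom : IsDominant
        (Spec.map (CommRingCat.ofHom (algebraMap (C.LocalRing P.1) C.FunctionField))) := by
      constructor
      refine (PrimeSpectrum.denseRange_comap_iff_ker_le_nilRadical
        (algebraMap (C.LocalRing P.1) C.FunctionField)).2 ?_
      rw [(RingHom.injective_iff_ker_eq_bot (algebraMap (C.LocalRing P.1) C.FunctionField)).1
        (FaithfulSMul.algebraMap_injective _ _)]
      exact bot_le
    have : IsReduced (Spec (CommRingCat.of (C.LocalRing P.1))) := inferInstance
    refine @ext_of_isDominant _ (Spec (CommRingCat.of (C.LocalRing P.1))) _ _ _ _ _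
      (Spec.map (CommRingCat.ofHom (algebraMap (C.LocalRing P.1) C.FunctionField))) hdom ?_
    rw [← Category.assoc, SpecMap_fromSpecStalk, hfg, ← D.SpecMap_fromSpecStalk Q.1,
      ← Category.assoc, ← Category.assoc, ← Spec.map_comp, ← Spec.map_comp,
      ← CommRingCat.ofHom_comp, ← CommRingCat.ofHom_comp, hψ]
  -- `f P` is a closed point that specializes to `Q`.
  have h4 : f P.1 ⤳ Q.1 := by
    have h5 := congrArg (fun k => k (IsLocalRing.closedPoint (C.LocalRing P.1))) h3
    have h6 : f P.1 ∈ Set.range (D.X.fromSpecStalk Q.1) := by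
      refine ⟨Spec.map (CommRingCat.ofHom ψ) (IsLocalRing.closedPoint (C.LocalRing P.1)), ?_⟩
      refine h5.symm.trans ?_
      exact congrArg f Scheme.fromSpecStalk_closedPoint
    rwa [Scheme.range_fromSpecStalk] at h6
  have h7 : IsClosed {f P.1} := by
    have := (Scheme.homeoOfIso φ).isClosedMap _ P.2
    rwa [Set.image_singleton] at this
  have h8 := specializes_iff_mem_closure.1 h4
  rw [h7.closure_eq] at h8
  exact h8.symm

/-- Separatedness, in valuation-theoretic form: the identity of `C` maps `P` to `P`, and to `Q` if
the local ring at `Q` is contained in the local ring at `P`. -/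
theorem point_ext (C : Curve K) {P Q : C.Point}
    (h : ∀ z : C.FunctionField, z ≠ 0 → 0 ≤ C.ord z Q → 0 ≤ C.ord z P) : P = Q := by
  obtain ⟨φ, -, hφ⟩ := exists_iso C C AlgEquiv.refl
  exact Subtype.ext ((hφ P P fun _ _ h => h).symm.trans (hφ P Q h))

end Curve

open Polynomial

/-! ### Places and equations of hyperelliptic curves -/

namespace Place
variable {K L : Type*} [Field K] [Field L] [Algebra K L] (v : Place K L)

/-- `v.Ge k a` says that `a` vanishes to order at least `k`; it holds for `a = 0`. -/
def Ge (k : ℤ) (a : L) : Prop := a ≠ 0 → k ≤ v.ord a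

variable {v}

theorem Ge.zero {k : ℤ} : v.Ge k 0 := fun h => absurd rfl h

theorem Ge.mono {k l : ℤ} {a : L} (h : v.Ge k a) (hl : l ≤ k) : v.Ge l a :=
  fun h0 => hl.trans (h h0)

theorem Ge.add {k : ℤ} {a b : L} (ha : v.Ge k a) (hb : v.Ge k b) : v.Ge k (a + b) := by
  intro h
  by_cases h1 : a = 0
  · subst h1; simp only [zero_add] at h ⊢; exact hb h
  by_cases h2 : b = 0
  · subst h2; simp only [add_zero] at h ⊢; exact ha h
  exact (le_min (ha h1) (hb h2)).trans (v.min_le_ord_add h1 h2 h)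

theorem Ge.mul {k l : ℤ} {a b : L} (ha : v.Ge k a) (hb : v.Ge l b) : v.Ge (k + l) (a * b) := by
  intro h
  have h1 := left_ne_zero_of_mul h
  have h2 := right_ne_zero_of_mul h
  rw [v.ord_mul h1 h2]
  exact add_le_add (ha h1) (hb h2)

theorem ge_algebraMap (c : K) : v.Ge 0 (algebraMap K L c) := by
  intro h
  rw [v.ord_algebraMap (by simpa using h)]

theorem Ge.mul_left {k : ℤ} {a b : L} (ha : v.Ge 0 a) (hb : v.Ge k b) : v.Ge k (a * b) := by
  simpa using ha.mul hb

theorem Ge.mul_right {k : ℤ} {a b : L} (ha : v.Ge k a) (hb : v.Ge 0 b) : v.Ge k (a * b) := by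
  simpa using ha.mul hb

theorem Ge.neg {k : ℤ} {a : L} (ha : v.Ge k a) : v.Ge k (-a) := by
  have := (ge_algebraMap (v := v) (-1 : K)).mul_left ha
  simpa using this

theorem Ge.sub {k : ℤ} {a b : L} (ha : v.Ge k a) (hb : v.Ge k b) : v.Ge k (a - b) := by
  rw [sub_eq_add_neg]; exact ha.add hb.neg

variable (v)

theorem ord_one : v.ord (1 : L) = 0 := by
  rw [← map_one (algebraMap K L)]; exact v.ord_algebraMap one_ne_zero

theorem ord_inv {a : L} (ha : a ≠ 0) : v.ord a⁻¹ = - v.ord a := by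
  have := v.ord_mul ha (inv_ne_zero ha)
  rw [mul_inv_cancel₀ ha, ord_one] at this
  omega

theorem ord_pow {a : L} (ha : a ≠ 0) (n : ℕ) : v.ord (a ^ n) = n * v.ord a := by
  induction n with
  | zero => simpa using ord_one v
  | succ n ih => rw [pow_succ, v.ord_mul (pow_ne_zero _ ha) ha, ih]; push_cast; ring

theorem ord_neg {a : L} : v.ord (-a) = v.ord a := by
  by_cases ha : a = 0
  · simp [ha]
  have h : v.ord (-1 : L) = 0 := by
    have := v.ord_algebraMap (c := (-1 : K)) (by simp)
    simpa using this
  rw [← neg_one_mul, v.ord_mul (by simp) ha, h, zero_add]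

variable {v}

/-- If `b` vanishes to higher order than `a`, then `a + b` has the order of `a`. -/
theorem ord_add_eq {a b : L} (ha : a ≠ 0) (hb : v.Ge (v.ord a + 1) b) :
    a + b ≠ 0 ∧ v.ord (a + b) = v.ord a := by
  have hne : a + b ≠ 0 := by
    intro h
    have hb' : b = -a := by linear_combination h
    subst hb'
    have := hb (neg_ne_zero.2 ha)
    rw [ord_neg] at this
    omega
  refine ⟨hne, le_antisymm ?_ ?_⟩
  · by_contra hlt
    push Not at hlt
    have h1 : v.Ge (v.ord a + 1) (a + b) := fun _ => hlt
    have h2 := h1.sub hb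
    rw [add_sub_cancel_right] at h2
    have := h2 ha
    omega
  · have h1 : v.Ge (v.ord a) a := fun _ => le_rfl
    exact h1.add (hb.mono (by omega)) hne

theorem eq_zero_of_ge {c : K} (h : v.Ge 1 (algebraMap K L c)) : c = 0 := by
  by_contra hc
  have := h (by simpa using hc)
  rw [v.ord_algebraMap hc] at this
  omega

theorem exists_value {a : L} (ha : v.Ge 0 a) : ∃ c : K, v.Ge 1 (a - algebraMap K L c) := by
  by_cases h0 : a = 0
  · exact ⟨0, by simpa [h0] using Ge.zero⟩
  · obtain ⟨c, hc⟩ := v.exists_const h0 (ha h0)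
    exact ⟨c, fun h => hc h⟩

theorem ge_aeval {x : L} (hx : v.Ge 0 x) (f : K[X]) : v.Ge 0 (aeval x f) := by
  induction f using Polynomial.induction_on' with
  | add p q hp hq => rw [map_add]; exact hp.add hq
  | monomial n c =>
    rw [aeval_monomial]
    refine (ge_algebraMap c).mul_left ?_
    intro h
    by_cases hn : n = 0
    · subst hn; simpa using (ord_one v).ge
    have hx0 : x ≠ 0 := by rintro rfl; exact h (zero_pow hn)
    rw [ord_pow v hx0]
    exact mul_nonneg (by positivity) (hx hx0)

theorem ge_aeval_sub {x : L} {a : K} (hx : v.Ge 1 (x - algebraMap K L a)) (hx0 : v.Ge 0 x)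
    (f : K[X]) : v.Ge 1 (aeval x f - algebraMap K L (f.eval a)) := by
  obtain ⟨g, hg⟩ := X_sub_C_dvd_sub_C_eval (a := a) (p := f)
  have : aeval x f - algebraMap K L (f.eval a) = (x - algebraMap K L a) * aeval x g := by
    have := congrArg (aeval x) hg
    simpa using this
  rw [this]
  exact hx.mul_right (ge_aeval hx0 g)

end Place

/-- `L` is the function field of the curve `y² = f(x)` over `K`, with `f` separable: every element
of `L` is of the form `(p(x) + q(x) y) / r(x)`, and `1`, `y` are linearly independent over
`K(x)`. -/
structure IsQuadraticModel {K L : Type*} [Field K] [Field L] [Algebra K L] (x y : L) (f : K[X]) :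
    Prop where
  sq : y ^ 2 = aeval x f
  separable : f.Separable
  exists_repr : ∀ z : L, ∃ p q r : K[X], r ≠ 0 ∧ z * aeval x r = aeval x p + aeval x q * y
  eq_zero : ∀ p q : K[X], aeval x p + aeval x q * y = 0 → p = 0 ∧ q = 0

namespace IsQuadraticModel
variable {K L : Type*} [Field K] [Field L] [Algebra K L] {x y : L} {f : K[X]}

theorem aeval_ne_zero (M : IsQuadraticModel x y f) {p : K[X]} (hp : p ≠ 0) : aeval x p ≠ 0 :=
  fun h => hp (M.eq_zero p 0 (by simpa using h)).1

theorem y_ne_zero (M : IsQuadraticModel x y f) : y ≠ 0 := by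
  intro h
  exact one_ne_zero (M.eq_zero 0 1 (by simpa using h)).2

theorem sub_ne_zero (M : IsQuadraticModel x y f) (a : K) : x - algebraMap K L a ≠ 0 := by
  have := M.aeval_ne_zero (X_sub_C_ne_zero a)
  simpa using this

/-- The coordinate ring `K[x, y]`. -/
theorem mem_adjoin_iff (M : IsQuadraticModel x y f) {z : L} :
    z ∈ Algebra.adjoin K {x, y} ↔ ∃ p q : K[X], z = aeval x p + aeval x q * y := by
  constructor
  · intro hz
    induction hz using Algebra.adjoin_induction with
    | mem z hz =>
      rcases hz with rfl | rfl
      · exact ⟨X, 0, by simp⟩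
      · exact ⟨0, 1, by simp⟩
    | algebraMap c => exact ⟨C c, 0, by simp⟩
    | add a b _ _ ha hb =>
      obtain ⟨p, q, rfl⟩ := ha
      obtain ⟨p', q', rfl⟩ := hb
      exact ⟨p + p', q + q', by simp; ring⟩
    | mul a b _ _ ha hb =>
      obtain ⟨p, q, rfl⟩ := ha
      obtain ⟨p', q', rfl⟩ := hb
      refine ⟨p * p' + q * q' * f, p * q' + p' * q, ?_⟩
      simp only [map_add, map_mul, ← M.sq]
      ring
  · rintro ⟨p, q, rfl⟩
    have hx : x ∈ Algebra.adjoin K {x, y} := Algebra.subset_adjoin (by simp)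
    have hy : y ∈ Algebra.adjoin K {x, y} := Algebra.subset_adjoin (by simp)
    exact add_mem (aeval_mem _ hx p) (mul_mem (aeval_mem _ hx q) hy)
where
  aeval_mem (S : Subalgebra K L) {x : L} (hx : x ∈ S) (p : K[X]) : aeval x p ∈ S := by
    have := (aeval (⟨x, hx⟩ : S) p).2
    rwa [← Subalgebra.coe_val, ← Polynomial.aeval_algHom_apply] at this

end IsQuadraticModel

/-! ### Local rings at the finite places -/
namespace IsQuadraticModel
variable {K L : Type*} [Field K] [Field L] [Algebra K L] {x y : L} {f : K[X]} {v : Place K L}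

open scoped Classical

theorem ge_y (M : IsQuadraticModel x y f) (hx : v.Ge 0 x) : v.Ge 0 y := by
  intro hy
  have h := v.ge_aeval hx f
  rw [← M.sq] at h
  have := h (pow_ne_zero 2 hy)
  rw [v.ord_pow hy] at this
  push_cast at this
  omega

theorem ge_of_mem_adjoin (M : IsQuadraticModel x y f) (hx : v.Ge 0 x) {z : L}
    (hz : z ∈ Algebra.adjoin K {x, y}) : v.Ge 0 z := by
  obtain ⟨p, q, rfl⟩ := M.mem_adjoin_iff.1 hz
  exact (v.ge_aeval hx p).add ((v.ge_aeval hx q).mul_left (M.ge_y hx))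

/-- The values `a`, `b` of `x`, `y` at a place satisfy the equation of the curve. -/
theorem sq_eq_eval (M : IsQuadraticModel x y f) {a b : K} (hx0 : v.Ge 0 x)
    (hx : v.Ge 1 (x - algebraMap K L a)) (hy : v.Ge 1 (y - algebraMap K L b)) :
    b ^ 2 = f.eval a := by
  have h1 := v.ge_aeval_sub hx hx0 f
  have h2 : v.Ge 1 ((y - algebraMap K L b) * (y + algebraMap K L b)) :=
    hy.mul_right ((M.ge_y hx0).add (v.ge_algebraMap b))
  have h3 := h2.sub h1
  rw [← M.sq] at h3
  have h4 : (y - algebraMap K L b) * (y + algebraMap K L b) - (y ^ 2 - algebraMap K L (f.eval a)) =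
      algebraMap K L (f.eval a - b ^ 2) := by
    rw [map_sub, map_pow]; ring
  rw [h4] at h3
  exact (_root_.sub_eq_zero.1 (v.eq_zero_of_ge h3)).symm

theorem eval_derivative_ne_zero (M : IsQuadraticModel x y f) {a : K} (ha : f.eval a = 0) :
    (derivative f).eval a ≠ 0 := by
  intro h
  obtain ⟨s, t, hst⟩ := M.separable
  have := congrArg (Polynomial.eval a) hst
  simp [ha, h] at this

/-- The function `y` or `x - a`, according to whether `y` vanishes or not, generates the maximal
ideal of the coordinate ring at the point `(a, b)`, up to multiplication by functions that do not
vanish there. -/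
theorem exists_mul_eq_uniformizer_mul (M : IsQuadraticModel x y f) (h2 : (2 : K) ≠ 0) {a b : K}
    (hx0 : v.Ge 0 x) (hx : v.Ge 1 (x - algebraMap K L a)) (hy : v.Ge 1 (y - algebraMap K L b))
    {α : L} (hα : α ∈ Algebra.adjoin K {x, y}) (hα1 : v.Ge 1 α) :
    ∃ u ∈ Algebra.adjoin K {x, y}, u ≠ 0 ∧ v.ord u = 0 ∧ ∃ α₁ ∈ Algebra.adjoin K {x, y},
      α * u = (if b = 0 then y else x - algebraMap K L a) * α₁ := by
  set A := Algebra.adjoin K {x, y}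
  have hxA : x ∈ A := Algebra.subset_adjoin (by simp)
  have hyA : y ∈ A := Algebra.subset_adjoin (by simp)
  have hfab := M.sq_eq_eval hx0 hx hy
  obtain ⟨c, s, hs, s', hs', rfl⟩ : ∃ c : K, ∃ s ∈ A, ∃ s' ∈ A,
      α = algebraMap K L c + (x - algebraMap K L a) * s + (y - algebraMap K L b) * s' := by
    clear hα1
    obtain ⟨p, q, rfl⟩ := M.mem_adjoin_iff.1 hα
    obtain ⟨p₁, hp₁⟩ := X_sub_C_dvd_sub_C_eval (a := a) (p := p)
    obtain ⟨q₁, hq₁⟩ := X_sub_C_dvd_sub_C_eval (a := a) (p := q)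
    have hp := congrArg (aeval x) hp₁
    have hq := congrArg (aeval x) hq₁
    simp only [map_sub, aeval_C, map_mul, aeval_X] at hp hq
    refine ⟨p.eval a + q.eval a * b, aeval x p₁ + aeval x q₁ * y,
      M.mem_adjoin_iff.2 ⟨p₁, q₁, rfl⟩, algebraMap K L (q.eval a), A.algebraMap_mem _, ?_⟩
    rw [map_add, map_mul]
    linear_combination hp + hq * y
  have hc : c = 0 := by
    apply v.eq_zero_of_ge
    have h3 := (hα1.sub (hx.mul_right (M.ge_of_mem_adjoin hx0 hs))).sub
      (hy.mul_right (M.ge_of_mem_adjoin hx0 hs'))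
    convert h3 using 1
    ring
  subst hc
  obtain ⟨g, hg⟩ := X_sub_C_dvd_sub_C_eval (a := a) (p := f)
  have hgx : aeval x f - algebraMap K L (f.eval a) = (x - algebraMap K L a) * aeval x g := by
    have := congrArg (aeval x) hg
    simpa using this
  have hgA : aeval x g ∈ A := M.mem_adjoin_iff.2 ⟨g, 0, by simp⟩
  have unit_of {w : L} {e : K} (he : e ≠ 0) (hw : v.Ge 1 (w - algebraMap K L e)) :
      w ≠ 0 ∧ v.ord w = 0 := by
    have h := v.ord_add_eq (a := algebraMap K L e) (b := w - algebraMap K L e) (by simpa using he)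
      (by rw [v.ord_algebraMap he]; exact hw)
    rwa [add_sub_cancel, v.ord_algebraMap he] at h
  by_cases hb : b = 0
  · subst hb
    have hfa : f.eval a = 0 := by rw [← hfab]; simp
    have hga : g.eval a ≠ 0 := by
      have h3 := M.eval_derivative_ne_zero hfa
      rw [hfa, C_0, _root_.sub_zero] at hg
      rw [hg] at h3
      simpa using h3
    obtain ⟨hu0, hu⟩ := unit_of hga (v.ge_aeval_sub hx hx0 g)
    refine ⟨aeval x g, hgA, hu0, hu, y * s + aeval x g * s',
      add_mem (mul_mem hyA hs) (mul_mem hgA hs'), ?_⟩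
    rw [if_pos rfl]
    rw [hfa, ← M.sq] at hgx
    simp only [map_zero] at hgx ⊢
    linear_combination (-s) * hgx
  · have hv : v.Ge 1 (y + algebraMap K L b - algebraMap K L (2 * b)) := by
      convert hy using 1
      rw [map_mul, map_ofNat]; ring
    obtain ⟨hu0, hu⟩ := unit_of (mul_ne_zero h2 hb) hv
    refine ⟨y + algebraMap K L b, add_mem hyA (A.algebraMap_mem b), hu0, hu,
      s * (y + algebraMap K L b) + aeval x g * s',
      add_mem (mul_mem hs (add_mem hyA (A.algebraMap_mem b))) (mul_mem hgA hs'), ?_⟩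
    rw [if_neg hb]
    rw [← M.sq, ← hfab, map_pow] at hgx
    simp only [map_zero]
    linear_combination s' * hgx

/-- Up to functions of order zero in the coordinate ring, every element of the coordinate ring is a
power of the function `x - a` or `y`. -/
theorem exists_eq_uniformizer_pow_mul (M : IsQuadraticModel x y f) (h2 : (2 : K) ≠ 0) {a b : K}
    (hx0 : v.Ge 0 x) (hx : v.Ge 1 (x - algebraMap K L a)) (hy : v.Ge 1 (y - algebraMap K L b))
    {α : L} (hα : α ∈ Algebra.adjoin K {x, y}) (hα0 : α ≠ 0) :
    ∃ k : ℕ, ∃ β ∈ Algebra.adjoin K {x, y}, ∃ γ ∈ Algebra.adjoin K {x, y},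
      β ≠ 0 ∧ γ ≠ 0 ∧ v.ord β = 0 ∧ v.ord γ = 0 ∧
      α * β = (if b = 0 then y else x - algebraMap K L a) ^ k * γ := by
  set t := (if b = 0 then y else x - algebraMap K L a) with ht
  have ht0 : t ≠ 0 := by
    rw [ht]; split_ifs
    exacts [M.y_ne_zero, M.sub_ne_zero a]
  have ht1 : 1 ≤ v.ord t := by
    have : v.Ge 1 t := by
      rw [ht]; split_ifs with hb
      · simpa [hb] using hy
      · exact hx
    exact this ht0
  obtain ⟨n, hn⟩ : ∃ n : ℕ, v.ord α = n := Int.eq_ofNat_of_zero_le (M.ge_of_mem_adjoin hx0 hα hα0)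
  induction n using Nat.strong_induction_on generalizing α with
  | _ n ih =>
    by_cases hn0 : n = 0
    · exact ⟨0, 1, one_mem _, α, hα, one_ne_zero, hα0, v.ord_one, by simp [hn, hn0], by simp⟩
    obtain ⟨u, hu, hu0, hu1, α₁, hα₁, h⟩ := M.exists_mul_eq_uniformizer_mul h2 hx0 hx hy hα
      (fun _ => by omega)
    rw [← ht] at h
    have hα₁0 : α₁ ≠ 0 := by
      rintro rfl
      exact mul_ne_zero hα0 hu0 (by simpa using h)
    have hord := congrArg v.ord h
    rw [v.ord_mul hα0 hu0, v.ord_mul ht0 hα₁0] at hord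
    have h0 := M.ge_of_mem_adjoin hx0 hα₁ hα₁0
    obtain ⟨k, β, hβ, γ, hγ, hβ0, hγ0, hβ1, hγ1, h'⟩ := ih (v.ord α₁).toNat (by omega) hα₁ hα₁0
      (by omega)
    refine ⟨k + 1, u * β, mul_mem hu hβ, γ, hγ, mul_ne_zero hu0 hβ0, hγ0, ?_, hγ1, ?_⟩
    · rw [v.ord_mul hu0 hβ0]; omega
    · rw [← mul_assoc, h, mul_assoc, h', pow_succ]; ring

theorem exists_eq_uniformizer_zpow_mul (M : IsQuadraticModel x y f) (h2 : (2 : K) ≠ 0) {a b : K}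
    (hx0 : v.Ge 0 x) (hx : v.Ge 1 (x - algebraMap K L a)) (hy : v.Ge 1 (y - algebraMap K L b))
    {z : L} (hz : z ≠ 0) :
    ∃ k j : ℕ, ∃ β ∈ Algebra.adjoin K {x, y}, ∃ γ ∈ Algebra.adjoin K {x, y},
      β ≠ 0 ∧ γ ≠ 0 ∧ v.ord β = 0 ∧ v.ord γ = 0 ∧
      z * (if b = 0 then y else x - algebraMap K L a) ^ j * β =
        (if b = 0 then y else x - algebraMap K L a) ^ k * γ := by
  obtain ⟨p, q, r, hr, hz'⟩ := M.exists_repr z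
  have hrA : aeval x r ∈ Algebra.adjoin K {x, y} := M.mem_adjoin_iff.2 ⟨r, 0, by simp⟩
  have hr0 := M.aeval_ne_zero hr
  have hα0 : aeval x p + aeval x q * y ≠ 0 := by rw [← hz']; exact mul_ne_zero hz hr0
  obtain ⟨k, β, hβ, γ, hγ, hβ0, hγ0, hβ1, hγ1, h⟩ := M.exists_eq_uniformizer_pow_mul h2 hx0 hx hy
    (M.mem_adjoin_iff.2 ⟨p, q, rfl⟩) hα0
  obtain ⟨j, β', hβ', γ', hγ', hβ'0, hγ'0, hβ'1, hγ'1, h'⟩ :=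
    M.exists_eq_uniformizer_pow_mul h2 hx0 hx hy hrA hr0
  rw [← hz'] at h
  refine ⟨k, j, γ' * β, mul_mem hγ' hβ, γ * β', mul_mem hγ hβ', mul_ne_zero hγ'0 hβ0,
    mul_ne_zero hγ0 hβ'0, ?_, ?_, ?_⟩
  · rw [v.ord_mul hγ'0 hβ0]; omega
  · rw [v.ord_mul hγ0 hβ'0]; omega
  · linear_combination (-z * β) * h' + β' * h

/-- A function of order one is, up to functions of order zero, a power of `x - a` or `y`, which is
therefore a uniformizer. -/
theorem ord_uniformizer (M : IsQuadraticModel x y f) (h2 : (2 : K) ≠ 0) {a b : K}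
    (hx0 : v.Ge 0 x) (hx : v.Ge 1 (x - algebraMap K L a)) (hy : v.Ge 1 (y - algebraMap K L b)) :
    v.ord (if b = 0 then y else x - algebraMap K L a) = 1 := by
  have key := fun (z : L) (hz : z ≠ 0) => M.exists_eq_uniformizer_zpow_mul h2 hx0 hx hy hz
  set t := (if b = 0 then y else x - algebraMap K L a) with ht
  have ht0 : t ≠ 0 := by
    rw [ht]; split_ifs
    exacts [M.y_ne_zero, M.sub_ne_zero a]
  have ht1 : 1 ≤ v.ord t := by
    have : v.Ge 1 t := by
      rw [ht]; split_ifs with hb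
      · simpa [hb] using hy
      · exact hx
    exact this ht0
  obtain ⟨z, hz, hz1⟩ := v.exists_ord_eq_one
  obtain ⟨k, j, β, -, γ, -, hβ0, hγ0, hβ1, hγ1, h⟩ := key z hz
  have := congrArg v.ord h
  rw [v.ord_mul (mul_ne_zero hz (pow_ne_zero _ ht0)) hβ0, v.ord_mul hz (pow_ne_zero _ ht0),
    v.ord_mul (pow_ne_zero _ ht0) hγ0, v.ord_pow ht0, v.ord_pow ht0, hz1, hβ1, hγ1] at this
  have h3 : (k - j : ℤ) * v.ord t = 1 := by linarith
  rcases Int.eq_one_or_neg_one_of_mul_eq_one h3 with h4 | h4 <;> rw [h4] at h3 <;> omega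

/-- The local ring at a finite place consists of the quotients of elements of the coordinate ring
with denominator not vanishing at the place. -/
theorem exists_mul_mem_adjoin (M : IsQuadraticModel x y f) (h2 : (2 : K) ≠ 0) {z : L}
    (hx0 : v.Ge 0 x) (hz : v.Ge 0 z) :
    ∃ β ∈ Algebra.adjoin K {x, y}, β ≠ 0 ∧ v.ord β = 0 ∧ z * β ∈ Algebra.adjoin K {x, y} := by
  by_cases hz0 : z = 0
  · exact ⟨1, one_mem _, one_ne_zero, v.ord_one, by simp [hz0]⟩
  obtain ⟨a, hx⟩ := v.exists_value hx0
  obtain ⟨b, hy⟩ := v.exists_value (M.ge_y hx0)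
  have hu := M.ord_uniformizer h2 hx0 hx hy
  obtain ⟨k, j, β, hβ, γ, hγ, hβ0, hγ0, hβ1, hγ1, h⟩ :=
    M.exists_eq_uniformizer_zpow_mul h2 hx0 hx hy hz0
  set t := (if b = 0 then y else x - algebraMap K L a) with ht
  have ht0 : t ≠ 0 := by
    rw [ht]; split_ifs
    exacts [M.y_ne_zero, M.sub_ne_zero a]
  have htA : t ∈ Algebra.adjoin K {x, y} := by
    rw [ht]; split_ifs
    · exact Algebra.subset_adjoin (by simp)
    · exact sub_mem (Algebra.subset_adjoin (by simp)) (Subalgebra.algebraMap_mem _ _)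
  have := congrArg v.ord h
  rw [v.ord_mul (mul_ne_zero hz0 (pow_ne_zero _ ht0)) hβ0, v.ord_mul hz0 (pow_ne_zero _ ht0),
    v.ord_mul (pow_ne_zero _ ht0) hγ0, v.ord_pow ht0, v.ord_pow ht0, hβ1, hγ1, hu] at this
  have hzv := hz hz0
  have hjk : j ≤ k := by omega
  obtain ⟨i, rfl⟩ := Nat.exists_eq_add_of_le hjk
  refine ⟨β, hβ, hβ0, hβ1, ?_⟩
  have h4 : z * β = t ^ i * γ := by
    apply mul_left_cancel₀ (pow_ne_zero j ht0)
    rw [pow_add] at h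
    linear_combination h
  rw [h4]
  exact mul_mem (pow_mem htA i) hγ

theorem ord_sub_eq_one (M : IsQuadraticModel x y f) (h2 : (2 : K) ≠ 0) {a b : K}
    (hx0 : v.Ge 0 x) (hx : v.Ge 1 (x - algebraMap K L a)) (hy : v.Ge 1 (y - algebraMap K L b))
    (hb : b ≠ 0) : v.ord (x - algebraMap K L a) = 1 := by
  have := M.ord_uniformizer h2 hx0 hx hy
  rwa [if_neg hb] at this

theorem ord_y_eq_one (M : IsQuadraticModel x y f) (h2 : (2 : K) ≠ 0) {a : K}
    (hx0 : v.Ge 0 x) (hx : v.Ge 1 (x - algebraMap K L a)) (hy : v.Ge 1 y) : v.ord y = 1 := by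
  have := M.ord_uniformizer h2 hx0 hx (b := 0) (by simpa using hy)
  rwa [if_pos rfl] at this

/-! ### Differentials -/

/-- The differential `dx / y`. -/
noncomputable def omega (K : Type*) {L : Type*} [Field K] [Field L] [Algebra K L] (x y : L) :
    Ω[L⁄K] :=
  y⁻¹ • KaehlerDifferential.D K L x

theorem D_x (M : IsQuadraticModel x y f) : KaehlerDifferential.D K L x = y • omega K x y := by
  rw [omega, smul_smul, mul_inv_cancel₀ M.y_ne_zero, one_smul]

theorem two_smul_D_y (M : IsQuadraticModel x y f) :
    (2 : L) • KaehlerDifferential.D K L y = aeval x (derivative f) • omega K x y := by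
  have h := congrArg (KaehlerDifferential.D K L) M.sq
  rw [Derivation.leibniz_pow, Derivation.map_aeval, M.D_x] at h
  simp only [Nat.add_one_sub_one, pow_one] at h
  have h3 := congrArg (fun w => y⁻¹ • w) h
  simp only [smul_smul, ← Nat.cast_smul_eq_nsmul L] at h3
  convert h3 using 2
  · field_simp [M.y_ne_zero]
    norm_num
  · field_simp [M.y_ne_zero]

theorem exists_D_eq_smul_of_mem_adjoin (M : IsQuadraticModel x y f) (h2 : (2 : K) ≠ 0) {z : L}
    (hz : z ∈ Algebra.adjoin K {x, y}) :
    ∃ s ∈ Algebra.adjoin K {x, y}, KaehlerDifferential.D K L z = s • omega K x y := by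
  induction hz using Algebra.adjoin_induction with
  | mem z hz =>
    rcases hz with rfl | rfl
    · exact ⟨y, Algebra.subset_adjoin (by simp), M.D_x⟩
    · refine ⟨algebraMap K L 2⁻¹ * aeval x (derivative f), mul_mem (Subalgebra.algebraMap_mem _ _)
        (M.mem_adjoin_iff.2 ⟨derivative f, 0, by simp⟩), ?_⟩
      rw [mul_smul, ← M.two_smul_D_y, smul_smul]
      have : algebraMap K L 2⁻¹ * 2 = 1 := by
        rw [← map_ofNat (algebraMap K L) 2, ← map_mul, inv_mul_cancel₀ h2, map_one]
      rw [this, one_smul]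
  | algebraMap c => exact ⟨0, zero_mem _, by simp⟩
  | add a b _ _ ha hb =>
    obtain ⟨s, hs, h⟩ := ha
    obtain ⟨s', hs', h'⟩ := hb
    exact ⟨s + s', add_mem hs hs', by rw [map_add, h, h', add_smul]⟩
  | mul a b ha' hb' ha hb =>
    obtain ⟨s, hs, h⟩ := ha
    obtain ⟨s', hs', h'⟩ := hb
    exact ⟨a * s' + b * s, add_mem (mul_mem ha' hs') (mul_mem hb' hs), by
      rw [Derivation.leibniz, h, h', add_smul, smul_smul, smul_smul]⟩

theorem exists_D_eq_smul (M : IsQuadraticModel x y f) (h2 : (2 : K) ≠ 0) {z : L}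
    (hx0 : v.Ge 0 x) (hz : v.Ge 0 z) :
    ∃ s, v.Ge 0 s ∧ KaehlerDifferential.D K L z = s • omega K x y := by
  obtain ⟨β, hβ, hβ0, hβ1, hα⟩ := M.exists_mul_mem_adjoin h2 hx0 hz
  obtain ⟨s, hs, h⟩ := M.exists_D_eq_smul_of_mem_adjoin h2 hα
  obtain ⟨s', hs', h'⟩ := M.exists_D_eq_smul_of_mem_adjoin h2 hβ
  have hβi : v.Ge 0 β⁻¹ := fun _ => by rw [v.ord_inv hβ0, hβ1]; rfl
  refine ⟨β⁻¹ * (s - z * s'), hβi.mul_left ((M.ge_of_mem_adjoin hx0 hs).sub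
    (hz.mul_left (M.ge_of_mem_adjoin hx0 hs'))), ?_⟩
  rw [Derivation.leibniz, h'] at h
  have h3 : β • KaehlerDifferential.D K L z = (s - z * s') • omega K x y := by
    rw [sub_smul, ← h, mul_smul]
    abel
  rw [mul_smul, ← h3, smul_smul, inv_mul_cancel₀ hβ0, one_smul]

/-- At a place where `x` is regular, the regular differentials are the regular multiples of
`dx / y`. -/
theorem mem_range_map_iff (M : IsQuadraticModel x y f) (h2 : (2 : K) ≠ 0) {O : Type*} [CommRing O]
    [Algebra K O] [Algebra O L] [IsScalarTower K O L] (hx0 : v.Ge 0 x)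
    (hO : ∀ z : L, v.Ge 0 z ↔ ∃ w : O, algebraMap O L w = z) (ω : Ω[L⁄K]) :
    ω ∈ LinearMap.range (KaehlerDifferential.map K K O L) ↔
      ∃ s, v.Ge 0 s ∧ ω = s • omega K x y := by
  constructor
  · rintro ⟨η, rfl⟩
    have hη : η ∈ Submodule.span O (Set.range (KaehlerDifferential.D K O)) := by
      rw [KaehlerDifferential.span_range_derivation]; trivial
    induction hη using Submodule.span_induction with
    | mem η hη =>
      obtain ⟨w, rfl⟩ := hη
      rw [KaehlerDifferential.map_D]
      exact M.exists_D_eq_smul h2 hx0 ((hO _).2 ⟨w, rfl⟩)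
    | zero => exact ⟨0, Place.Ge.zero, by simp⟩
    | add a b _ _ ha hb =>
      obtain ⟨s, hs, h⟩ := ha
      obtain ⟨s', hs', h'⟩ := hb
      exact ⟨s + s', hs.add hs', by rw [map_add, h, h', add_smul]⟩
    | smul w a _ ha =>
      obtain ⟨s, hs, h⟩ := ha
      refine ⟨algebraMap O L w * s, ((hO _).2 ⟨w, rfl⟩).mul_left hs, ?_⟩
      rw [map_smul, h, mul_smul, algebraMap_smul]
  · rintro ⟨s, hs, rfl⟩
    obtain ⟨p, q, hpq⟩ := M.separable
    obtain ⟨x', hx'⟩ := (hO x).1 hx0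
    obtain ⟨y', hy'⟩ := (hO y).1 (M.ge_y hx0)
    obtain ⟨s', rfl⟩ := (hO s).1 hs
    -- With `p f + q f' = 1`, the differential `dx / y` is `p(x) y dx + 2 q(x) dy`.
    have h3 : KaehlerDifferential.map K K O L ((aeval x' p * y') • KaehlerDifferential.D K O x' +
        (2 * aeval x' q) • KaehlerDifferential.D K O y') = omega K x y := by
      rw [map_add, map_smul, map_smul, KaehlerDifferential.map_D, KaehlerDifferential.map_D,
        ← algebraMap_smul L, ← algebraMap_smul L (2 * aeval x' q), map_mul, map_mul,
        ← aeval_algebraMap_apply, ← aeval_algebraMap_apply, hx', hy', map_ofNat, mul_comm 2,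
        mul_smul _ (2 : L), M.two_smul_D_y, M.D_x, smul_smul, smul_smul, ← add_smul]
      have h4 := congrArg (aeval x) hpq
      simp only [map_add, map_mul, ← M.sq, map_one] at h4
      rw [show aeval x p * y * y + aeval x q * aeval x (derivative f) = 1 by rw [← h4]; ring,
        one_smul]
    refine ⟨s' • ((aeval x' p * y') • KaehlerDifferential.D K O x' +
        (2 * aeval x' q) • KaehlerDifferential.D K O y'), (map_smul _ _ _).trans ?_⟩
    rw [h3, algebraMap_smul]

end IsQuadraticModel

/-! ### The places at infinity -/

theorem reverse_reverse_dvd {K : Type*} [Field K] (f : K[X]) : f.reverse.reverse ∣ f := by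
  by_cases hf : f = 0
  · simp [hf]
  obtain ⟨h, hh⟩ : X ^ f.natTrailingDegree ∣ f := by
    rw [X_pow_dvd_iff]
    intro d hd
    exact coeff_eq_zero_of_lt_natTrailingDegree hd
  have h0 : h ≠ 0 := by rintro rfl; exact hf (by rw [hh, mul_zero])
  have hc : h.natTrailingDegree = 0 := by
    have := congrArg natTrailingDegree hh
    rw [mul_comm, natTrailingDegree_mul_X_pow h0] at this
    omega
  have hr : f.reverse = h.reverse := by
    conv_lhs => rw [hh]
    rw [reverse_X_pow_mul]
  have hrr : h.reverse.reverse = h := by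
    ext i
    rw [coeff_reverse, reverse_natDegree, hc, Nat.sub_zero, coeff_reverse, revAt_invol]
  rw [hr, hrr]
  exact ⟨_, hh.trans (mul_comm _ _)⟩

theorem separable_X_pow_mul_reverse {K : Type*} [Field K] [PerfectField K] {f : K[X]}
    (hf : f.Separable) {e : ℕ} (he : e ≤ 1) : (X ^ e * f.reverse).Separable := by
  rw [PerfectField.separable_iff_squarefree] at hf ⊢
  intro d hd
  have h0 : d ≠ 0 := by
    rintro rfl
    rw [mul_zero] at hd
    have := zero_dvd_iff.1 hd
    exact hf.ne_zero (by simpa using this)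
  have h1 : IsUnit d.reverse := by
    apply hf
    refine dvd_trans ?_ (reverse_reverse_dvd f)
    obtain ⟨k, hk⟩ := hd
    have := congrArg reverse hk
    rw [reverse_X_pow_mul, reverse_mul_of_domain, reverse_mul_of_domain] at this
    exact ⟨_, this⟩
  have h2 := natDegree_eq_zero_of_isUnit h1
  have h3 := d.natDegree_eq_reverse_natDegree_add_natTrailingDegree
  rw [h2, zero_add] at h3
  by_cases h4 : d.natDegree = 0
  · rw [natDegree_eq_zero] at h4
    obtain ⟨c, rfl⟩ := h4
    exact isUnit_C.2 (isUnit_iff_ne_zero.2 (by simpa using h0))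
  · exfalso
    have hX : X ∣ d := X_dvd_iff.2 (coeff_eq_zero_of_lt_natTrailingDegree (by omega))
    have h5 : X * X ∣ X ^ e * f.reverse := (mul_dvd_mul hX hX).trans hd
    have h6 : (X : K[X]) ∣ f.reverse := by
      interval_cases e
      · exact (dvd_mul_left _ _).trans (by simpa using h5)
      · rw [pow_one] at h5
        exact (mul_dvd_mul_iff_left X_ne_zero).1 h5
    rw [X_dvd_iff, coeff_zero_reverse, leadingCoeff_eq_zero] at h6
    exact hf.ne_zero h6

/-- The substitution `x ↦ 1 / x` in a polynomial. -/
theorem aeval_inv_reflect_mul_pow {K L : Type*} [Field K] [Field L] [Algebra K L] {x : L}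
    (hx : x ≠ 0) {N : ℕ} {p : K[X]} (hp : p.natDegree ≤ N) :
    aeval x⁻¹ (p.reflect N) * x ^ N = aeval x p := by
  let _ : Invertible x := invertibleOfNonzero hx
  have := eval₂_reflect_mul_pow (algebraMap K L) x N p hp
  rwa [invOf_eq_inv] at this

namespace Place
variable {K L : Type*} [Field K] [Field L] [Algebra K L] {v : Place K L}

theorem ge_zero_of_ge_sub {x : L} {a : K} (h : v.Ge 1 (x - algebraMap K L a)) : v.Ge 0 x := by
  simpa using (h.mono (by norm_num)).add (v.ge_algebraMap a)

theorem ge_one_inv {x : L} (hx : v.ord x < 0) : v.Ge 1 x⁻¹ := by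
  intro h
  rw [v.ord_inv (by rintro rfl; exact h inv_zero)]
  omega

/-- At a pole of `x`, the pole order of a polynomial in `x` is determined by its degree. -/
theorem ord_aeval_of_neg {x : L} (hx0 : x ≠ 0) (hx : v.ord x < 0) {p : K[X]} (hp : p ≠ 0) :
    aeval x p ≠ 0 ∧ v.ord (aeval x p) = p.natDegree * v.ord x := by
  rw [← aeval_inv_reflect_mul_pow hx0 (le_refl p.natDegree)]
  have h1 : v.Ge 1 (x⁻¹ - algebraMap K L 0) := by simpa using ge_one_inv hx
  have h2 := ge_aeval_sub h1 (ge_zero_of_ge_sub h1) (p.reflect p.natDegree)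
  have h3 : (p.reflect p.natDegree).eval 0 ≠ 0 := by
    rw [← coeff_zero_eq_eval_zero]
    change p.reverse.coeff 0 ≠ 0
    rwa [coeff_zero_reverse, leadingCoeff_ne_zero]
  have h4 := v.ord_add_eq (a := algebraMap K L ((p.reflect p.natDegree).eval 0))
    (b := aeval x⁻¹ (p.reflect p.natDegree) - algebraMap K L ((p.reflect p.natDegree).eval 0))
    (by simpa using h3) (by rw [v.ord_algebraMap h3]; exact h2)
  rw [add_sub_cancel, v.ord_algebraMap h3] at h4
  refine ⟨mul_ne_zero h4.1 (pow_ne_zero _ hx0), ?_⟩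
  rw [v.ord_mul h4.1 (pow_ne_zero _ hx0), h4.2, v.ord_pow hx0, zero_add]

/-- The place of `L` obtained from a place of `L'` through an isomorphism `L ≃ L'`. -/
def comap {L' : Type*} [Field L'] [Algebra K L'] (v : Place K L') (θ : L ≃ₐ[K] L') :
    Place K L where
  ord a := v.ord (θ a)
  ord_mul ha hb := by rw [map_mul, v.ord_mul (by simpa using ha) (by simpa using hb)]
  min_le_ord_add ha hb hab := by
    rw [map_add]
    exact v.min_le_ord_add (by simpa using ha) (by simpa using hb)
      (by rwa [← map_add, _root_.map_ne_zero])
  exists_ord_eq_one := by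
    obtain ⟨t, ht, h⟩ := v.exists_ord_eq_one
    exact ⟨θ.symm t, by simpa using ht, by simpa using h⟩
  exists_const ha h := by
    obtain ⟨c, hc⟩ := v.exists_const (by simpa using ha) h
    refine ⟨c, fun h => ?_⟩
    have := hc (by rwa [← _root_.map_ne_zero θ, map_sub, AlgEquiv.commutes] at h)
    rwa [map_sub, AlgEquiv.commutes]
  ord_algebraMap hc := by rw [AlgEquiv.commutes, v.ord_algebraMap hc]

end Place

namespace IsQuadraticModel
variable {K L L' : Type*} [Field K] [Field L] [Algebra K L] [Field L'] [Algebra K L'] {x y : L}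
  {x' y' : L'} {f : K[X]} {v : Place K L}

/-- The homomorphism from the coordinate ring `K[X][Y]/(Y² - f(X))` of the affine curve. -/
noncomputable def coordinateHom (M : IsQuadraticModel x y f) :
    AdjoinRoot (X ^ 2 - C f : K[X][X]) →ₐ[K] L :=
  AdjoinRoot.liftAlgHom _ (aeval x) y (by simp [M.sq])

theorem coordinateHom_injective (M : IsQuadraticModel x y f) :
    Function.Injective M.coordinateHom := by
  have hm : (X ^ 2 - C f : K[X][X]).Monic := monic_X_pow_sub_C f two_ne_zero
  rw [injective_iff_map_eq_zero]
  intro a ha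
  obtain ⟨P, rfl⟩ := AdjoinRoot.mk_surjective a
  rw [AdjoinRoot.mk_eq_zero, ← modByMonic_eq_zero_iff_dvd hm]
  set R := P %ₘ (X ^ 2 - C f) with hR
  have hmk : AdjoinRoot.mk (X ^ 2 - C f) P = AdjoinRoot.mk (X ^ 2 - C f) R := by
    rw [AdjoinRoot.mk_eq_mk, hR]
    exact ⟨P /ₘ (X ^ 2 - C f), by rw [modByMonic_eq_sub_mul_div]; ring⟩
  have hd : R.natDegree ≤ 1 := by
    have := natDegree_modByMonic_lt P hm (by
      intro h; have := congrArg natDegree h; rw [natDegree_X_pow_sub_C] at this; simp at this)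
    rw [natDegree_X_pow_sub_C, ← hR] at this
    omega
  rw [hmk, coordinateHom, AdjoinRoot.liftAlgHom_mk] at ha
  rw [eq_X_add_C_of_natDegree_le_one hd] at ha ⊢
  simp only [eval₂_add, eval₂_mul, eval₂_C, eval₂_X] at ha
  obtain ⟨h0, h1⟩ := M.eq_zero (R.coeff 0) (R.coeff 1) (by rw [← ha]; simp [add_comm])
  simp [h0, h1]

theorem isFractionRing_coordinateHom (M : IsQuadraticModel x y f) :
    @IsFractionRing (AdjoinRoot (X ^ 2 - C f : K[X][X])) _ L _
      M.coordinateHom.toRingHom.toAlgebra := by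
  let A := AdjoinRoot (X ^ 2 - C f : K[X][X])
  let _ : Algebra A L := M.coordinateHom.toRingHom.toAlgebra
  have _ : FaithfulSMul A L := (faithfulSMul_iff_algebraMap_injective A L).2
    M.coordinateHom_injective
  refine IsFractionRing.of_field A L fun z => ?_
  obtain ⟨p, q, r, hr, h⟩ := M.exists_repr z
  refine ⟨AdjoinRoot.mk _ (C p + C q * X), AdjoinRoot.mk _ (C r), ?_⟩
  change z = M.coordinateHom _ / M.coordinateHom _
  rw [eq_div_iff]
  · simpa [coordinateHom] using h
  · simpa [coordinateHom] using M.aeval_ne_zero hr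

/-- The function field of the curve `y² = f(x)` is determined by `f`. -/
theorem exists_algEquiv (M : IsQuadraticModel x y f) (M' : IsQuadraticModel x' y' f) :
    ∃ θ : L ≃ₐ[K] L', θ x = x' ∧ θ y = y' := by
  let A := AdjoinRoot (X ^ 2 - C f : K[X][X])
  let _ : Algebra A L := M.coordinateHom.toRingHom.toAlgebra
  let _ : Algebra A L' := M'.coordinateHom.toRingHom.toAlgebra
  have _ : IsFractionRing A L := M.isFractionRing_coordinateHom
  have _ : IsFractionRing A L' := M'.isFractionRing_coordinateHom
  let e : L ≃ₐ[A] L' := IsLocalization.algEquiv (nonZeroDivisors A) L L'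
  have he : ∀ a : A, e (M.coordinateHom a) = M'.coordinateHom a := e.commutes
  refine ⟨AlgEquiv.ofRingEquiv (f := e.toRingEquiv) fun c => ?_, ?_, ?_⟩
  · have := he (algebraMap K A c)
    rwa [AlgHom.commutes, AlgHom.commutes] at this
  · have := he (AdjoinRoot.of _ X)
    simpa [coordinateHom] using this
  · have := he (AdjoinRoot.root _)
    simpa [coordinateHom] using this

/-- The effect of an affine change of coordinates on the equation of the curve. -/
theorem affine (M : IsQuadraticModel x y f) {α β γ : K} (hα : α ≠ 0) (hγ : γ ≠ 0) :
    IsQuadraticModel (algebraMap K L α⁻¹ * (x - algebraMap K L β)) (algebraMap K L γ⁻¹ * y)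
      (C (γ⁻¹ ^ 2) * f.comp (C α * X + C β)) := by
  have hx : ∀ p : K[X], aeval x p =
      aeval (algebraMap K L α⁻¹ * (x - algebraMap K L β)) (p.comp (C α * X + C β)) := by
    intro p
    rw [aeval_comp]
    congr 2
    simp only [map_add, map_mul, aeval_C, aeval_X]
    rw [← mul_assoc, ← map_mul, mul_inv_cancel₀ hα, map_one, one_mul, sub_add_cancel]
  have hx' : ∀ p : K[X], aeval (algebraMap K L α⁻¹ * (x - algebraMap K L β)) p =
      aeval x (p.comp (C α⁻¹ * (X - C β))) := by
    intro p
    rw [aeval_comp]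
    simp
  have hc : ∀ p : K[X], p.comp (C α⁻¹ * (X - C β)) = 0 → p = 0 := by
    intro p hp
    have h2 : (p.comp (C α⁻¹ * (X - C β))).comp (C α * X + C β) = p := by
      rw [comp_assoc]
      simp only [mul_comp, C_comp, sub_comp, X_comp, add_sub_cancel_right]
      rw [← mul_assoc, ← C_mul, inv_mul_cancel₀ hα, C_1, one_mul, comp_X]
    rw [← h2, hp, zero_comp]
  have hg : algebraMap K L γ ≠ 0 := by simpa using hγ
  refine ⟨?_, ?_, fun z => ?_, fun p q h => ?_⟩
  · rw [mul_pow, M.sq, hx, map_mul, aeval_C, map_pow]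
  · have hs : (f.comp (C α * X + C β)).Separable := by
      obtain ⟨p, q, h⟩ := M.separable
      refine ⟨p.comp (C α * X + C β), C α⁻¹ * q.comp (C α * X + C β), ?_⟩
      have := congrArg (fun r => r.comp (C α * X + C β)) h
      simp only [add_comp, mul_comp, one_comp] at this
      rw [derivative_comp]
      simp only [derivative_add, derivative_mul, derivative_C, derivative_X]
      have h4 : C α⁻¹ * C α = (1 : K[X]) := by rw [← C_mul, inv_mul_cancel₀ hα, C_1]
      linear_combination this + (q.comp (C α * X + C β)) *
        ((derivative f).comp (C α * X + C β)) * h4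
    exact hs.unit_mul (isUnit_C.2 (by simpa using hγ))
  · obtain ⟨p, q, r, hr, h⟩ := M.exists_repr z
    refine ⟨p.comp (C α * X + C β), C γ * q.comp (C α * X + C β), r.comp (C α * X + C β), ?_, ?_⟩
    · intro h0
      refine M.aeval_ne_zero hr ?_
      rw [hx, h0, map_zero]
    · rw [map_mul, ← hx, ← hx, ← hx, h, aeval_C, map_inv₀]
      field_simp
  · rw [hx', hx'] at h
    obtain ⟨h1, h2⟩ := M.eq_zero (p.comp (C α⁻¹ * (X - C β)))
      (C γ⁻¹ * q.comp (C α⁻¹ * (X - C β))) (by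
        rw [← h, map_mul, aeval_C]; ring)
    refine ⟨hc p h1, hc q ?_⟩
    exact (mul_eq_zero.1 h2).resolve_left (by simpa using hγ)

theorem x_ne_zero (M : IsQuadraticModel x y f) : x ≠ 0 := by
  simpa using M.sub_ne_zero 0

/-- The chart at infinity of the curve `y² = f(x)`, with the coordinates `1 / x` and `y / x ^ d`. -/
theorem atInfinity [PerfectField K] (M : IsQuadraticModel x y f) {d e : ℕ}
    (hd : 2 * d = f.natDegree + e) (he : e ≤ 1) :
    IsQuadraticModel x⁻¹ (y * x⁻¹ ^ d) (X ^ e * f.reverse) := by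
  have hx := M.x_ne_zero
  refine ⟨?_, separable_X_pow_mul_reverse M.separable he, fun z => ?_, fun p q h => ?_⟩
  · have h1 := aeval_inv_reflect_mul_pow hx (le_refl f.natDegree)
    change aeval x⁻¹ f.reverse * _ = _ at h1
    rw [mul_pow, M.sq, ← h1, map_mul, map_pow, aeval_X, ← pow_mul, mul_comm d 2, hd, pow_add,
      mul_assoc, ← mul_assoc (x ^ _), ← mul_pow, mul_inv_cancel₀ hx, one_pow, one_mul, mul_comm]
  · obtain ⟨p, q, r, hr, h⟩ := M.exists_repr z
    set n := p.natDegree + (q * X ^ d).natDegree + r.natDegree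
    refine ⟨p.reflect n, (q * X ^ d).reflect n, r.reflect n, by simpa using hr, ?_⟩
    have h1 := aeval_inv_reflect_mul_pow hx (show p.natDegree ≤ n by omega)
    have h2 := aeval_inv_reflect_mul_pow hx (show (q * X ^ d).natDegree ≤ n by omega)
    have h3 := aeval_inv_reflect_mul_pow hx (show r.natDegree ≤ n by omega)
    rw [← mul_left_inj' (pow_ne_zero n hx), mul_assoc, h3, add_mul, h1, mul_right_comm, h2, h,
      map_mul, map_pow, aeval_X, inv_pow]
    have := pow_ne_zero d hx
    field_simp
  · set n := p.natDegree + q.natDegree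
    have hr : ∀ p : K[X], p.natDegree ≤ n → aeval x (p.reflect n) = aeval x⁻¹ p * x ^ n := by
      intro p hp
      have := aeval_inv_reflect_mul_pow (inv_ne_zero hx) hp
      rw [inv_inv] at this
      rw [← this, mul_assoc, ← mul_pow, inv_mul_cancel₀ hx, one_pow, mul_one]
    obtain ⟨h1, h2⟩ := M.eq_zero (X ^ d * p.reflect n) (q.reflect n) (by
      rw [map_mul, map_pow, aeval_X, hr p (by omega), hr q (by omega)]
      have : x ^ d * x⁻¹ ^ d = 1 := by rw [← mul_pow, mul_inv_cancel₀ hx, one_pow]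
      linear_combination (x ^ n * x ^ d) * h - (aeval x⁻¹ q * x ^ n * y) * this)
    refine ⟨?_, reflect_eq_zero_iff.1 h2⟩
    exact reflect_eq_zero_iff.1 ((mul_eq_zero.1 h1).resolve_left (pow_ne_zero _ X_ne_zero))

/-- The local ring at a finite place depends only on the values of `x` and `y`. -/
theorem ge_zero_of_ge_zero (M : IsQuadraticModel x y f) (h2 : (2 : K) ≠ 0) {v v' : Place K L}
    {a b : K} (hx : v.Ge 1 (x - algebraMap K L a)) (hy : v.Ge 1 (y - algebraMap K L b))
    (hx' : v'.Ge 1 (x - algebraMap K L a)) (hy' : v'.Ge 1 (y - algebraMap K L b)) {z : L}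
    (hz : v.Ge 0 z) : v'.Ge 0 z := by
  obtain ⟨β, hβ, hβ0, hβ1, hα⟩ := M.exists_mul_mem_adjoin h2 (Place.ge_zero_of_ge_sub hx) hz
  have hg := M.ge_of_mem_adjoin (Place.ge_zero_of_ge_sub hx') hα
  obtain ⟨p, q, rfl⟩ := M.mem_adjoin_iff.1 hβ
  have value : ∀ w : Place K L, w.Ge 1 (x - algebraMap K L a) → w.Ge 1 (y - algebraMap K L b) →
      w.Ge 1 (aeval x p + aeval x q * y - algebraMap K L (p.eval a + q.eval a * b)) := by
    intro w hwx hwy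
    have h0 := Place.ge_zero_of_ge_sub hwx
    have h3 := ((w.ge_aeval_sub hwx h0 p).add ((w.ge_aeval_sub hwx h0 q).mul_right
      (Place.ge_zero_of_ge_sub hwy))).add ((w.ge_algebraMap (q.eval a)).mul_left hwy)
    convert h3 using 1
    rw [map_add, map_mul]; ring
  have hc : p.eval a + q.eval a * b ≠ 0 := by
    intro hc
    have := value v hx hy
    rw [hc, map_zero, _root_.sub_zero] at this
    have := this hβ0
    omega
  have h4 := v'.ord_add_eq (a := algebraMap K L (p.eval a + q.eval a * b))
    ((_root_.map_ne_zero _).2 hc)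
    (by rw [v'.ord_algebraMap hc]; exact value v' hx' hy')
  rw [add_sub_cancel, v'.ord_algebraMap hc] at h4
  intro hz0
  have := hg (mul_ne_zero hz0 hβ0)
  rw [v'.ord_mul hz0 hβ0, h4.2] at this
  omega

theorem ord_sub_eq_two (M : IsQuadraticModel x y f) (h2 : (2 : K) ≠ 0) {a : K}
    (hx : v.Ge 1 (x - algebraMap K L a)) (hfa : f.eval a = 0) :
    v.ord y = 1 ∧ v.ord (x - algebraMap K L a) = 2 := by
  have hx0 := Place.ge_zero_of_ge_sub hx
  have hy : v.Ge 1 y := by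
    intro hy
    have h := v.ge_aeval_sub hx hx0 f
    rw [hfa, map_zero, _root_.sub_zero, ← M.sq] at h
    have := h (pow_ne_zero 2 hy)
    rw [v.ord_pow hy] at this
    push_cast at this
    omega
  have h1 := M.ord_y_eq_one h2 hx0 hx hy
  refine ⟨h1, ?_⟩
  obtain ⟨g, hg⟩ := dvd_iff_isRoot.2 hfa
  have hga : g.eval a ≠ 0 := by
    have h3 := M.eval_derivative_ne_zero hfa
    rw [hg] at h3
    simpa using h3
  have h4 := v.ord_add_eq (a := algebraMap K L (g.eval a)) (by simpa using hga)
    (by rw [v.ord_algebraMap hga]; exact v.ge_aeval_sub hx hx0 g)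
  rw [add_sub_cancel, v.ord_algebraMap hga] at h4
  have h5 := congrArg v.ord M.sq
  rw [hg, map_mul, map_sub, aeval_X, aeval_C, v.ord_mul (M.sub_ne_zero a) h4.1, h4.2,
    v.ord_pow M.y_ne_zero, h1] at h5
  push_cast at h5
  omega

/-- The orders of `x` and `y` at the point at infinity of `y² = f(x)`, with `f` of odd degree. -/
theorem ord_of_odd [PerfectField K] (M : IsQuadraticModel x y f) (h2 : (2 : K) ≠ 0) {m : ℕ}
    (hf : f.natDegree = 2 * m + 1) (hx : v.ord x < 0) :
    v.ord x = -2 ∧ v.ord y = -(2 * m + 1) := by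
  have M' := M.atInfinity (d := m + 1) (e := 1) (by omega) le_rfl
  have h := M'.ord_sub_eq_two (v := v) h2 (a := 0) (by simpa using Place.ge_one_inv hx) (by simp)
  have hx0 := M.x_ne_zero
  rw [map_zero, _root_.sub_zero, v.ord_mul M.y_ne_zero (pow_ne_zero _ (inv_ne_zero hx0)),
    v.ord_pow (inv_ne_zero hx0), v.ord_inv hx0] at h
  obtain ⟨h3, h4⟩ := h
  have h5 : v.ord x = -2 := by omega
  rw [h5] at h3
  push_cast at h3
  exact ⟨h5, by linarith⟩

/-- For `f` of even degree the covering `x` is not ramified above infinity. -/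
theorem ord_of_even [PerfectField K] (M : IsQuadraticModel x y f) (h2 : (2 : K) ≠ 0) {m : ℕ}
    (hf : f.natDegree = 2 * m) (hx : v.ord x < 0) : v.ord x = -1 := by
  have M' := M.atInfinity (d := m) (e := 0) (by omega) (by omega)
  have hu : v.Ge 1 (x⁻¹ - algebraMap K L 0) := by simpa using Place.ge_one_inv hx
  have hu0 := Place.ge_zero_of_ge_sub hu
  obtain ⟨b, hb⟩ := v.exists_value (M'.ge_y hu0)
  have h3 := M'.sq_eq_eval hu0 hu hb
  have hb0 : b ≠ 0 := by
    rintro rfl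
    rw [pow_zero, one_mul, ← coeff_zero_eq_eval_zero, coeff_zero_reverse] at h3
    have := leadingCoeff_eq_zero.1 (h3.symm.trans (by simp))
    exact M.separable.ne_zero this
  have h4 := M'.ord_sub_eq_one h2 hu0 hu hb hb0
  rw [map_zero, _root_.sub_zero, v.ord_inv M.x_ne_zero] at h4
  omega

/-- For `f` of odd degree there is only one place at infinity. -/
theorem ge_zero_of_ge_zero_of_neg [PerfectField K] (M : IsQuadraticModel x y f) (h2 : (2 : K) ≠ 0)
    {m : ℕ} (hf : f.natDegree = 2 * m + 1) {v v' : Place K L} (hx : v.ord x < 0)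
    (hx' : v'.ord x < 0) {z : L} (hz : v.Ge 0 z) : v'.Ge 0 z := by
  have M' := M.atInfinity (d := m + 1) (e := 1) (by omega) le_rfl
  have hw : ∀ w : Place K L, w.ord x < 0 → w.Ge 1 (y * x⁻¹ ^ (m + 1) - algebraMap K L 0) := by
    intro w hw
    rw [map_zero, _root_.sub_zero]
    exact fun _ => (M'.ord_sub_eq_two (v := w) h2 (a := 0) (by simpa using Place.ge_one_inv hw)
      (by simp)).1.ge
  exact M'.ge_zero_of_ge_zero h2 (a := 0) (b := 0) (by simpa using Place.ge_one_inv hx) (hw v hx)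
    (by simpa using Place.ge_one_inv hx') (hw v' hx') hz

end IsQuadraticModel

/-! ### Regular functions, regular differentials and the genus -/

namespace IsQuadraticModel

/-- The differential `dx / y` in the chart at infinity. -/
theorem omega_at_infinity {K L : Type*} [Field K] [Field L] [Algebra K L] {x y : L} {f : K[X]}
    (M : IsQuadraticModel x y f) (m : ℕ) :
    (x ^ 2) • omega K x⁻¹ (y * x⁻¹ ^ (m + 1)) =
      (-x ^ (m + 1)) • omega K x y := by
  have hx := M.x_ne_zero
  have hy := M.y_ne_zero
  rw [IsQuadraticModel.omega, IsQuadraticModel.omega, Derivation.leibniz_inv, smul_smul, smul_smul,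
    smul_smul]
  congr 1
  field_simp
  rw [← mul_pow, one_div, inv_mul_cancel₀ hx, one_pow]

end IsQuadraticModel

namespace Curve

theorem mem_regularDifferentials_iff {K : Type u} [Field K] {C : Curve K}
    (ω : Ω[C.FunctionField⁄K]) :
    ω ∈ C.regularDifferentials ↔ ∀ P : C.Point, ω ∈ LinearMap.range
      (KaehlerDifferential.map K K (C.LocalRing P.1) C.FunctionField) := by
  simp [regularDifferentials, Submodule.mem_iInf]

theorem ge_zero_iff {K : Type u} [Field K] [IsAlgClosed K] {C : Curve K} (P : C.Point)
    (z : C.FunctionField) :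
    (C.place P).Ge 0 z ↔ ∃ w : C.LocalRing P.1, algebraMap _ C.FunctionField w = z := by
  by_cases hz : z = 0
  · subst hz
    exact ⟨fun _ => ⟨0, map_zero _⟩, fun _ => Place.Ge.zero⟩
  · rw [← C.ord_nonneg_iff P hz]
    exact ⟨fun h => h hz, fun h _ => h⟩

variable {K : Type u} [Field K] [IsAlgClosed K] {C : Curve K} {x y : C.FunctionField} {f : K[X]}

/-- Every affine solution of `b² = f(a)` is the pair of values of `x` and `y` at some point. -/
theorem exists_point (M : IsQuadraticModel x y f) {a b : K} (hab : b ^ 2 = f.eval a) :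
    ∃ P : C.Point, (C.place P).Ge 1 (x - algebraMap K _ a) ∧
      (C.place P).Ge 1 (y - algebraMap K _ b) := by
  set A := Algebra.adjoin K {x, y}
  have hx : x - algebraMap K _ a ∈ A :=
    sub_mem (Algebra.subset_adjoin (by simp)) (A.algebraMap_mem a)
  have hy : y - algebraMap K _ b ∈ A :=
    sub_mem (Algebra.subset_adjoin (by simp)) (A.algebraMap_mem b)
  -- A valuation ring that dominates the coordinate ring at the maximal ideal of `(a, b)`.
  let I : Ideal A.toSubring := Ideal.span {⟨_, hx⟩, ⟨_, hy⟩}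
  have hI : I ≠ ⊤ := by
    rw [Ideal.ne_top_iff_one, Ideal.mem_span_pair]
    rintro ⟨⟨s, hs⟩, ⟨t, ht⟩, h⟩
    obtain ⟨p, q, rfl⟩ := M.mem_adjoin_iff.1 hs
    obtain ⟨p', q', rfl⟩ := M.mem_adjoin_iff.1 ht
    have h1 : (aeval x p + aeval x q * y) * (x - algebraMap K _ a) +
        (aeval x p' + aeval x q' * y) * (y - algebraMap K _ b) = 1 := congrArg Subtype.val h
    obtain ⟨h2, h3⟩ := M.eq_zero
      (p * (Polynomial.X - Polynomial.C a) + q' * f - p' * Polynomial.C b - 1)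
      (q * (Polynomial.X - Polynomial.C a) + p' - q' * Polynomial.C b) (by
        simp only [map_add, map_sub, map_mul, aeval_X, aeval_C, ← M.sq, map_one]
        linear_combination h1)
    have h2 := congrArg (eval a) h2
    have h3 := congrArg (eval a) h3
    simp only [eval_add, eval_sub, eval_mul, eval_X, eval_C, sub_self, mul_zero, eval_one,
      eval_zero, zero_add] at h2 h3
    apply one_ne_zero (α := K)
    linear_combination (-1 : K) * h2 - b * h3 - q'.eval a * hab
  obtain ⟨V, hAV, hIV⟩ := Ideal.image_subset_nonunits_valuationSubring I hI
  have hxV : x - algebraMap K _ a ∈ V.nonunits := hIV ⟨⟨_, hx⟩, Ideal.subset_span (by simp), rfl⟩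
  have hyV : y - algebraMap K _ b ∈ V.nonunits := hIV ⟨⟨_, hy⟩, Ideal.subset_span (by simp), rfl⟩
  have hinv : ∀ z ∈ V.nonunits, z ≠ 0 → z⁻¹ ∉ V := by
    intro z hz h0
    rw [← inv_inv z, V.inv_mem_nonunits_iff] at hz
    exact hz.resolve_left (inv_ne_zero h0)
  obtain ⟨P, hP⟩ := C.exists_point_of_valuationSubring V (fun c => hAV (A.algebraMap_mem c)) (by
    rintro rfl
    exact hinv _ hxV (M.sub_ne_zero a) trivial)
  have hPinv : ∀ z ∈ V.nonunits, (C.place P).Ge 1 z := by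
    intro z hz h0
    have h1 := (hP _ (inv_ne_zero h0)).not.1 (hinv z hz h0)
    change ¬ 0 ≤ (C.place P).ord z⁻¹ at h1
    rw [(C.place P).ord_inv h0] at h1
    omega
  exact ⟨P, hPinv _ hxV, hPinv _ hyV⟩

theorem point_ext_of_value (M : IsQuadraticModel x y f) (h2 : (2 : K) ≠ 0) {a b : K} {P Q : C.Point}
    (hP : (C.place P).Ge 1 (x - algebraMap K _ a)) (hP' : (C.place P).Ge 1 (y - algebraMap K _ b))
    (hQ : (C.place Q).Ge 1 (x - algebraMap K _ a)) (hQ' : (C.place Q).Ge 1 (y - algebraMap K _ b)) :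
    P = Q :=
  C.point_ext fun _ hz0 hz => M.ge_zero_of_ge_zero h2 hQ hQ' hP hP' (fun _ => hz) hz0

theorem point_ext_of_neg (M : IsQuadraticModel x y f) (h2 : (2 : K) ≠ 0) {m : ℕ}
    (hf : f.natDegree = 2 * m + 1) {P Q : C.Point} (hP : C.ord x P < 0) (hQ : C.ord x Q < 0) :
    P = Q :=
  C.point_ext fun _ hz0 hz => M.ge_zero_of_ge_zero_of_neg h2 hf (v := C.place Q) (v' := C.place P)
    hQ hP (fun _ => hz) hz0

theorem exists_point_at_infinity (M : IsQuadraticModel x y f) {m : ℕ}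
    (hf : f.natDegree = 2 * m + 1) : ∃ P : C.Point, C.ord x P < 0 := by
  have M' := M.atInfinity (d := m + 1) (e := 1) (by omega) le_rfl
  obtain ⟨P, hP, -⟩ := exists_point M' (a := 0) (b := 0) (by simp)
  refine ⟨P, ?_⟩
  rw [map_zero, sub_zero] at hP
  have := hP (inv_ne_zero M.x_ne_zero)
  rw [(C.place P).ord_inv M.x_ne_zero] at this
  change (C.place P).ord x < 0
  omega

/-- A function without poles outside infinity belongs to the coordinate ring: the linear factors
`x - a` of its denominator cancel, by its regularity at the points above `a`. -/
theorem exists_eq_of_forall_ge (M : IsQuadraticModel x y f) (h2 : (2 : K) ≠ 0)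
    {h : C.FunctionField}
    (hreg : ∀ P : C.Point, (C.place P).Ge 0 x → (C.place P).Ge 0 h) :
    ∃ p q : K[X], h = aeval x p + aeval x q * y := by
  obtain ⟨p, q, r, hr, hpq⟩ := M.exists_repr h
  obtain ⟨n, hn⟩ : ∃ n, r.natDegree = n := ⟨_, rfl⟩
  induction n generalizing p q r with
  | zero =>
    obtain ⟨c, rfl⟩ := natDegree_eq_zero.1 hn
    have hc : c ≠ 0 := by simpa using hr
    refine ⟨Polynomial.C c⁻¹ * p, Polynomial.C c⁻¹ * q, ?_⟩
    simp only [map_mul, aeval_C, map_inv₀] at hpq ⊢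
    have : algebraMap K C.FunctionField c ≠ 0 := by simpa using hc
    field_simp
    exact hpq
  | succ n ih =>
    obtain ⟨a, ha⟩ := IsAlgClosed.exists_root r (by
      rw [degree_eq_natDegree hr, hn]; exact_mod_cast Nat.succ_ne_zero n)
    obtain ⟨r₁, rfl⟩ := dvd_iff_isRoot.2 ha
    have hr₁ : r₁ ≠ 0 := right_ne_zero_of_mul hr
    have hn₁ : r₁.natDegree = n := by
      rw [natDegree_mul (X_sub_C_ne_zero a) hr₁, natDegree_X_sub_C] at hn
      omega
    have value : ∀ b : K, b ^ 2 = f.eval a → p.eval a + q.eval a * b = 0 := by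
      intro b hb
      obtain ⟨P, hP, hP'⟩ := exists_point M hb
      have hx0 := Place.ge_zero_of_ge_sub hP
      apply (C.place P).eq_zero_of_ge
      have h3 : (C.place P).Ge 1 (aeval x p + aeval x q * y) := by
        rw [← hpq, map_mul, map_sub, aeval_X, aeval_C]
        exact (hreg P hx0).mul_left (hP.mul_right ((C.place P).ge_aeval hx0 r₁))
      have h4 := ((h3.sub ((C.place P).ge_aeval_sub hP hx0 p)).sub
        (((C.place P).ge_aeval_sub hP hx0 q).mul_right (Place.ge_zero_of_ge_sub hP'))).sub
        (((C.place P).ge_algebraMap (q.eval a)).mul_left hP')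
      convert h4 using 1
      rw [map_add, map_mul]
      ring
    have hdiv : p.eval a = 0 → q.eval a = 0 →
        ∃ p q : K[X], h = aeval x p + aeval x q * y := by
      intro hp hq
      obtain ⟨p₁, rfl⟩ := dvd_iff_isRoot.2 hp
      obtain ⟨q₁, rfl⟩ := dvd_iff_isRoot.2 hq
      refine ih p₁ q₁ r₁ hr₁ ?_ hn₁
      apply mul_left_cancel₀ (M.sub_ne_zero a)
      simp only [map_mul, map_sub, aeval_X, aeval_C] at hpq
      linear_combination hpq
    obtain ⟨b, hb⟩ := IsAlgClosed.exists_pow_nat_eq (f.eval a) two_pos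
    by_cases hb0 : b = 0
    · subst hb0
      have hp : p.eval a = 0 := by simpa using value 0 hb
      have hfa : f.eval a = 0 := by rw [← hb]; simp
      refine hdiv hp ?_
      by_contra hq
      obtain ⟨p₁, rfl⟩ := dvd_iff_isRoot.2 hp
      obtain ⟨P, hP, -⟩ := exists_point M hb
      have hx0 := Place.ge_zero_of_ge_sub hP
      obtain ⟨hy1, hx2⟩ := M.ord_sub_eq_two h2 hP hfa
      have h3 := (C.place P).ord_add_eq (a := algebraMap K _ (q.eval a)) (by simpa using hq)
        (by rw [(C.place P).ord_algebraMap hq]; exact (C.place P).ge_aeval_sub hP hx0 q)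
      rw [add_sub_cancel, (C.place P).ord_algebraMap hq] at h3
      simp only [map_mul, map_sub, aeval_X, aeval_C] at hpq
      have h4 : aeval x q * y =
          (x - algebraMap K _ a) * (h * aeval x r₁ - aeval x p₁) := by
        linear_combination -hpq
      have h5 : (C.place P).Ge 2 (aeval x q * y) := by
        rw [h4]
        have : (C.place P).Ge 2 (x - algebraMap K _ a) := fun _ => hx2.ge
        exact this.mul_right (((hreg P hx0).mul_left ((C.place P).ge_aeval hx0 r₁)).sub
          ((C.place P).ge_aeval hx0 p₁))
      have := h5 (mul_ne_zero h3.1 M.y_ne_zero)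
      rw [(C.place P).ord_mul h3.1 M.y_ne_zero, h3.2, hy1] at this
      omega
    · have h3 := value b hb
      have h4 := value (-b) (by rw [neg_sq, hb])
      have hq : q.eval a = 0 := by
        have : (2 * b) * q.eval a = 0 := by linear_combination h3 - h4
        exact (mul_eq_zero.1 this).resolve_left (mul_ne_zero h2 hb0)
      exact hdiv (by simpa [hq] using h3) hq

/-- The order at infinity of an element of the coordinate ring: `p(x)` has even order and `q(x) y`
has odd order there, so that nothing cancels. -/
theorem natDegree_le_of_ge (M : IsQuadraticModel x y f) (h2 : (2 : K) ≠ 0) {m : ℕ}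
    (hf : f.natDegree = 2 * m + 1) {v : Place K C.FunctionField} (hx : v.ord x < 0) {p q : K[X]}
    {d : ℕ} (h : v.Ge (-d) (aeval x p + aeval x q * y)) :
    (p ≠ 0 → 2 * p.natDegree ≤ d) ∧ (q ≠ 0 → 2 * q.natDegree + 2 * m + 1 ≤ d) := by
  obtain ⟨hx2, hy⟩ := M.ord_of_odd h2 hf hx
  have hp' : p ≠ 0 → aeval x p ≠ 0 ∧ v.ord (aeval x p) = -(2 * p.natDegree) := fun hp => by
    obtain ⟨h3, h4⟩ := v.ord_aeval_of_neg M.x_ne_zero hx hp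
    exact ⟨h3, by rw [h4, hx2]; ring⟩
  have hq' : q ≠ 0 → aeval x q * y ≠ 0 ∧
      v.ord (aeval x q * y) = -(2 * q.natDegree + 2 * m + 1) := fun hq => by
    obtain ⟨h3, h4⟩ := v.ord_aeval_of_neg M.x_ne_zero hx hq
    exact ⟨mul_ne_zero h3 M.y_ne_zero, by
      rw [v.ord_mul h3 M.y_ne_zero, h4, hx2, hy]; ring⟩
  by_cases hp : p = 0
  · refine ⟨fun h => absurd hp h, fun hq => ?_⟩
    rw [hp, map_zero, zero_add] at h
    have := h (hq' hq).1
    rw [(hq' hq).2] at this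
    omega
  by_cases hq : q = 0
  · refine ⟨fun _ => ?_, fun h => absurd hq h⟩
    rw [hq, map_zero, zero_mul, add_zero] at h
    have := h (hp' hp).1
    rw [(hp' hp).2] at this
    omega
  obtain ⟨hp0, hp1⟩ := hp' hp
  obtain ⟨hq0, hq1⟩ := hq' hq
  rcases lt_trichotomy (v.ord (aeval x p)) (v.ord (aeval x q * y)) with hlt | heq | hlt
  · have h3 := v.ord_add_eq hp0 (b := aeval x q * y) fun _ => hlt
    have := h h3.1
    rw [h3.2] at this
    exact ⟨fun _ => by omega, fun _ => by omega⟩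
  · omega
  · have h3 := v.ord_add_eq hq0 (b := aeval x p) fun _ => hlt
    rw [add_comm] at h3
    have := h h3.1
    rw [h3.2] at this
    exact ⟨fun _ => by omega, fun _ => by omega⟩

/-- The regular differentials of `y² = f(x)`, with `deg f = 2 m + 1`, are the `p(x) dx / y` with
`deg p < m`. -/
theorem mem_regularDifferentials_iff_of_model (M : IsQuadraticModel x y f) (h2 : (2 : K) ≠ 0)
    {m : ℕ} (hf : f.natDegree = 2 * m + 1) (hω : IsQuadraticModel.omega K x y ≠ 0)
    (ω : Ω[C.FunctionField⁄K]) :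
    ω ∈ C.regularDifferentials ↔
      ∃ p ∈ degreeLT K m, ω = aeval x p • IsQuadraticModel.omega K x y := by
  have hx0 := M.x_ne_zero
  have M' := M.atInfinity (d := m + 1) (e := 1) (by omega) le_rfl
  have hinf := M.omega_at_infinity m
  have smul_inj : ∀ {s t : C.FunctionField}, s • IsQuadraticModel.omega K x y =
      t • IsQuadraticModel.omega K x y → s = t := fun h => smul_left_injective _ hω h
  rw [mem_regularDifferentials_iff]
  constructor
  · intro h
    obtain ⟨O, hO⟩ := exists_point_at_infinity M hf
    obtain ⟨b, hb⟩ := IsAlgClosed.exists_pow_nat_eq (f.eval 0) two_pos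
    obtain ⟨P, hP, -⟩ := exists_point M hb
    obtain ⟨s, -, rfl⟩ := (M.mem_range_map_iff h2 (Place.ge_zero_of_ge_sub hP) (ge_zero_iff P) ω).1
      (h P)
    obtain ⟨p, q, rfl⟩ := exists_eq_of_forall_ge M h2 (h := s) (by
      intro Q hQ
      obtain ⟨t, ht, hst⟩ := (M.mem_range_map_iff h2 hQ (ge_zero_iff Q) _).1 (h Q)
      rwa [smul_inj hst])
    obtain ⟨t, ht, hst⟩ := (M'.mem_range_map_iff h2
      ((Place.ge_one_inv (v := C.place O) hO).mono (by norm_num)) (ge_zero_iff O) _).1 (h O)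
    have hst' : (aeval x p + aeval x q * y) * x ^ 2 = t * -x ^ (m + 1) := by
      apply smul_inj
      rw [mul_smul, smul_comm, hst, smul_comm, hinf, ← mul_smul]
    have hord := (M.ord_of_odd h2 hf (v := C.place O) hO).1
    have hge : (C.place O).Ge (-((2 * m - 2 : ℤ))) (aeval x p + aeval x q * y) := by
      intro h0
      have ht0 : t ≠ 0 := by
        rintro rfl
        rw [zero_mul] at hst'
        exact mul_ne_zero h0 (pow_ne_zero 2 hx0) hst'
      have h3 := congrArg (C.place O).ord hst'
      rw [(C.place O).ord_mul h0 (pow_ne_zero 2 hx0), (C.place O).ord_mul ht0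
        (neg_ne_zero.2 (pow_ne_zero _ hx0)), (C.place O).ord_neg, (C.place O).ord_pow hx0,
        (C.place O).ord_pow hx0, hord] at h3
      have h4 := ht ht0
      push_cast at h3
      linarith
    -- For `m = 0` the bound `2 m - 2` on the pole order is negative and the form vanishes.
    by_cases hm : m = 0
    · subst hm
      have hz := hge
      by_cases h0 : aeval x p + aeval x q * y = 0
      · exact ⟨0, Submodule.zero_mem _, by simp [h0]⟩
      · exfalso
        have h5 := natDegree_le_of_ge M h2 hf (v := C.place O) hO (d := 0)
          (hge.mono (by norm_num))
        have hq : q = 0 := by by_contra hq; have := h5.2 hq; omega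
        have hp : p ≠ 0 := by rintro rfl; simp [hq] at h0
        have h6 := h5.1 hp
        obtain ⟨c, rfl⟩ := natDegree_eq_zero.1 (show p.natDegree = 0 by omega)
        have h7 := hge h0
        rw [hq, map_zero, zero_mul, add_zero, aeval_C,
          (C.place O).ord_algebraMap (by simpa using hp)] at h7
        norm_num at h7
    obtain ⟨hp, hq⟩ := natDegree_le_of_ge M h2 hf (v := C.place O) hO (d := 2 * m - 2)
      (hge.mono (by omega))
    have hq0 : q = 0 := by by_contra h0; have := hq h0; omega
    refine ⟨p, ?_, by rw [hq0]; simp⟩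
    rw [mem_degreeLT]
    by_cases hp0 : p = 0
    · rw [hp0, degree_zero]; exact WithBot.bot_lt_coe m
    · rw [← natDegree_lt_iff_degree_lt hp0]
      have := hp hp0
      omega
  · rintro ⟨p, hp, rfl⟩ P
    by_cases hP : (C.place P).Ge 0 x
    · exact (M.mem_range_map_iff h2 hP (ge_zero_iff P) _).2 ⟨_, (C.place P).ge_aeval hP p, rfl⟩
    · have hO : (C.place P).ord x < 0 := by
        by_contra h
        exact hP fun _ => not_lt.1 h
      rw [M'.mem_range_map_iff h2 ((Place.ge_one_inv (v := C.place P) hO).mono (by norm_num))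
        (ge_zero_iff P)]
      refine ⟨-(aeval x p * x ^ 2 * x⁻¹ ^ (m + 1)), ?_, ?_⟩
      · refine Place.Ge.neg ?_
        by_cases hp0 : p = 0
        · simpa [hp0] using Place.Ge.zero
        rw [mem_degreeLT, ← natDegree_lt_iff_degree_lt hp0] at hp
        obtain ⟨h3, h4⟩ := (C.place P).ord_aeval_of_neg hx0 hO hp0
        intro _
        rw [(C.place P).ord_mul (mul_ne_zero h3 (pow_ne_zero _ hx0))
          (pow_ne_zero _ (inv_ne_zero hx0)), (C.place P).ord_mul h3 (pow_ne_zero _ hx0), h4,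
          (C.place P).ord_pow hx0, (C.place P).ord_pow (inv_ne_zero hx0), (C.place P).ord_inv hx0,
          (M.ord_of_odd h2 hf hO).1]
        push_cast
        have : (p.natDegree : ℤ) + 1 ≤ m := by exact_mod_cast hp
        linarith
      · rw [mul_right_comm, ← neg_mul, mul_smul, hinf, smul_smul]
        congr 1
        have : x⁻¹ ^ (m + 1) * x ^ (m + 1) = 1 := by
          rw [← mul_pow, inv_mul_cancel₀ hx0, one_pow]
        linear_combination (-aeval x p) * this

/-- The hypothesis `hg` serves to show that `dx / y` is not zero. -/
theorem genus_eq_of_model (M : IsQuadraticModel x y f) (h2 : (2 : K) ≠ 0) {m : ℕ}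
    (hf : f.natDegree = 2 * m + 1) (hg : C.genus ≠ 0) : C.genus = m := by
  have hω : IsQuadraticModel.omega K x y ≠ 0 := by
    intro h0
    apply hg
    have hbot : C.regularDifferentials = ⊥ := by
      rw [eq_bot_iff]
      intro ω hω
      rw [mem_regularDifferentials_iff] at hω
      obtain ⟨b, hb⟩ := IsAlgClosed.exists_pow_nat_eq (f.eval 0) two_pos
      obtain ⟨P, hP, -⟩ := exists_point M hb
      obtain ⟨s, -, rfl⟩ := (M.mem_range_map_iff h2 (Place.ge_zero_of_ge_sub hP)
        (ge_zero_iff P) ω).1 (hω P)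
      rw [h0, smul_zero]
      exact Submodule.zero_mem _
    rw [genus, hbot, finrank_bot]
  let φ : degreeLT K m →ₗ[K] Ω[C.FunctionField⁄K] :=
    ((LinearMap.toSpanSingleton C.FunctionField _ (IsQuadraticModel.omega K x y)).restrictScalars
      K) ∘ₗ (aeval x).toLinearMap ∘ₗ (degreeLT K m).subtype
  have hφ : ∀ p : degreeLT K m, φ p = aeval x p.1 • IsQuadraticModel.omega K x y := fun _ => rfl
  have hinj : Function.Injective φ := by
    rw [injective_iff_map_eq_zero]
    intro p hp
    rw [hφ, smul_eq_zero] at hp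
    by_contra h0
    exact M.aeval_ne_zero (fun h => h0 (Subtype.ext h)) (hp.resolve_right hω)
  have hrange : C.regularDifferentials = LinearMap.range φ := by
    ext ω
    rw [mem_regularDifferentials_iff_of_model M h2 hf hω]
    constructor
    · rintro ⟨p, hp, rfl⟩
      exact ⟨⟨p, hp⟩, rfl⟩
    · rintro ⟨p, rfl⟩
      exact ⟨p.1, p.2, rfl⟩
  rw [genus, hrange, LinearMap.finrank_range_of_inj hinj, (degreeLTEquiv K m).finrank_eq]
  simp

end Curve

/-! ### Equations of marked hyperelliptic curves -/

theorem exists_eq_add_mul_of_finrank_eq_two {F L : Type*} [Field F] [Field L] [Algebra F L]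
    (h : Module.finrank F L = 2) {z : L} (hz : ∀ c : F, algebraMap F L c ≠ z) (w : L) :
    ∃ a b : F, w = algebraMap F L a + algebraMap F L b * z := by
  have hli : LinearIndependent F ![1, z] := by
    rw [LinearIndependent.pair_iff]
    intro s t hst
    have ht : t = 0 := by
      by_contra ht
      apply hz (-s / t)
      have : algebraMap F L t ≠ 0 := by simpa using ht
      rw [map_div₀, map_neg, div_eq_iff this]
      rw [Algebra.smul_def, Algebra.smul_def, mul_one] at hst
      linear_combination -hst
    subst ht
    refine ⟨?_, rfl⟩
    simpa using hst
  let b := basisOfLinearIndependentOfCardEqFinrank hli (by simp [h])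
  refine ⟨b.repr w 0, b.repr w 1, ?_⟩
  have := b.sum_repr w
  rw [Fin.sum_univ_two] at this
  simpa [b, Algebra.smul_def] using this.symm

/-- A quadratic extension of `K(x)` is the function field of a curve `y² = f(x)`: complete the
square, and choose `f` of minimal degree to make it squarefree. -/
theorem exists_isQuadraticModel {K L : Type*} [Field K] [PerfectField K] [Field L] [Algebra K L]
    (h2 : (2 : K) ≠ 0) {x : L} (hx : ∀ p : K[X], p ≠ 0 → aeval x p ≠ 0)
    (hL : Module.finrank K⟮x⟯ L = 2) : ∃ (y : L) (f : K[X]), IsQuadraticModel x y f := by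
  have hxF : ∀ p : K[X], aeval x p ∈ K⟮x⟯ := fun p => by
    have := (aeval (⟨x, IntermediateField.mem_adjoin_simple_self K x⟩ : K⟮x⟯) p).2
    rwa [← IntermediateField.coe_val, ← Polynomial.aeval_algHom_apply] at this
  have h2L : (2 : L) ≠ 0 := by
    rw [← map_ofNat (algebraMap K L) 2]
    simpa using h2
  have gen : ∀ {z : L}, z ∉ K⟮x⟯ → ∀ w : L, ∃ a ∈ K⟮x⟯, ∃ b ∈ K⟮x⟯, w = a + b * z := by
    intro z hz w
    obtain ⟨a, b, h⟩ := exists_eq_add_mul_of_finrank_eq_two hL (z := z)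
      (fun c hc => hz (hc ▸ c.2)) w
    exact ⟨a, a.2, b, b.2, h⟩
  have hex : ∃ n : ℕ, ∃ (y : L) (f : K[X]), y ∉ K⟮x⟯ ∧ y ^ 2 = aeval x f ∧ f.natDegree = n := by
    obtain ⟨z, hz⟩ : ∃ z, z ∉ K⟮x⟯ := by
      by_contra! hall
      have h1 : Module.finrank K⟮x⟯ L = 1 := by
        have htop : K⟮x⟯ = ⊤ := by ext z; simp [hall z]
        rw [htop]
        exact IntermediateField.finrank_top
      omega
    obtain ⟨a, ha, b, hb, hab⟩ := gen hz (z ^ 2)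
    have hsq : (z - b / 2) ^ 2 = a + b ^ 2 / 4 := by
      have : (4 : L) = 2 * 2 := by norm_num
      rw [this]
      field_simp
      linear_combination 4 * hab
    have h2F : (2 : L) ∈ K⟮x⟯ := ofNat_mem _ 2
    have h4F : (4 : L) ∈ K⟮x⟯ := ofNat_mem _ 4
    have hyF : z - b / 2 ∉ K⟮x⟯ := fun h => hz (by
      have := add_mem h (div_mem hb h2F)
      rwa [sub_add_cancel] at this)
    have hsF : (z - b / 2) ^ 2 ∈ K⟮x⟯ := by
      rw [hsq]
      exact add_mem ha (div_mem (pow_mem hb 2) h4F)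
    obtain ⟨p, r, hpr⟩ := IntermediateField.mem_adjoin_simple_iff K _ |>.1 hsF
    have hr : aeval x r ≠ 0 := by
      intro h0
      rw [h0, div_zero] at hpr
      exact hyF (by rw [pow_eq_zero_iff two_ne_zero |>.1 hpr]; exact zero_mem _)
    refine ⟨_, aeval x r * (z - b / 2), p * r, fun h => hyF ?_, ?_, rfl⟩
    · have := div_mem h (hxF r)
      rwa [mul_div_cancel_left₀ _ hr] at this
    · rw [mul_pow, hpr, map_mul]
      field_simp
  classical
  obtain ⟨y, f, hy, hyf, hn⟩ := Nat.find_spec hex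
  have hmin := fun m => Nat.find_min (m := m) hex
  rw [← hn] at hmin
  have hf0 : f ≠ 0 := by
    rintro rfl
    rw [map_zero, pow_eq_zero_iff two_ne_zero] at hyf
    exact hy (hyf ▸ zero_mem _)
  refine ⟨y, f, hyf, ?_, fun z => ?_, fun p q h => ?_⟩
  · rw [PerfectField.separable_iff_squarefree]
    rintro d ⟨e, rfl⟩
    have hd0 : d ≠ 0 := by rintro rfl; simp at hf0
    have he0 : e ≠ 0 := by rintro rfl; simp at hf0
    by_contra hd
    have hdeg : d.natDegree ≠ 0 := by
      intro h
      obtain ⟨c, rfl⟩ := natDegree_eq_zero.1 h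
      exact hd (isUnit_C.2 (isUnit_iff_ne_zero.2 (by simpa using hd0)))
    refine hmin e.natDegree ?_ ⟨y / aeval x d, e, fun h => hy ?_, ?_, rfl⟩
    · rw [natDegree_mul (mul_ne_zero hd0 hd0) he0, natDegree_mul hd0 hd0]
      omega
    · have := mul_mem h (hxF d)
      rwa [div_mul_cancel₀ _ (hx d hd0)] at this
    · rw [div_pow, hyf, map_mul, map_mul]
      have := hx d hd0
      field_simp
  · obtain ⟨a, ha, b, hb, rfl⟩ := gen hy z
    obtain ⟨p, r, hr, rfl⟩ : ∃ p r : K[X], r ≠ 0 ∧ a = aeval x p / aeval x r := by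
      obtain ⟨p, r, rfl⟩ := IntermediateField.mem_adjoin_simple_iff K _ |>.1 ha
      by_cases hr : r = 0
      · exact ⟨0, 1, one_ne_zero, by simp [hr]⟩
      · exact ⟨p, r, hr, rfl⟩
    obtain ⟨q, s, hs, rfl⟩ : ∃ p r : K[X], r ≠ 0 ∧ b = aeval x p / aeval x r := by
      obtain ⟨p, r, rfl⟩ := IntermediateField.mem_adjoin_simple_iff K _ |>.1 hb
      by_cases hr : r = 0
      · exact ⟨0, 1, one_ne_zero, by simp [hr]⟩
      · exact ⟨p, r, hr, rfl⟩
    refine ⟨p * s, q * r, r * s, mul_ne_zero hr hs, ?_⟩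
    have := hx r hr
    have := hx s hs
    simp only [map_mul]
    field_simp
  · have hq : q = 0 := by
      by_contra hq
      apply hy
      have h1 := div_mem (neg_mem (hxF p)) (hxF q)
      have h3 : y = -aeval x p / aeval x q := by
        rw [eq_div_iff (hx q hq)]
        linear_combination h
      rwa [← h3] at h1
    refine ⟨?_, hq⟩
    by_contra hp
    exact hx p hp (by simpa [hq] using h)

namespace MarkedHyperellipticCurve
variable {K : Type u} [Field K] [IsAlgClosed K] {g : ℕ}

/-- A coordinate of the projective line can be chosen such that the marked point, a ramification
point, lies above infinity. -/
theorem exists_doubleCover_pole (C : MarkedHyperellipticCurve K g) :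
    ∃ x : C.FunctionField, C.toCurve.IsDoubleCover x ∧ C.toCurve.ord x C.pt ≤ -2 := by
  obtain ⟨x, hx, ⟨c, hc⟩ | h⟩ := C.exists_doubleCover
  · have h0 : x - algebraMap K C.FunctionField c ≠ 0 := by
      intro h0
      rw [h0, Curve.ord, Scheme.ord_zero] at hc
      simp at hc
    refine ⟨(x - algebraMap K C.FunctionField c)⁻¹, ?_, ?_⟩
    · have hadj : K⟮(x - algebraMap K C.FunctionField c)⁻¹⟯ = K⟮x⟯ := by
        apply le_antisymm
        · rw [IntermediateField.adjoin_simple_le_iff]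
          exact inv_mem (sub_mem (IntermediateField.mem_adjoin_simple_self K x)
            (IntermediateField.algebraMap_mem _ c))
        · rw [IntermediateField.adjoin_simple_le_iff]
          have := add_mem (inv_mem (IntermediateField.mem_adjoin_simple_self K
            (x - algebraMap K C.FunctionField c)⁻¹))
            (IntermediateField.algebraMap_mem
              K⟮(x - algebraMap K C.FunctionField c)⁻¹⟯ c)
          rwa [inv_inv, sub_add_cancel] at this
      rw [Curve.IsDoubleCover, hadj]
      exact hx
    · have := (C.toCurve.place C.pt).ord_inv h0
      change C.toCurve.ord _ C.pt = - C.toCurve.ord _ C.pt at this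
      omega
  · exact ⟨x, hx, h⟩

/-- Every marked hyperelliptic curve is given by an equation `y² = f(x)` with `f` monic of degree
`2 g + 1` and with the marked point at infinity. -/
theorem exists_model (C : MarkedHyperellipticCurve K g) (hg : g ≠ 0) (h2 : (2 : K) ≠ 0) :
    ∃ (x y : C.FunctionField) (f : K[X]), IsQuadraticModel x y f ∧ f.Monic ∧
      f.natDegree = 2 * g + 1 ∧ C.toCurve.ord x C.pt < 0 := by
  obtain ⟨x, hx, hO⟩ := C.exists_doubleCover_pole
  have hx0 : x ≠ 0 := by
    rintro rfl
    rw [Curve.ord, Scheme.ord_zero] at hO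
    simp at hO
  have hO' : (C.toCurve.place C.pt).ord x < 0 := by
    change C.toCurve.ord x C.pt < 0
    omega
  obtain ⟨y, f, M⟩ := exists_isQuadraticModel h2
    (fun p hp => (Place.ord_aeval_of_neg hx0 hO' hp).1) hx
  -- The degree of `f` is odd because `x` is ramified at the marked point.
  obtain ⟨m, hm⟩ | ⟨m, hm⟩ := Nat.even_or_odd f.natDegree
  · have := M.ord_of_even h2 (hm.trans (two_mul m).symm) hO'
    change C.toCurve.ord x C.pt = -1 at this
    omega
  have hgm := Curve.genus_eq_of_model M h2 hm (by rw [C.genus_eq]; exact hg)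
  rw [C.genus_eq] at hgm
  subst hgm
  obtain ⟨c, hc⟩ := IsAlgClosed.exists_pow_nat_eq f.leadingCoeff two_pos
  have hlead : f.leadingCoeff ≠ 0 := leadingCoeff_ne_zero.2 M.separable.ne_zero
  have hc0 : c ≠ 0 := by
    rintro rfl
    apply hlead
    rw [← hc]
    simp
  have M' := M.affine (α := 1) (β := 0) (γ := c) one_ne_zero hc0
  simp only [inv_one, map_one, map_zero, sub_zero, one_mul, add_zero, comp_X] at M'
  refine ⟨x, _, _, M', ?_, ?_, hO'⟩
  · rw [Monic, leadingCoeff_mul, leadingCoeff_C, ← hc, ← mul_pow, inv_mul_cancel₀ hc0, one_pow]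
  · rw [natDegree_C_mul (pow_ne_zero 2 (inv_ne_zero hc0)), hm]

/-- Marked curves with the same equation are isomorphic. -/
theorem isIsomorphic_of_model {C D : MarkedHyperellipticCurve K g} (h2 : (2 : K) ≠ 0)
    {x y : C.FunctionField} {x' y' : D.FunctionField} {f : K[X]} {m : ℕ}
    (M : IsQuadraticModel x y f) (M' : IsQuadraticModel x' y' f) (hf : f.natDegree = 2 * m + 1)
    (hC : C.toCurve.ord x C.pt < 0) (hD : D.toCurve.ord x' D.pt < 0) : C.IsIsomorphic D := by
  obtain ⟨θ, hx, -⟩ := M'.exists_algEquiv M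
  obtain ⟨φ, h1, h3⟩ := Curve.exists_iso C.toCurve D.toCurve θ
  refine ⟨φ, h1, h3 _ _ fun z hz0 hz => ?_⟩
  refine M'.ge_zero_of_ge_zero_of_neg h2 hf (v := D.toCurve.place D.pt)
    (v' := (C.toCurve.place C.pt).comap θ) hD ?_ (fun _ => hz) hz0
  change C.toCurve.ord (θ x') C.pt < 0
  rwa [hx]

end MarkedHyperellipticCurve

/-! ### Points of order `2 g + 1` -/

namespace Curve
variable {K : Type u} [Field K] [IsAlgClosed K] {C : Curve K}

/-- A point of order `n` comes with a function of divisor `n (P - O)`. -/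
theorem exists_function_of_addOrderOf {K : Type u} [Field K] {C : Curve K} {O P : C.Point} {n : ℕ}
    (hn1 : n ≠ 1) (hn : addOrderOf (C.abelJacobi O P) = n) :
    P ≠ O ∧ ∃ h : C.FunctionField, h ≠ 0 ∧ C.ord h O = -n ∧ C.ord h P = n ∧
      ∀ Q, Q ≠ P → Q ≠ O → C.ord h Q = 0 := by
  have hPO : P ≠ O := by
    rintro rfl
    apply hn1
    rw [← hn, AddMonoid.addOrderOf_eq_one_iff, abelJacobi, QuotientAddGroup.eq_zero_iff]
    simp only [sub_self]
    exact zero_mem _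
  refine ⟨hPO, ?_⟩
  have h := addOrderOf_nsmul_eq_zero (C.abelJacobi O P)
  rw [hn, abelJacobi, ← QuotientAddGroup.mk_nsmul, QuotientAddGroup.eq_zero_iff,
    AddSubgroup.mem_addSubgroupOf] at h
  obtain ⟨h, h0, hD⟩ := h
  have hD' : ∀ Q, C.ord h Q =
      n * ((Finsupp.single P 1 : C.Divisor) Q - (Finsupp.single O 1 : C.Divisor) Q) := by
    intro Q
    rw [← hD]
    simp
  refine ⟨h, h0, ?_, ?_, fun Q hP hO => ?_⟩
  · rw [hD', Finsupp.single_eq_same, Finsupp.single_eq_of_ne hPO.symm]; ring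
  · rw [hD', Finsupp.single_eq_same, Finsupp.single_eq_of_ne hPO]; ring
  · rw [hD', Finsupp.single_eq_of_ne hP, Finsupp.single_eq_of_ne hO]; ring

/-- A monic polynomial with a single root. -/
theorem eq_X_sub_C_pow_of_forall_root {f : K[X]} (hf : f.Monic) {a : K}
    (h : ∀ c, f.eval c = 0 → c = a) : f = (Polynomial.X - Polynomial.C a) ^ f.natDegree := by
  have hs := IsAlgClosed.splits f
  have h1 := hs.eq_prod_roots_of_monic hf
  have h3 : f.roots = Multiset.replicate f.natDegree a := by
    rw [Multiset.eq_replicate]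
    refine ⟨hs.natDegree_eq_card_roots.symm, fun b hb => h b ((mem_roots hf.ne_zero).1 hb)⟩
  conv_lhs => rw [h1, h3]
  simp

/-- If `P` has order `2 m + 1`, then the function with divisor `(2 m + 1)(P - O)` is, up to a
constant, of the form `y + v(x)`, and its norm `v² - f` is a power of `x - x(P)`. -/
theorem exists_eq_pow_add_sq {x y : C.FunctionField} {f : K[X]} (M : IsQuadraticModel x y f)
    (h2 : (2 : K) ≠ 0) {m : ℕ} (hm : m ≠ 0) (hfm : f.Monic) (hf : f.natDegree = 2 * m + 1)
    {O P : C.Point} (hO : C.ord x O < 0) (hP : addOrderOf (C.abelJacobi O P) = 2 * m + 1) :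
    ∃ (a : K) (v : K[X]), v.natDegree ≤ m ∧
      f = (Polynomial.X - Polynomial.C a) ^ (2 * m + 1) + v ^ 2 ∧
      (C.place P).Ge 1 (x - algebraMap K _ a) := by
  obtain ⟨hPO, h, h0, hhO, hhP, hhQ⟩ := exists_function_of_addOrderOf (by omega) hP
  have hfin : ∀ Q, Q ≠ O → (C.place Q).Ge 0 x := by
    intro Q hQ _
    by_contra hneg
    exact hQ (point_ext_of_neg M h2 hf (not_le.1 hneg) hO)
  obtain ⟨p, q, rfl⟩ := exists_eq_of_forall_ge M h2 (h := h) (by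
    intro Q hQ _
    have hQO : Q ≠ O := by
      rintro rfl
      exact absurd (hQ M.x_ne_zero) (not_le.2 hO)
    change 0 ≤ C.ord h Q
    by_cases hQP : Q = P
    · rw [hQP, hhP]; positivity
    · rw [hhQ Q hQP hQO])
  obtain ⟨hp, hq⟩ := natDegree_le_of_ge M h2 hf (v := C.place O) hO (p := p) (q := q)
    (d := 2 * m + 1) (fun _ => by
      change _ ≤ C.ord _ O
      rw [hhO])
  have hq0 : q ≠ 0 := by
    rintro rfl
    rw [map_zero, zero_mul, add_zero] at h0 hhO
    have hp0 : p ≠ 0 := by rintro rfl; simp at h0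
    have := (Place.ord_aeval_of_neg (v := C.place O) M.x_ne_zero hO hp0).2
    change C.ord _ O = _ * (C.place O).ord x at this
    rw [hhO, (M.ord_of_odd h2 hf (v := C.place O) hO).1] at this
    push_cast at this
    omega
  have hq1 := hq hq0
  obtain ⟨c, rfl⟩ := natDegree_eq_zero.1 (show q.natDegree = 0 by omega)
  have hc : c ≠ 0 := by simpa using hq0
  obtain ⟨a, ha⟩ := (C.place P).exists_value (hfin P hPO)
  set v := Polynomial.C c⁻¹ * p with hv
  have hvp : p = Polynomial.C c * v := by
    rw [hv, ← mul_assoc, ← Polynomial.C_mul, mul_inv_cancel₀ hc, Polynomial.C_1, one_mul]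
  have hvdeg : v.natDegree ≤ m := by
    rw [hv, natDegree_C_mul (inv_ne_zero hc)]
    by_cases hp0 : p = 0
    · simp [hp0]
    · have := hp hp0; omega
  have hlt' : (v ^ 2).natDegree < f.natDegree := by
    have : (v ^ 2).natDegree ≤ 2 * v.natDegree := natDegree_pow_le
    omega
  have hlt : (v ^ 2).degree < f.degree := degree_lt_degree hlt'
  -- A root `e` of `f - v ^ 2` is the value of `x` at a zero `(e, -v e)` of the function, that is,
  -- at `P`.
  have hroot : f - v ^ 2 = (Polynomial.X - Polynomial.C a) ^ (f - v ^ 2).natDegree := by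
    refine eq_X_sub_C_pow_of_forall_root (hfm.sub_of_left hlt) fun e he => ?_
    have hb : (-(v.eval e)) ^ 2 = f.eval e := by
      rw [eval_sub, eval_pow] at he
      linear_combination -he
    obtain ⟨Q, hQ, hQ'⟩ := exists_point M hb
    have hQ0 := Place.ge_zero_of_ge_sub hQ
    have hpos : (C.place Q).Ge 1 (aeval x p + aeval x (Polynomial.C c) * y) := by
      have h3 := ((C.place Q).ge_algebraMap c).mul_left
        (((C.place Q).ge_aeval_sub hQ hQ0 v).add hQ')
      convert h3 using 1
      rw [hvp, map_mul, aeval_C, map_neg]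
      ring
    have h4 : 1 ≤ C.ord _ Q := hpos h0
    have hQP : Q = P := by
      by_contra hQP
      have hQO : Q ≠ O := by
        rintro rfl
        exact absurd (hQ0 M.x_ne_zero) (not_le.2 hO)
      rw [hhQ Q hQP hQO] at h4
      omega
    subst hQP
    have h5 := ha.sub hQ
    rw [sub_sub_sub_cancel_left, ← map_sub] at h5
    exact sub_eq_zero.1 ((C.place Q).eq_zero_of_ge h5)
  refine ⟨a, v, hvdeg, ?_, ha⟩
  rw [natDegree_sub_eq_left_of_natDegree_lt hlt', hf] at hroot
  linear_combination hroot

/-- Among more than four points there are three with different values of `x`, because at most two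
points have a given value of `x`. -/
theorem exists_ne_of_four_lt_encard {x y : C.FunctionField} {f : K[X]} (M : IsQuadraticModel x y f)
    (h2 : (2 : K) ≠ 0) {T : Set C.Point} (hT : 4 < T.encard) {s : C.Point → K}
    (hs : ∀ P ∈ T, (C.place P).Ge 1 (x - algebraMap K _ (s P))) :
    ∃ P₁ ∈ T, ∃ P₂ ∈ T, ∃ P₃ ∈ T, s P₁ ≠ s P₂ ∧ s P₁ ≠ s P₃ ∧ s P₂ ≠ s P₃ := by
  classical
  obtain ⟨F, hF, hF5⟩ := Set.exists_subset_encard_eq (Order.add_one_le_of_lt hT)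
  have hfin : F.Finite := Set.finite_of_encard_eq_coe (k := 5) (by rw [hF5]; norm_num)
  obtain ⟨F, rfl⟩ := hfin.exists_finset_coe
  rw [Set.encard_coe_eq_coe_finsetCard] at hF5
  have hcard : F.card = 5 := by
    have : (F.card : ℕ∞) = ((5 : ℕ) : ℕ∞) := by rw [hF5]; norm_num
    exact_mod_cast this
  have hle : F.card ≤ 2 * (F.image s).card := by
    refine Finset.card_le_mul_card_image F 2 fun a _ => ?_
    obtain ⟨b, hb⟩ := IsAlgClosed.exists_pow_nat_eq (f.eval a) two_pos
    have hval : ∀ P ∈ T, s P = a → ∃ b' ∈ ({b, -b} : Finset K),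
        (C.place P).Ge 1 (y - algebraMap K _ b') := by
      rintro P hP rfl
      have hx0 := Place.ge_zero_of_ge_sub (hs P hP)
      obtain ⟨b', hb'⟩ := (C.place P).exists_value (M.ge_y hx0)
      have := M.sq_eq_eval hx0 (hs P hP) hb'
      rw [← hb, sq_eq_sq_iff_eq_or_eq_neg] at this
      exact ⟨b', by simpa using this, hb'⟩
    choose! t ht ht' using hval
    refine (Finset.card_le_card_of_injOn t (t := {b, -b}) ?_ ?_).trans Finset.card_le_two
    · intro P hP
      rw [Finset.mem_coe, Finset.mem_filter] at hP
      exact ht P (hF hP.1) hP.2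
    · intro P hP Q hQ hPQ
      rw [Finset.mem_coe, Finset.mem_filter] at hP hQ
      refine point_ext_of_value M h2 (hs P (hF hP.1)) (ht' P (hF hP.1) hP.2) ?_ ?_
      · rw [hP.2, ← hQ.2]; exact hs Q (hF hQ.1)
      · rw [hPQ]; exact ht' Q (hF hQ.1) hQ.2
  obtain ⟨a₁, a₂, a₃, h1, h3, h4, h12, h13, h23⟩ := Finset.two_lt_card_iff.1
    (show 2 < (F.image s).card by omega)
  obtain ⟨P₁, hP₁, rfl⟩ := Finset.mem_image.1 h1
  obtain ⟨P₂, hP₂, rfl⟩ := Finset.mem_image.1 h3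
  obtain ⟨P₃, hP₃, rfl⟩ := Finset.mem_image.1 h4
  exact ⟨P₁, hF hP₁, P₂, hF hP₂, P₃, hF hP₃, h12, h13, h23⟩

end Curve

namespace MarkedHyperellipticCurve
variable {K : Type u} [Field K] [IsAlgClosed K] {g : ℕ}

/-- With more than four points of order `2 g + 1`, the equation of the curve has at least three
representations `f = (X - a)^(2g+1) + v²`. -/
theorem exists_three_representations (C : MarkedHyperellipticCurve K g) (hg : g ≠ 0)
    (h2 : (2 : K) ≠ 0) (hC : 4 < (C.pointsOfOrder (2 * g + 1)).encard) :
    ∃ (x y : C.FunctionField) (f : K[X]) (a : Fin 3 → K) (v : Fin 3 → K[X]),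
      IsQuadraticModel x y f ∧ f.natDegree = 2 * g + 1 ∧ C.toCurve.ord x C.pt < 0 ∧
      Function.Injective a ∧ ∀ i, (v i).natDegree ≤ g ∧
        f = (X - Polynomial.C (a i)) ^ (2 * g + 1) + v i ^ 2 := by
  obtain ⟨x, y, f, M, hfm, hf, hO⟩ := C.exists_model hg h2
  have key : ∀ P ∈ C.pointsOfOrder (2 * g + 1), ∃ (a : K) (v : K[X]), v.natDegree ≤ g ∧
      f = (X - Polynomial.C a) ^ (2 * g + 1) + v ^ 2 ∧
      (C.toCurve.place P).Ge 1 (x - algebraMap K _ a) :=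
    fun P hP => Curve.exists_eq_pow_add_sq M h2 hg hfm hf hO hP
  choose! s v hv hfv hs using key
  obtain ⟨P₁, h1, P₂, h2', P₃, h3, h12, h13, h23⟩ :=
    Curve.exists_ne_of_four_lt_encard M h2 hC hs
  refine ⟨x, y, f, ![s P₁, s P₂, s P₃], ![v P₁, v P₂, v P₃], M, hf, hO, ?_, ?_⟩
  · intro i j hij
    fin_cases i <;> fin_cases j <;> simp_all
  · intro i
    fin_cases i
    · exact ⟨hv _ h1, hfv _ h1⟩
    · exact ⟨hv _ h2', hfv _ h2'⟩
    · exact ⟨hv _ h3, hfv _ h3⟩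

end MarkedHyperellipticCurve

/-! ### Products of linear factors -/

/-- The polynomial `∏ (X - ρ m)` over the `ρ` in `S`. -/
noncomputable def linProd {K A : Type*} [Field K] [CommRing A] [Algebra K A] (S : Finset K)
    (m : A) : A[X] :=
  ∏ ρ ∈ S, (X - C (algebraMap K A ρ * m))

section linProd
variable {K A : Type*} [Field K] [CommRing A] [Algebra K A] (S : Finset K) (m : A)

theorem linProd_monic : (linProd S m).Monic := monic_prod_X_sub_C _ _

theorem natDegree_linProd [Nontrivial A] : (linProd S m).natDegree = S.card := by
  rw [linProd, natDegree_prod_of_monic _ _ fun _ _ => monic_X_sub_C _]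
  simp only [natDegree_X_sub_C, Finset.sum_const, smul_eq_mul, mul_one]

theorem coeff_card_linProd [Nontrivial A] : (linProd S m).coeff S.card = 1 := by
  have := (linProd_monic S m).coeff_natDegree
  rwa [natDegree_linProd] at this

theorem map_linProd {B : Type*} [CommRing B] [Algebra K B] (φ : A →ₐ[K] B) :
    (linProd S m).map φ.toRingHom = linProd S (φ m) := by
  rw [linProd, linProd, Polynomial.map_prod]
  refine Finset.prod_congr rfl fun ρ _ => ?_
  rw [Polynomial.map_sub, map_X, map_C]
  simp

theorem linProd_zero : linProd S (0 : A) = X ^ S.card := by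
  simp [linProd]

theorem coeff_succ_X_sub_C_mul {A : Type*} [CommRing A] (a : A) (p : A[X]) (i : ℕ) :
    ((X - C a) * p).coeff (i + 1) = p.coeff i - a * p.coeff (i + 1) := by
  rw [sub_mul, coeff_sub, coeff_X_mul, coeff_C_mul]

/-- Homogeneity of the coefficients in `m`. -/
theorem coeff_linProd (i : ℕ) :
    (linProd S m).coeff i = algebraMap K A ((linProd S (1 : K)).coeff i) * m ^ (S.card - i) := by
  classical
  induction S using Finset.induction_on generalizing i with
  | empty =>
    cases i with
    | zero => simp [linProd]
    | succ i => simp [linProd, coeff_one]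
  | insert ρ S hρ ih =>
    have hins' : linProd (insert ρ S) m = (X - C (algebraMap K A ρ * m)) * linProd S m := by
      rw [linProd, Finset.prod_insert hρ, linProd]
    have hins1 : linProd (insert ρ S) (1 : K) = (X - C ρ) * linProd S 1 := by
      rw [linProd, Finset.prod_insert hρ, linProd]
      simp
    rw [hins', hins1, Finset.card_insert_of_notMem hρ]
    cases i with
    | zero =>
      simp only [mul_coeff_zero, coeff_sub, coeff_X_zero, coeff_C_zero, zero_sub, map_mul, map_neg,
        Nat.sub_zero]
      rw [ih, Nat.sub_zero, pow_succ]
      ring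
    | succ i =>
      rw [coeff_succ_X_sub_C_mul, coeff_succ_X_sub_C_mul, map_sub, map_mul, ih, ih,
        Nat.add_sub_add_right]
      by_cases hi : i + 1 ≤ S.card
      · rw [show S.card - i = S.card - (i + 1) + 1 by omega, pow_succ]
        ring
      · rw [coeff_eq_zero_of_natDegree_lt (n := i + 1) (by rw [natDegree_linProd]; omega)]
        simp

theorem coeff_zero_linProd_ne_zero {S : Finset K} (hS : ∀ ρ ∈ S, ρ ≠ 0) :
    (linProd S (1 : K)).coeff 0 ≠ 0 := by
  rw [coeff_zero_eq_eval_zero, linProd, eval_prod, Finset.prod_ne_zero_iff]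
  intro ρ hρ
  simpa using hS ρ hρ

theorem linProd_mul_linProd_sdiff [DecidableEq K] {R I : Finset K} (h : I ⊆ R) :
    linProd I m * linProd (R \ I) m = linProd R m := by
  rw [mul_comm, linProd, linProd, linProd, Finset.prod_sdiff h]

end linProd

section linProdField
variable {K L : Type*} [Field K] [Field L] [Algebra K L]

theorem isRoot_linProd_iff {S : Finset K} {m : L} {r : L} :
    (linProd S m).eval r = 0 ↔ ∃ ρ ∈ S, r = algebraMap K L ρ * m := by
  rw [linProd, eval_prod, Finset.prod_eq_zero_iff]
  simp [sub_eq_zero]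

theorem linProd_separable {S : Finset K} {m : L} (hm : m ≠ 0) : (linProd S m).Separable := by
  refine separable_prod_X_sub_C_iff'.2 ?_
  intro ρ _ σ _ h
  exact (algebraMap K L).injective (mul_right_cancel₀ hm h)

/-- A factorization of a product of distinct linear factors is given by a partition of the
factors. -/
theorem exists_eq_linProd_of_mul_eq [DecidableEq K] {R : Finset K} {m c : L} (hm : m ≠ 0)
    (hc : c ≠ 0) {p q : L[X]} (h : p * q = C c * linProd R m) :
    ∃ I ⊆ R, ∃ a b : L, a * b = c ∧ p = C a * linProd I m ∧ q = C b * linProd (R \ I) m := by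
  classical
  set I := R.filter fun ρ => p.eval (algebraMap K L ρ * m) = 0 with hI
  have hIR : I ⊆ R := Finset.filter_subset _ _
  have hdvd : ∀ (S : Finset K) (r : L[X]), (∀ ρ ∈ S, r.eval (algebraMap K L ρ * m) = 0) →
      linProd S m ∣ r := by
    intro S r hr
    refine Finset.prod_dvd_of_coprime ?_ fun ρ hρ => dvd_iff_isRoot.2 (hr ρ hρ)
    intro ρ _ σ _ hne
    refine isCoprime_X_sub_C_of_isUnit_sub ?_
    rw [← sub_mul, ← map_sub, isUnit_iff_ne_zero]
    exact mul_ne_zero ((_root_.map_ne_zero _).2 (sub_ne_zero.2 hne)) hm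
  obtain ⟨p', hp⟩ := hdvd I p fun ρ hρ => (Finset.mem_filter.1 hρ).2
  obtain ⟨q', hq⟩ := hdvd (R \ I) q fun ρ hρ => by
    rw [Finset.mem_sdiff, hI, Finset.mem_filter, not_and] at hρ
    have := congrArg (eval (algebraMap K L ρ * m)) h
    rw [eval_mul, eval_mul, isRoot_linProd_iff.2 ⟨ρ, hρ.1, rfl⟩, mul_zero, mul_eq_zero] at this
    exact this.resolve_left (hρ.2 hρ.1)
  have hpq : p' * q' = C c := by
    apply mul_left_cancel₀ (linProd_monic R m).ne_zero
    rw [mul_comm _ (C c), ← h, hp, hq, ← linProd_mul_linProd_sdiff m hIR]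
    ring
  have hu : IsUnit (p' * q') := by rw [hpq]; exact isUnit_C.2 (isUnit_iff_ne_zero.2 hc)
  obtain ⟨a, -, rfl⟩ := Polynomial.isUnit_iff.1 (isUnit_of_mul_isUnit_left hu)
  obtain ⟨b, -, rfl⟩ := Polynomial.isUnit_iff.1 (isUnit_of_mul_isUnit_right hu)
  refine ⟨I, hIR, a, b, ?_, by rw [hp]; ring, by rw [hq]; ring⟩
  rw [← C_mul] at hpq
  exact C_injective hpq

end linProdField

/-! ### Differences of powers -/

/-- The polynomial `(X + 1/n)^n - X^n`, `n = 2 g + 1`. -/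
noncomputable def powDifference (K : Type*) [Field K] (g : ℕ) : K[X] :=
  (X + C ((2 * g + 1 : ℕ) : K)⁻¹) ^ (2 * g + 1) - X ^ (2 * g + 1)

open scoped Classical in
/-- The roots of `(X + 1/n)^n - X^n`, `n = 2 g + 1`, that is, the `1 / (n (ζ - 1))` for the
nontrivial `n`-th roots of unity `ζ`. -/
noncomputable def powDifferenceRoots (K : Type*) [Field K] (g : ℕ) : Finset K :=
  (powDifference K g).roots.toFinset

section powDifference
variable {K : Type*} [Field K] {g : ℕ}

theorem coeff_powDifference (i : ℕ) (hi : i ≤ 2 * g) : (powDifference K g).coeff i =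
    (((2 * g + 1 : ℕ) : K)⁻¹) ^ (2 * g + 1 - i) * ((2 * g + 1).choose i : K) := by
  rw [powDifference, coeff_sub, coeff_X_add_C_pow, coeff_X_pow, if_neg (by omega), sub_zero]

theorem natDegree_powDifference_le : (powDifference K g).natDegree ≤ 2 * g := by
  rw [natDegree_le_iff_coeff_eq_zero]
  intro i hi
  rw [powDifference, coeff_sub, coeff_X_add_C_pow, coeff_X_pow]
  split_ifs with h
  · simp [h]
  · rw [Nat.choose_eq_zero_of_lt (by omega)]
    simp

theorem powDifference_monic (hn : ((2 * g + 1 : ℕ) : K) ≠ 0) : (powDifference K g).Monic := by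
  refine monic_of_natDegree_le_of_coeff_eq_one (2 * g) natDegree_powDifference_le ?_
  rw [coeff_powDifference _ le_rfl, show 2 * g + 1 - 2 * g = 1 by omega, pow_one,
    show (2 * g + 1).choose (2 * g) = 2 * g + 1 from Nat.choose_succ_self_right (2 * g)]
  exact inv_mul_cancel₀ hn

theorem natDegree_powDifference (hn : ((2 * g + 1 : ℕ) : K) ≠ 0) :
    (powDifference K g).natDegree = 2 * g := by
  refine le_antisymm natDegree_powDifference_le (le_natDegree_of_ne_zero ?_)
  rw [coeff_powDifference _ le_rfl, show 2 * g + 1 - 2 * g = 1 by omega, pow_one,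
    show (2 * g + 1).choose (2 * g) = 2 * g + 1 from Nat.choose_succ_self_right (2 * g),
    inv_mul_cancel₀ hn]
  exact one_ne_zero

theorem mem_powDifferenceRoots (hn : ((2 * g + 1 : ℕ) : K) ≠ 0) {ρ : K} :
    ρ ∈ powDifferenceRoots K g ↔
      (ρ + ((2 * g + 1 : ℕ) : K)⁻¹) ^ (2 * g + 1) = ρ ^ (2 * g + 1) := by
  classical
  rw [powDifferenceRoots, Multiset.mem_toFinset, mem_roots (powDifference_monic hn).ne_zero,
    IsRoot, powDifference]
  simp [sub_eq_zero]

theorem ne_zero_of_mem_powDifferenceRoots (hn : ((2 * g + 1 : ℕ) : K) ≠ 0) {ρ : K}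
    (h : ρ ∈ powDifferenceRoots K g) : ρ ≠ 0 := by
  rintro rfl
  rw [mem_powDifferenceRoots hn, zero_add, zero_pow (by omega)] at h
  exact pow_ne_zero _ (inv_ne_zero hn) h

theorem nodup_roots_powDifference (hn : ((2 * g + 1 : ℕ) : K) ≠ 0) :
    (powDifference K g).roots.Nodup := by
  classical
  rw [Multiset.nodup_iff_count_le_one]
  intro ρ
  by_contra! hlt
  rw [count_roots] at hlt
  have h1 := (one_lt_rootMultiplicity_iff_isRoot (powDifference_monic hn).ne_zero).1 hlt
  obtain ⟨h1, h3⟩ := h1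
  have h4 : ρ ∈ powDifferenceRoots K g := by
    rw [powDifferenceRoots, Multiset.mem_toFinset]
    exact (mem_roots (powDifference_monic hn).ne_zero).2 h1
  have h0 := ne_zero_of_mem_powDifferenceRoots hn h4
  rw [mem_powDifferenceRoots hn] at h4
  rw [IsRoot, powDifference] at h3
  simp only [derivative_sub, derivative_X_pow, derivative_X_add_C_pow, eval_sub, eval_mul, eval_pow,
    eval_add, eval_X, eval_C, Nat.add_sub_cancel, eval_natCast, map_natCast] at h3
  have h5 : (ρ + ((2 * g + 1 : ℕ) : K)⁻¹) ^ (2 * g) = ρ ^ (2 * g) :=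
    mul_left_cancel₀ hn (by linear_combination h3)
  rw [pow_succ, pow_succ, h5] at h4
  have h6 := mul_left_cancel₀ (pow_ne_zero _ h0) h4
  exact inv_ne_zero hn (by linear_combination h6)

variable [IsAlgClosed K]

theorem card_powDifferenceRoots (hn : ((2 * g + 1 : ℕ) : K) ≠ 0) :
    (powDifferenceRoots K g).card = 2 * g := by
  classical
  have h := (IsAlgClosed.splits (powDifference K g)).natDegree_eq_card_roots
  rw [natDegree_powDifference hn] at h
  rw [powDifferenceRoots, Multiset.toFinset_card_of_nodup (nodup_roots_powDifference hn), h]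

theorem linProd_powDifferenceRoots (hn : ((2 * g + 1 : ℕ) : K) ≠ 0) :
    linProd (powDifferenceRoots K g) (1 : K) = powDifference K g := by
  classical
  have h1 := (IsAlgClosed.splits (powDifference K g)).eq_prod_roots_of_monic
    (powDifference_monic hn)
  conv_rhs => rw [h1, ← Multiset.dedup_eq_self.2 (nodup_roots_powDifference hn)]
  rw [linProd, powDifferenceRoots, Finset.prod, Multiset.toFinset_val]
  simp

/-- The homogeneous form of the factorization of `(X + 1/n)^n - X^n`. -/
theorem C_mul_linProd_powDifferenceRoots (hn : ((2 * g + 1 : ℕ) : K) ≠ 0) {A : Type*} [CommRing A]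
    [Algebra K A] (m : A) :
    C m * linProd (powDifferenceRoots K g) m =
      (X + C (m * algebraMap K A ((2 * g + 1 : ℕ) : K)⁻¹)) ^ (2 * g + 1) - X ^ (2 * g + 1) := by
  ext i
  rw [coeff_C_mul, coeff_linProd, linProd_powDifferenceRoots hn, card_powDifferenceRoots hn,
    coeff_sub, coeff_X_add_C_pow, coeff_X_pow]
  by_cases hi : i ≤ 2 * g
  · rw [coeff_powDifference i hi, if_neg (by omega), sub_zero, map_mul, map_pow, map_natCast,
      mul_pow, show 2 * g + 1 - i = 2 * g - i + 1 by omega, pow_succ m]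
    ring
  · rw [coeff_eq_zero_of_natDegree_lt (by rw [natDegree_powDifference hn]; omega), map_zero]
    split_ifs with h
    · simp [h]
    · rw [Nat.choose_eq_zero_of_lt (by omega)]
      simp

end powDifference

/-! ### Roots of unity -/

/-- The arithmetic conditions on `K` and `g` used in the proof. The last one says that a certain
relation between roots of unity of order dividing `2 g + 1` is preserved under inversion. -/
structure IsAdmissible (K : Type*) [Field K] (g : ℕ) : Prop where
  two_ne_zero : (2 : K) ≠ 0
  natCast_ne_zero : ((2 * g + 1 : ℕ) : K) ≠ 0
  inv_eq_inv : ∀ ζ : Fin 4 → K, (∀ i, ζ i ^ (2 * g + 1) = 1) →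
    (1 - ζ 0) * (1 - ζ 1) = (1 - ζ 2) * (1 - ζ 3) →
      (1 - (ζ 0)⁻¹) * (1 - (ζ 1)⁻¹) = (1 - (ζ 2)⁻¹) * (1 - (ζ 3)⁻¹)

/-- In characteristic zero, the relation holds for all conjugates of a primitive root of unity `ω`,
among them `ω⁻¹`. -/
theorem isAdmissible_of_charZero {K : Type*} [Field K] [IsAlgClosed K] [CharZero K] (g : ℕ) :
    IsAdmissible K g := by
  refine ⟨two_ne_zero, Nat.cast_ne_zero.2 (by omega), fun ζ hζ h => ?_⟩
  have : NeZero ((2 * g + 1 : ℕ) : K) := ⟨Nat.cast_ne_zero.2 (by omega)⟩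
  obtain ⟨ω, hω⟩ := HasEnoughRootsOfUnity.exists_primitiveRoot K (2 * g + 1)
  have hpow : ∀ i, ∃ k : ℕ, ω ^ k = ζ i := fun i => by
    obtain ⟨k, -, hk⟩ := hω.eq_pow_of_pow_eq_one (hζ i)
    exact ⟨k, hk⟩
  choose k hk using hpow
  let P : ℤ[X] := (1 - X ^ k 0) * (1 - X ^ k 1) - (1 - X ^ k 2) * (1 - X ^ k 3)
  have hP : aeval ω P = 0 := by
    simp only [P, map_sub, map_mul, map_one, map_pow, aeval_X, hk]
    exact sub_eq_zero.2 h
  have hdvd : cyclotomic (2 * g + 1) ℤ ∣ P := by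
    rw [cyclotomic_eq_minpoly hω (by omega)]
    exact minpoly.isIntegrallyClosed_dvd (hω.isIntegral (by omega)) hP
  have hinv : aeval ω⁻¹ (cyclotomic (2 * g + 1) ℤ) = 0 := by
    rw [aeval_def, eval₂_eq_eval_map, map_cyclotomic]
    exact hω.inv.isRoot_cyclotomic (by omega)
  have hP' := aeval_eq_zero_of_dvd_aeval_eq_zero hdvd hinv
  simp only [P, map_sub, map_mul, map_one, map_pow, aeval_X, inv_pow, hk] at hP'
  exact sub_eq_zero.1 hP'

/-- Since `p ^ g = -1` modulo `2 g + 1`, the `g`-th iterate of the Frobenius endomorphism inverts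
the roots of unity. -/
theorem isAdmissible_of_isPrimitiveRoot {K : Type*} [Field K] {g p : ℕ} (hg : g ≠ 0)
    (hq : (2 * g + 1).Prime) (hp : p.Prime) (hodd : Odd p) [CharP K p]
    (h : IsPrimitiveRoot (p : ZMod (2 * g + 1)) (2 * g)) : IsAdmissible K g := by
  have : Fact p.Prime := ⟨hp⟩
  have : Fact (2 * g + 1).Prime := ⟨hq⟩
  refine ⟨?_, ?_, fun ζ hζ h' => ?_⟩
  · intro h2
    have h3 : ((2 : ℕ) : K) = 0 := by exact_mod_cast h2
    rw [CharP.cast_eq_zero_iff K p, Nat.prime_dvd_prime_iff_eq hp Nat.prime_two] at h3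
    subst h3
    exact absurd hodd (by decide)
  · intro hn
    rw [CharP.cast_eq_zero_iff K p, Nat.prime_dvd_prime_iff_eq hp hq] at hn
    have h3 := h.pow_eq_one
    rw [hn, ZMod.natCast_self, zero_pow (by omega)] at h3
    exact zero_ne_one h3
  · have hpg : (p : ZMod (2 * g + 1)) ^ g = -1 := by
      have h3 : ((p : ZMod (2 * g + 1)) ^ g) ^ 2 = 1 := by
        rw [← pow_mul, mul_two, ← two_mul, h.pow_eq_one]
      rcases eq_or_eq_neg_of_sq_eq_sq _ 1 (h3.trans (one_pow 2).symm) with h4 | h4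
      · have := h.dvd_of_pow_eq_one g h4
        have := Nat.le_of_dvd (by omega) this
        omega
      · exact h4
    have hdvd : 2 * g + 1 ∣ p ^ g + 1 := by
      rw [← ZMod.natCast_eq_zero_iff]
      push_cast
      rw [hpg]
      ring
    have hfrob : ∀ i, iterateFrobenius K p g (ζ i) = (ζ i)⁻¹ := by
      intro i
      obtain ⟨c, hc⟩ := hdvd
      rw [iterateFrobenius_def]
      apply eq_inv_of_mul_eq_one_left
      rw [← pow_succ, hc, pow_mul, hζ, one_pow]
    have := congrArg (iterateFrobenius K p g) h'
    simpa only [map_mul, map_sub, map_one, hfrob] using this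

theorem isAdmissible_of_isAlgClosed {K : Type u} [Field K] [IsAlgClosed K] {g : ℕ} (hg : g ≠ 0)
    (hK : CharZero K ∨ ((2 * g + 1).Prime ∧ ∃ p : ℕ, p.Prime ∧ Odd p ∧ CharP K p ∧
      IsPrimitiveRoot (p : ZMod (2 * g + 1)) (2 * g))) : IsAdmissible K g := by
  rcases hK with hK | ⟨hq, p, hp, hodd, hchar, h⟩
  · exact isAdmissible_of_charZero g
  · exact isAdmissible_of_isPrimitiveRoot hg hq hp hodd h

/-- Two pairs of roots of `(X + 1/n)^n - X^n` with the same ratio are equal. In terms of roots of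
unity, `(1 - a) (1 - d) = (1 - b) (1 - c)` and the same relation between the inverses give
`a d = b c`, whence `(a - b) (a - c) = 0`. -/
theorem IsAdmissible.eq_of_mul_eq_mul {K : Type*} [Field K] {g : ℕ} (hK : IsAdmissible K g)
    {ρ₁ ρ₂ σ₁ σ₂ : K} (hρ₁ : ρ₁ ∈ powDifferenceRoots K g) (hρ₂ : ρ₂ ∈ powDifferenceRoots K g)
    (hσ₁ : σ₁ ∈ powDifferenceRoots K g) (hσ₂ : σ₂ ∈ powDifferenceRoots K g) (hne : ρ₁ ≠ ρ₂)
    (h : ρ₁ * σ₂ = ρ₂ * σ₁) : ρ₁ = σ₁ := by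
  set n := ((2 * g + 1 : ℕ) : K) with hn
  have hn0 : n ≠ 0 := hK.natCast_ne_zero
  -- The root `ρ` corresponds to the root of unity `1 + 1 / (n ρ)`.
  have key : ∀ ρ ∈ powDifferenceRoots K g, ∃ ζ : K, ζ ^ (2 * g + 1) = 1 ∧ ζ ≠ 0 ∧
      n * ρ * (ζ - 1) = 1 := by
    intro ρ hρ
    have h0 := ne_zero_of_mem_powDifferenceRoots hn0 hρ
    rw [mem_powDifferenceRoots hn0] at hρ
    have h1 : ((ρ + n⁻¹) / ρ) ^ (2 * g + 1) = 1 := by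
      rw [div_pow, hρ, div_self (pow_ne_zero _ h0)]
    refine ⟨(ρ + n⁻¹) / ρ, h1, ?_, ?_⟩
    · intro h3
      rw [h3, zero_pow (by omega)] at h1
      exact zero_ne_one h1
    · field_simp
      ring
  obtain ⟨a, ha, ha0, hρa⟩ := key ρ₁ hρ₁
  obtain ⟨b, hb, hb0, hρb⟩ := key ρ₂ hρ₂
  obtain ⟨c, hc, hc0, hσc⟩ := key σ₁ hσ₁
  obtain ⟨d, hd, hd0, hσd⟩ := key σ₂ hσ₂
  have hρ₁0 := ne_zero_of_mem_powDifferenceRoots hn0 hρ₁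
  have hρ₂0 := ne_zero_of_mem_powDifferenceRoots hn0 hρ₂
  have hσ₁0 := ne_zero_of_mem_powDifferenceRoots hn0 hσ₁
  have hσ₂0 := ne_zero_of_mem_powDifferenceRoots hn0 hσ₂
  have ea : a - 1 = 1 / (n * ρ₁) := by field_simp; linear_combination hρa
  have eb : b - 1 = 1 / (n * ρ₂) := by field_simp; linear_combination hρb
  have ec : c - 1 = 1 / (n * σ₁) := by field_simp; linear_combination hσc
  have ed : d - 1 = 1 / (n * σ₂) := by field_simp; linear_combination hσd
  have h1 : (1 - a) * (1 - d) = (1 - b) * (1 - c) := by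
    have : (a - 1) * (d - 1) = (b - 1) * (c - 1) := by
      rw [ea, eb, ec, ed, div_mul_div_comm, div_mul_div_comm]
      congr 1
      linear_combination n ^ 2 * h
    linear_combination this
  have h2 := hK.inv_eq_inv ![a, d, b, c] (by intro i; fin_cases i <;> assumption) h1
  simp only [Matrix.cons_val] at h2
  have hne1 : (1 - a) * (1 - d) ≠ 0 := by
    have : (a - 1) * (d - 1) ≠ 0 := by
      rw [ea, ed]
      exact mul_ne_zero (one_div_ne_zero (mul_ne_zero hn0 hρ₁0))
        (one_div_ne_zero (mul_ne_zero hn0 hσ₂0))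
    intro h3
    exact this (by linear_combination h3)
  have h3 : a * d = b * c := by
    have h4 : (1 - a) * (1 - d) * (b * c) = (1 - a) * (1 - d) * (a * d) := by
      have h5 : (a - 1) * (d - 1) * (b * c) = (b - 1) * (c - 1) * (a * d) := by
        field_simp at h2
        linear_combination h2
      linear_combination h5 - a * d * h1
    exact (mul_left_cancel₀ hne1 h4).symm
  have h4 : (a - b) * (a - c) = 0 := by linear_combination (a - 1) * h3 - a * h1
  have hab : a ≠ b := by
    rintro rfl
    apply hne
    rw [ea] at eb
    field_simp at eb
    exact eb.symm
  have hac : a = c := by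
    rcases mul_eq_zero.1 h4 with h5 | h5
    · exact absurd (sub_eq_zero.1 h5) hab
    · exact sub_eq_zero.1 h5
  subst hac
  rw [ea] at ec
  field_simp at ec
  exact ec.symm

/-! ### Representations `f = (X - a)^n + v²` -/

open scoped Classical in
/-- The complement of a set of roots of `(X + 1/n)^n - X^n`. -/
noncomputable def complRoots {K : Type*} [Field K] (g : ℕ) (I : Finset K) : Finset K :=
  powDifferenceRoots K g \ I

/-- The polynomial `2 v`, where `v - w` and `v + w` are the two factors of the difference
`(X + μ μ' / n)^n - X^n`, `n = 2 g + 1`, that have leading coefficients `μ'` and `μ` and roots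
indexed by the complement of `I` and by `I`. -/
noncomputable def splitSum {K A : Type*} [Field K] [CommRing A] [Algebra K A] (g : ℕ)
    (I : Finset K) (μ μ' : A) : A[X] :=
  C μ * linProd I (μ * μ') + C μ' * linProd (complRoots g I) (μ * μ')

/-- The subsets of size `g` of the set of `2 g` roots of `(X + 1/n)^n - X^n`. -/
noncomputable def halves (K : Type*) [Field K] (g : ℕ) : Finset (Finset K) :=
  (powDifferenceRoots K g).powersetCard g

section
variable {K : Type*} [Field K] {g : ℕ} {I : Finset K}

theorem complRoots_complRoots (hI : I ∈ halves K g) : complRoots g (complRoots g I) = I := by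
  classical
  rw [halves, Finset.mem_powersetCard] at hI
  simp only [complRoots]
  exact Finset.sdiff_sdiff_eq_self hI.1

theorem card_of_mem_halves (hI : I ∈ halves K g) : I.card = g := (Finset.mem_powersetCard.1 hI).2

theorem mem_roots_of_mem_halves (hI : I ∈ halves K g) {ρ : K} (hρ : ρ ∈ I) :
    ρ ∈ powDifferenceRoots K g := (Finset.mem_powersetCard.1 hI).1 hρ

theorem linProd_mul_linProd_complRoots {A : Type*} [CommRing A] [Algebra K A] (hI : I ∈ halves K g)
    (m : A) : linProd I m * linProd (complRoots g I) m = linProd (powDifferenceRoots K g) m := by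
  classical
  rw [← linProd_mul_linProd_sdiff m (Finset.mem_powersetCard.1 hI).1, complRoots]

theorem splitSum_complRoots {A : Type*} [CommRing A] [Algebra K A] (hI : I ∈ halves K g)
    (μ μ' : A) : splitSum g (complRoots g I) μ' μ = splitSum g I μ μ' := by
  rw [splitSum, splitSum, complRoots_complRoots hI, mul_comm μ' μ, add_comm]

theorem map_splitSum {A B : Type*} [CommRing A] [Algebra K A] [CommRing B] [Algebra K B]
    (φ : A →ₐ[K] B) (μ μ' : A) :
    (splitSum g I μ μ').map φ.toRingHom = splitSum g I (φ μ) (φ μ') := by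
  rw [splitSum, splitSum, Polynomial.map_add, Polynomial.map_mul, Polynomial.map_mul, map_linProd,
    map_linProd, map_C, map_C]
  simp

theorem linProd_comp {A : Type*} [CommRing A] [Algebra K A] (S : Finset K) (c m : A) :
    (linProd S (c * m)).comp (C c * X) = C (c ^ S.card) * linProd S m := by
  rw [linProd, linProd, Polynomial.prod_comp, C_pow, ← Finset.prod_const, ← Finset.prod_mul_distrib]
  refine Finset.prod_congr rfl fun ρ _ => ?_
  rw [sub_comp, X_comp, C_comp, C_mul, C_mul, C_mul]
  ring

variable [IsAlgClosed K]

theorem complRoots_mem_halves (hK : IsAdmissible K g) (hI : I ∈ halves K g) :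
    complRoots g I ∈ halves K g := by
  classical
  rw [halves, Finset.mem_powersetCard] at hI ⊢
  refine ⟨Finset.sdiff_subset, ?_⟩
  rw [complRoots, Finset.card_sdiff_of_subset hI.1,
    card_powDifferenceRoots hK.natCast_ne_zero, hI.2]
  omega

/-- The shape of the coefficients: for `i < g` they are divisible by `μ μ'`. -/
theorem coeff_splitSum {A : Type*} [CommRing A] [Algebra K A] (hK : IsAdmissible K g)
    (hI : I ∈ halves K g) (μ μ' : A) (i : ℕ) :
    (splitSum g I μ μ').coeff i = (μ * μ') ^ (g - i) *
      (μ * algebraMap K A ((linProd I (1 : K)).coeff i) +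
        μ' * algebraMap K A ((linProd (complRoots g I) (1 : K)).coeff i)) := by
  rw [splitSum, coeff_add, coeff_C_mul, coeff_C_mul, coeff_linProd, coeff_linProd _ (μ * μ'),
    card_of_mem_halves hI, card_of_mem_halves (complRoots_mem_halves hK hI)]
  ring

/-- The defining property of `splitSum`. -/
theorem splitSum_sq {A : Type*} [CommRing A] [Algebra K A] (hK : IsAdmissible K g)
    (hI : I ∈ halves K g) (μ μ' : A) : splitSum g I μ μ' ^ 2 -
      (C μ * linProd I (μ * μ') - C μ' * linProd (complRoots g I) (μ * μ')) ^ 2 =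
      4 * ((X + C (μ * μ' * algebraMap K A ((2 * g + 1 : ℕ) : K)⁻¹)) ^ (2 * g + 1) -
        X ^ (2 * g + 1)) := by
  rw [← C_mul_linProd_powDifferenceRoots hK.natCast_ne_zero, ← linProd_mul_linProd_complRoots hI,
    splitSum, C_mul]
  ring

/-- Homogeneity of `splitSum`. -/
theorem splitSum_comp {A : Type*} [CommRing A] [Algebra K A] (hK : IsAdmissible K g)
    (hI : I ∈ halves K g) (c μ μ' : A) :
    (splitSum g I (c * μ) (c * μ')).comp (C (c ^ 2) * X) =
      C (c ^ (2 * g + 1)) * splitSum g I μ μ' := by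
  rw [splitSum, splitSum, show c * μ * (c * μ') = c ^ 2 * (μ * μ') by ring, add_comp, mul_comp,
    mul_comp, C_comp, C_comp, linProd_comp, linProd_comp, card_of_mem_halves hI,
    card_of_mem_halves (complRoots_mem_halves hK hI), ← pow_mul, pow_succ]
  simp only [C_mul]
  ring

theorem splitSum_eq_splitSum_of_mul {L : Type*} [Field L] [Algebra K L] (hK : IsAdmissible K g)
    {J : Finset K} (hI : I ∈ halves K g) (hJ : J ∈ halves K g) {c μ μ' ν ν' : L} (hc : c ≠ 0)
    (h : splitSum g I (c * μ) (c * μ') = splitSum g J (c * ν) (c * ν')) :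
    splitSum g I μ μ' = splitSum g J ν ν' := by
  have h1 := congrArg (fun p => p.comp (C (c ^ 2) * X)) h
  simp only [splitSum_comp hK hI, splitSum_comp hK hJ] at h1
  exact mul_left_cancel₀ (C_ne_zero.2 (pow_ne_zero _ hc)) h1

/-- Two representations `X^n + v² = (X - a)^n + w²` come from a factorization of
`(X - a)^n - X^n = (v - w)(v + w)`. -/
theorem exists_splitSum (hK : IsAdmissible K g) {a : K} (ha : a ≠ 0) {v w : K[X]}
    (hv : v.natDegree ≤ g) (hw : w.natDegree ≤ g)
    (h : X ^ (2 * g + 1) + v ^ 2 = (X - C a) ^ (2 * g + 1) + w ^ 2) :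
    ∃ I ∈ halves K g, ∃ μ μ' : K, μ ≠ 0 ∧ μ' ≠ 0 ∧ μ * μ' = -((2 * g + 1 : ℕ) : K) * a ∧
      C 2 * v = splitSum g I μ μ' := by
  classical
  have hn := hK.natCast_ne_zero
  set M := -((2 * g + 1 : ℕ) : K) * a with hM
  have hM0 : M ≠ 0 := mul_ne_zero (neg_ne_zero.2 hn) ha
  have h1 := C_mul_linProd_powDifferenceRoots hn M
  have h3 : M * algebraMap K K ((2 * g + 1 : ℕ) : K)⁻¹ = -a := by
    rw [hM, Algebra.algebraMap_self, RingHom.id_apply]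
    field_simp
  rw [h3, C_neg, ← sub_eq_add_neg] at h1
  have h4 : (v + w) * (v - w) = C M * linProd (powDifferenceRoots K g) M := by
    rw [h1]
    linear_combination h
  obtain ⟨I, hIR, μ, μ', hμ, hp, hq⟩ := exists_eq_linProd_of_mul_eq hM0 hM0 h4
  have hμ0 : μ ≠ 0 := by rintro rfl; exact hM0 (by rw [← hμ, zero_mul])
  have hμ'0 : μ' ≠ 0 := by rintro rfl; exact hM0 (by rw [← hμ, mul_zero])
  have hdp := congrArg natDegree hp
  have hdq := congrArg natDegree hq
  rw [natDegree_C_mul hμ0, natDegree_linProd] at hdp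
  rw [natDegree_C_mul hμ'0, natDegree_linProd, Finset.card_sdiff_of_subset hIR,
    card_powDifferenceRoots hn] at hdq
  have h5 : (v + w).natDegree ≤ g := (natDegree_add_le _ _).trans (max_le hv hw)
  have h6 : (v - w).natDegree ≤ g := (natDegree_sub_le _ _).trans (max_le hv hw)
  refine ⟨I, Finset.mem_powersetCard.2 ⟨hIR, by omega⟩, μ, μ', hμ0, hμ'0, hμ, ?_⟩
  rw [splitSum, complRoots, hμ, ← hp, ← hq, C_ofNat]
  ring

/-- The equations of the curves with three representations, after normalization of the
coordinates. -/
noncomputable def normalForm (g : ℕ) (I : Finset K) (s : K) : K[X] :=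
  X ^ (2 * g + 1) + (C 2⁻¹ * splitSum g I 1 s) ^ 2

/-- The relation between the parameters `(I, 1, s)` and `(J, ν, ν')` of the two factorizations that
come from three distinct representations. The products `s` and `ν ν'` are proportional to the
differences `a₁ - a₀` and `a₂ - a₀`, and `1 + s` to the leading coefficient of `v₀`. -/
structure IsSolution (g : ℕ) (I J : Finset K) (s ν ν' : K) : Prop where
  s_ne_zero : s ≠ 0
  ν_ne_zero : ν ≠ 0
  ν'_ne_zero : ν' ≠ 0
  ne_mul : s ≠ ν * ν'
  one_add_ne_zero : 1 + s ≠ 0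
  eq : splitSum g I 1 s = splitSum g J ν ν'

/-- The translation `x ↦ x - a₀` followed by the scaling that makes the parameter `μ`
equal to `1`. -/
theorem exists_isSolution_of_coeff_ne_zero (hK : IsAdmissible K g) {a : Fin 3 → K}
    {v : Fin 3 → K[X]}
    {f : K[X]} (ha : Function.Injective a) (hv : ∀ i, (v i).natDegree ≤ g)
    (hf : ∀ i, f = (X - C (a i)) ^ (2 * g + 1) + v i ^ 2) (h0 : (v 0).coeff g ≠ 0) :
    ∃ I ∈ halves K g, ∃ J ∈ halves K g, ∃ s ν ν' α γ : K, α ≠ 0 ∧ γ ≠ 0 ∧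
      IsSolution g I J s ν ν' ∧
      C (γ⁻¹ ^ 2) * f.comp (C α * X + C (a 0)) = normalForm g I s := by
  have h2 := hK.two_ne_zero
  set w : Fin 3 → K[X] := fun i => (v i).comp (X + C (a 0)) with hw
  have hwdeg : ∀ i, (w i).natDegree ≤ g := fun i => by
    rw [hw, natDegree_comp, natDegree_X_add_C, mul_one]
    exact hv i
  have hrep : ∀ i, X ^ (2 * g + 1) + w 0 ^ 2 = (X - C (a i - a 0)) ^ (2 * g + 1) + w i ^ 2 := by
    intro i
    have h := congrArg (fun p => p.comp (X + C (a 0))) ((hf 0).symm.trans (hf i))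
    simp only [add_comp, pow_comp, sub_comp, X_comp, C_comp, add_sub_cancel_right] at h
    rw [C_sub]
    convert h using 3
    ring
  have hne : ∀ i, i ≠ 0 → a i - a 0 ≠ 0 := fun i hi => sub_ne_zero.2 fun h => hi (ha h)
  obtain ⟨I, hI, μ, μ', hμ, hμ', hM, hIv⟩ :=
    exists_splitSum hK (hne 1 (by decide)) (hwdeg 0) (hwdeg 1) (hrep 1)
  obtain ⟨J, hJ, ν, ν', hν, hν', hN, hJv⟩ :=
    exists_splitSum hK (hne 2 (by decide)) (hwdeg 0) (hwdeg 2) (hrep 2)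
  have hcoeff : (w 0).coeff g = (v 0).coeff g := by
    have h := coeff_comp_degree_mul_degree (p := v 0) (q := X + C (a 0)) (by simp)
    rw [natDegree_X_add_C, mul_one, (monic_X_add_C _).leadingCoeff, one_pow, mul_one] at h
    have hdeg : (v 0).natDegree = g := le_antisymm (hv 0) (le_natDegree_of_ne_zero h0)
    rwa [leadingCoeff, hdeg] at h
  refine ⟨I, hI, J, hJ, μ' / μ, ν / μ, ν' / μ, μ ^ 2, μ ^ (2 * g + 1), pow_ne_zero _ hμ,
    pow_ne_zero _ hμ, ⟨div_ne_zero hμ' hμ, div_ne_zero hν hμ, div_ne_zero hν' hμ, ?_, ?_, ?_⟩, ?_⟩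
  · intro h
    have h3 : μ * μ' = ν * ν' := by
      field_simp at h
      linear_combination h
    rw [hM, hN] at h3
    have h4 := mul_left_cancel₀ (neg_ne_zero.2 hK.natCast_ne_zero) h3
    have : (1 : Fin 3) = 2 := ha (by linear_combination h4)
    exact absurd this (by decide)
  · intro h
    apply h0
    have h3 := congrArg (fun p => p.coeff g) hIv
    simp only [coeff_C_mul, coeff_splitSum hK hI, Nat.sub_self, pow_zero, one_mul] at h3
    have e1 := coeff_card_linProd I (1 : K)
    have e2 := coeff_card_linProd (complRoots g I) (1 : K)
    rw [card_of_mem_halves hI] at e1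
    rw [card_of_mem_halves (complRoots_mem_halves hK hI)] at e2
    rw [e1, e2, map_one, hcoeff] at h3
    have h4 : 2 * (v 0).coeff g = 0 := by
      rw [h3]
      field_simp at h
      linear_combination h
    exact (mul_eq_zero.1 h4).resolve_left h2
  · apply splitSum_eq_splitSum_of_mul hK hI hJ hμ
    rw [mul_one, mul_div_cancel₀ _ hμ, mul_div_cancel₀ _ hμ, mul_div_cancel₀ _ hμ, ← hIv, hJv]
  · have h3 := splitSum_comp hK hI μ 1 (μ' / μ)
    rw [mul_one, mul_div_cancel₀ _ hμ, ← hIv, mul_comp, C_comp] at h3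
    have h4 : (v 0).comp (C (μ ^ 2) * X + C (a 0)) = (w 0).comp (C (μ ^ 2) * X) := by
      rw [hw, comp_assoc]
      simp
    have h5 : C 2 * C 2⁻¹ = (1 : K[X]) := by rw [← C_mul, mul_inv_cancel₀ h2, C_1]
    have h6 : (w 0).comp (C (μ ^ 2) * X) =
        C (μ ^ (2 * g + 1)) * (C 2⁻¹ * splitSum g I 1 (μ' / μ)) := by
      linear_combination C 2⁻¹ * h3 - (w 0).comp (C (μ ^ 2) * X) * h5
    have h7 : C ((μ ^ (2 * g + 1))⁻¹ ^ 2) * C (μ ^ (2 * g + 1)) ^ 2 = (1 : K[X]) := by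
      rw [← C_pow, ← C_mul, ← mul_pow, inv_mul_cancel₀ (pow_ne_zero _ hμ), one_pow, C_1]
    rw [hf 0, add_comp, pow_comp, pow_comp, sub_comp, X_comp, C_comp, add_sub_cancel_right, h4, h6,
      normalForm, mul_pow (C (μ ^ 2)), ← C_pow, ← pow_mul, mul_comm 2 (2 * g + 1), pow_mul, C_pow]
    simp only [C_pow] at h7 ⊢
    linear_combination (X ^ (2 * g + 1) + (C 2⁻¹ * splitSum g I 1 (μ' / μ)) ^ 2) * h7

/-- Of three distinct representations, at most one has a `v` of degree less than `g`, because for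
such a representation the coefficient of `X ^ (2 g)` in `f` is `-n a`. Another one is taken as the
first. -/
theorem exists_isSolution (hK : IsAdmissible K g) {a : Fin 3 → K} {v : Fin 3 → K[X]}
    {f : K[X]} (ha : Function.Injective a) (hv : ∀ i, (v i).natDegree ≤ g)
    (hf : ∀ i, f = (X - C (a i)) ^ (2 * g + 1) + v i ^ 2) :
    ∃ I ∈ halves K g, ∃ J ∈ halves K g, ∃ s ν ν' α β γ : K, α ≠ 0 ∧ γ ≠ 0 ∧
      IsSolution g I J s ν ν' ∧
      C (γ⁻¹ ^ 2) * f.comp (C α * X + C β) = normalForm g I s := by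
  have hcoeff : ∀ i, f.coeff (2 * g) = -((2 * g + 1 : ℕ) : K) * a i + (v i).coeff g ^ 2 := by
    intro i
    rw [hf i, coeff_add, sub_eq_add_neg, ← C_neg, coeff_X_add_C_pow,
      coeff_pow_of_natDegree_le (hv i),
      Nat.choose_succ_self_right, show 2 * g + 1 - 2 * g = 1 by omega, pow_one]
    ring
  by_cases h0 : (v 0).coeff g = 0
  · have h1 : (v 1).coeff g ≠ 0 := by
      intro h1
      have h3 := (hcoeff 0).symm.trans (hcoeff 1)
      rw [h0, h1, add_left_inj] at h3
      exact absurd (ha (mul_left_cancel₀ (neg_ne_zero.2 hK.natCast_ne_zero) h3)) (by decide)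
    obtain ⟨I, hI, J, hJ, s, ν, ν', α, γ, h⟩ := exists_isSolution_of_coeff_ne_zero hK
      (a := a ∘ Equiv.swap 0 1) (v := v ∘ Equiv.swap 0 1) (f := f)
      (ha.comp (Equiv.injective _)) (fun i => hv _) (fun i => hf _) (by simpa using h1)
    exact ⟨I, hI, J, hJ, s, ν, ν', α, _, γ, h⟩
  · obtain ⟨I, hI, J, hJ, s, ν, ν', α, γ, h⟩ := exists_isSolution_of_coeff_ne_zero hK ha hv hf h0
    exact ⟨I, hI, J, hJ, s, ν, ν', α, _, γ, h⟩

theorem natDegree_normalForm (hK : IsAdmissible K g) (hI : I ∈ halves K g) (s : K) :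
    (normalForm g I s).natDegree = 2 * g + 1 := by
  have h1 : (splitSum g I 1 s).natDegree ≤ g := by
    rw [natDegree_le_iff_coeff_eq_zero]
    intro i hi
    rw [coeff_splitSum hK hI, coeff_eq_zero_of_natDegree_lt (p := linProd I (1 : K)),
      coeff_eq_zero_of_natDegree_lt (p := linProd (complRoots g I) (1 : K))]
    · simp
    · rwa [natDegree_linProd, card_of_mem_halves (complRoots_mem_halves hK hI)]
    · rwa [natDegree_linProd, card_of_mem_halves hI]
  have h2 : ((C 2⁻¹ * splitSum g I 1 s) ^ 2).natDegree ≤ 2 * g := by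
    refine natDegree_pow_le.trans (Nat.mul_le_mul_left 2 ((natDegree_C_mul_le _ _).trans h1))
  rw [normalForm, natDegree_add_eq_left_of_natDegree_lt, natDegree_X_pow]
  rw [natDegree_X_pow]
  omega

end

/-- The equation of a marked curve with more than four points of order `2 g + 1` can be brought
into normal form. -/
theorem MarkedHyperellipticCurve.exists_normalForm {K : Type u} [Field K] [IsAlgClosed K] {g : ℕ}
    (C : MarkedHyperellipticCurve K g) (hg : g ≠ 0) (hK : IsAdmissible K g)
    (hC : 4 < (C.pointsOfOrder (2 * g + 1)).encard) :
    ∃ I ∈ halves K g, ∃ J ∈ halves K g, ∃ s ν ν' : K, IsSolution g I J s ν ν' ∧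
      ∃ x y : C.FunctionField, IsQuadraticModel x y (normalForm g I s) ∧
        C.toCurve.ord x C.pt < 0 := by
  obtain ⟨x, y, f, a, v, M, hf, hO, ha, hfv⟩ := C.exists_three_representations hg hK.two_ne_zero hC
  obtain ⟨I, hI, J, hJ, s, ν, ν', α, β, γ, hα, hγ, hsol, heq⟩ := exists_isSolution hK ha
    (fun i => (hfv i).1) fun i => (hfv i).2
  have M' := M.affine (α := α) (β := β) (γ := γ) hα hγ
  rw [heq] at M'
  refine ⟨I, hI, J, hJ, s, ν, ν', hsol, _, _, M', ?_⟩
  let P := C.toCurve.place C.pt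
  have hx : P.ord (x - algebraMap K C.FunctionField β) = P.ord x := by
    have := (P.ord_add_eq (a := x) (b := algebraMap K C.FunctionField (-β)) M.x_ne_zero
      ((P.ge_algebraMap _).mono (by change P.ord x < 0 at hO; omega))).2
    rwa [map_neg, ← sub_eq_add_neg] at this
  have hα' : algebraMap K C.FunctionField α⁻¹ ≠ 0 := by simpa using hα
  change P.ord _ < 0
  rw [P.ord_mul hα' (M.sub_ne_zero β), P.ord_algebraMap (inv_ne_zero hα), hx, zero_add]
  exact hO

/-! ### Rigidity of the solutions -/

/-- The polynomial `e X^(2g) + X^n - (X - β)^n`, `n = 2 g + 1`, is not a square. Every root of a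
square is a multiple root, and the vanishing of the polynomial and of its derivative determines the
root: `r (e + n β) = -2 g e β`. Hence `v` has only one root, whose multiplicity is at least two, and
the vanishing of the second derivative gives the contradicting `r (e + n β) = -(2 g - 1) e β`. -/
theorem sq_ne_of_isAlgClosed {k : Type*} [Field k] [IsAlgClosed k] {g : ℕ} (hg : 2 ≤ g)
    (hn : ((2 * g + 1 : ℕ) : k) ≠ 0) {e β : k} (hβ : β ≠ 0) (v : k[X]) :
    v ^ 2 ≠ C e * X ^ (2 * g) + X ^ (2 * g + 1) - (X - C β) ^ (2 * g + 1) := by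
  intro h
  obtain ⟨l, hl⟩ : ∃ l, 2 * g = l + 2 := ⟨2 * g - 2, by omega⟩
  rw [hl] at h hn
  have hroot : ∀ r, v.eval r = 0 → e * r ^ (l + 2) + r ^ (l + 3) = (r - β) ^ (l + 3) := by
    intro r hr
    have := congrArg (eval r) h
    simp only [eval_sub, eval_add, eval_mul, eval_pow, eval_C, eval_X, hr] at this
    linear_combination -this
  have hder : ∀ r, (v.eval r = 0 ∨ (derivative v).eval r = 0) →
      (l + 2 : k) * e * r ^ (l + 1) + (l + 3) * r ^ (l + 2) = (l + 3) * (r - β) ^ (l + 2) := by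
    intro r hr
    have := congrArg (fun p => eval r (derivative p)) h
    simp only [derivative_sub, derivative_add, derivative_mul, derivative_C, derivative_X_pow,
      derivative_X_sub_C_pow, eval_sub, eval_add, eval_mul, eval_pow, eval_C, eval_X, pow_two v]
      at this
    have h0 : eval r v * eval r (derivative v) = 0 := by
      rcases hr with hr | hr <;> rw [hr] <;> ring
    push_cast at this
    rw [eval_zero] at this
    linear_combination 2 * h0 - this
  have hn' : (l + 3 : k) ≠ 0 := by
    intro h0
    apply hn
    push_cast
    linear_combination h0
  have hroot' : ∀ r, v.eval r = 0 → r ≠ 0 ∧ r * (e + (l + 3) * β) = -(l + 2) * e * β := by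
    intro r hr
    have h1 := hroot r hr
    have h2 := hder r (Or.inl hr)
    have hr0 : r ≠ 0 := by
      rintro rfl
      rw [zero_pow (by omega), zero_pow (by omega), zero_sub] at h1
      exact pow_ne_zero (l + 3) (neg_ne_zero.2 hβ) (by linear_combination -h1)
    refine ⟨hr0, ?_⟩
    apply mul_left_cancel₀ (pow_ne_zero (l + 1) hr0)
    linear_combination (l + 3) * h1 - (r - β) * h2
  have hdeg : v.natDegree ≠ 0 := by
    intro h0
    obtain ⟨c, rfl⟩ := natDegree_eq_zero.1 h0
    have := hder 0 (Or.inr (by simp))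
    rw [zero_pow (by omega), zero_pow (by omega), zero_sub, mul_zero, mul_zero, zero_add] at this
    exact mul_ne_zero hn' (pow_ne_zero _ (neg_ne_zero.2 hβ)) this.symm
  have exists_root : ∀ p : k[X], p.natDegree ≠ 0 → ∃ r, p.eval r = 0 := by
    intro p hp
    exact IsAlgClosed.exists_root p fun h => hp (natDegree_eq_of_degree_eq_some h)
  obtain ⟨r, hr⟩ := exists_root v hdeg
  obtain ⟨hr0, hr1⟩ := hroot' r hr
  by_cases hN : e + (l + 3) * β = 0
  -- In this case `2 g = 0` in `k`, and `β` is a simple root.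
  · rw [hN, mul_zero] at hr1
    have he : e ≠ 0 := by
      rintro rfl
      rw [zero_add] at hN
      exact mul_ne_zero hn' hβ hN
    have hl0 : (l + 2 : k) = 0 := by
      have : (l + 2 : k) * (e * β) = 0 := by linear_combination hr1
      exact (mul_eq_zero.1 this).resolve_right (mul_ne_zero he hβ)
    have hβv : v.eval β = 0 := by
      have := congrArg (eval β) h
      simp only [eval_sub, eval_add, eval_mul, eval_pow, eval_C, eval_X, sub_self] at this
      rw [zero_pow (by omega)] at this
      have h3 : eval β v ^ 2 = 0 := by
        linear_combination this + β ^ (l + 2) * hN - β ^ (l + 3) * hl0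
      exact pow_eq_zero_iff two_ne_zero |>.1 h3
    have := hder β (Or.inl hβv)
    rw [sub_self, zero_pow (by omega), hl0, zero_mul, zero_mul, zero_add, mul_zero] at this
    exact mul_ne_zero hn' (pow_ne_zero _ hβ) this
  · obtain ⟨v₁, hv₁⟩ := dvd_iff_isRoot.2 hr
    have hv₁deg : v₁.natDegree ≠ 0 := by
      intro h0
      apply hN
      have hc := congrArg (fun p => p.coeff (l + 2)) h
      have h1 : (v ^ 2).natDegree < l + 2 := by
        have h3 : v.natDegree ≤ 1 := by
          rw [hv₁]
          refine natDegree_mul_le.trans ?_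
          rw [natDegree_X_sub_C, h0]
        have h4 : (v ^ 2).natDegree ≤ 2 * v.natDegree := natDegree_pow_le
        omega
      rw [coeff_eq_zero_of_natDegree_lt h1, coeff_sub, coeff_add, coeff_C_mul_X_pow, if_pos rfl,
        coeff_X_pow, if_neg (by omega), sub_eq_add_neg X, ← C_neg, coeff_X_add_C_pow,
        Nat.choose_succ_self_right, show l + 2 + 1 - (l + 2) = 1 by omega] at hc
      push_cast at hc
      linear_combination -hc
    obtain ⟨r₁, hr₁⟩ := exists_root v₁ hv₁deg
    have hrr : r₁ = r := by
      have h3 := (hroot' r₁ (by rw [hv₁, eval_mul, hr₁, mul_zero])).2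
      exact mul_right_cancel₀ hN (h3.trans hr1.symm)
    subst hrr
    obtain ⟨w, rfl⟩ := dvd_iff_isRoot.2 hr₁
    have hl0 : (l + 2 : k) ≠ 0 := by
      intro h0
      rw [h0, neg_zero, zero_mul, zero_mul, mul_eq_zero] at hr1
      exact hr1.elim hr0 hN
    have h3 := congrArg (fun p => eval r₁ (derivative (derivative p))) h
    rw [hv₁] at h3
    simp only [derivative_sub, derivative_add, derivative_mul, derivative_C, derivative_X_pow,
      derivative_X_sub_C_pow, eval_sub, eval_add, eval_mul, eval_pow, eval_C, eval_X, pow_two,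
      map_natCast, derivative_natCast, eval_natCast, derivative_X, sub_self, eval_zero,
      zero_mul, mul_zero, add_zero, zero_add, eval_one, Nat.add_succ_sub_one,
      derivative_one] at h3
    push_cast at h3
    have h4 : (l + 2 : k) * ((l + 1) * e * r₁ ^ l + (l + 3) * r₁ ^ (l + 1) -
        (l + 3) * (r₁ - β) ^ (l + 1)) = 0 := by
      linear_combination -h3
    have h5 := (mul_eq_zero.1 h4).resolve_left hl0
    have h6 := hder r₁ (Or.inl hr)
    have h7 : r₁ * (e + (l + 3) * β) = -(l + 1) * e * β := by
      apply mul_left_cancel₀ (pow_ne_zero l hr0)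
      linear_combination h6 - (r₁ - β) * h5
    have he : e = 0 := by
      have : e * β = 0 := by linear_combination hr1 - h7
      exact (mul_eq_zero.1 this).resolve_right hβ
    rw [he, mul_zero, zero_mul, zero_add, mul_eq_zero] at h7
    exact h7.elim hr0 (mul_ne_zero hn' hβ)

section
variable {K : Type*} [Field K] {g : ℕ} {I J : Finset K}

/-- The hypothesis says that `X q' = g q` for `q = linProd I 1`, which contradicts separability. -/
theorem false_of_forall_mul_coeff_eq_zero (hK : IsAdmissible K g) (hg : g ≠ 0)
    (hI : I ∈ halves K g)
    (h : ∀ i < g, ((g - i : ℕ) : K) * (linProd I (1 : K)).coeff i = 0) : False := by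
  set q := linProd I (1 : K) with hq
  have hcard := card_of_mem_halves hI
  have hqd : q.natDegree = g := by rw [hq, natDegree_linProd, hcard]
  have hX : X * derivative q = C (g : K) * q := by
    ext i
    rw [coeff_C_mul]
    cases i with
    | zero =>
      have := h 0 (by omega)
      rw [Nat.sub_zero] at this
      rw [this]
      simp
    | succ i =>
      rw [coeff_X_mul, coeff_derivative]
      rcases lt_trichotomy (i + 1) g with hlt | heq | hgt
      · have := h _ hlt
        rw [Nat.cast_sub hlt.le] at this
        push_cast at this
        linear_combination -this
      · rw [← heq]
        push_cast
        ring
      · rw [coeff_eq_zero_of_natDegree_lt (by omega)]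
        ring
  obtain ⟨ρ, hρ⟩ : I.Nonempty := Finset.card_pos.1 (by omega)
  have hρ0 := ne_zero_of_mem_powDifferenceRoots hK.natCast_ne_zero (mem_roots_of_mem_halves hI hρ)
  have hqρ : q.eval ρ = 0 := isRoot_linProd_iff.2 ⟨ρ, hρ, by simp⟩
  have h1 := congrArg (eval ρ) hX
  rw [eval_mul, eval_X, eval_mul, hqρ, mul_zero] at h1
  have h2 := (mul_eq_zero.1 h1).resolve_left hρ0
  obtain ⟨a, b, hab⟩ := linProd_separable (S := I) (one_ne_zero (α := K))
  have h3 := congrArg (eval ρ) hab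
  rw [← hq, eval_add, eval_mul, eval_mul, hqρ, h2] at h3
  simp at h3

variable [IsAlgClosed K]

/-- Comparison of the coefficients of `X ^ g`. -/
theorem add_eq_add_of_splitSum_eq {A : Type*} [CommRing A] [Algebra K A]
    (hK : IsAdmissible K g) (hI : I ∈ halves K g) (hJ : J ∈ halves K g) {μ μ' ν ν' : A}
    (h : splitSum g I μ μ' = splitSum g J ν ν') : μ + μ' = ν + ν' := by
  have key : ∀ {I : Finset K}, I ∈ halves K g → ∀ μ μ' : A,
      (splitSum g I μ μ').coeff g = μ + μ' := by
    intro I hI μ μ'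
    have e1 := coeff_card_linProd I (1 : K)
    have e2 := coeff_card_linProd (complRoots g I) (1 : K)
    rw [card_of_mem_halves hI] at e1
    rw [card_of_mem_halves (complRoots_mem_halves hK hI)] at e2
    rw [coeff_splitSum hK hI, e1, e2]
    simp
  rw [← key hI, ← key hJ, h]

/-- For `μ = 0` the identity `splitSum_sq` expresses `e² X^(2g)` as the sum of a square and of a
multiple of `(X - β)^n - X^n`, which is impossible for `β ≠ 0`. -/
theorem eq_zero_or_eq_zero_of_splitSum_eq {k : Type*} [Field k] [Algebra K k] (hg : 2 ≤ g)
    (hK : IsAdmissible K g) (hI : I ∈ halves K g) (hJ : J ∈ halves K g) {e ν ν' : k}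
    (h : splitSum g I 0 e = splitSum g J ν ν') : ν = 0 ∨ ν' = 0 := by
  by_contra! hne
  have h2 : (2 : k) ≠ 0 := by
    rw [← map_ofNat (algebraMap K k) 2]
    simpa using hK.two_ne_zero
  have hn : ((2 * g + 1 : ℕ) : k) ≠ 0 := by
    rw [← map_natCast (algebraMap K k), _root_.map_ne_zero]
    exact hK.natCast_ne_zero
  have h1 := splitSum_sq hK hJ ν ν'
  rw [← h, splitSum, zero_mul, C_0, zero_mul, zero_add, linProd_zero,
    card_of_mem_halves (complRoots_mem_halves hK hI)] at h1
  set w := C ν * linProd J (ν * ν') - C ν' * linProd (complRoots g J) (ν * ν')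
  set β := -(ν * ν' * algebraMap K k ((2 * g + 1 : ℕ) : K)⁻¹) with hβ
  have hβ0 : β ≠ 0 := by
    rw [hβ]
    refine neg_ne_zero.2 (mul_ne_zero (mul_ne_zero hne.1 hne.2) ?_)
    rw [_root_.map_ne_zero]
    exact inv_ne_zero hK.natCast_ne_zero
  have hβ' : C (ν * ν' * algebraMap K k ((2 * g + 1 : ℕ) : K)⁻¹) = - C β := by
    rw [hβ, C_neg, neg_neg]
  rw [hβ', ← sub_eq_add_neg] at h1
  have h3 : (C 2⁻¹ * w) ^ 2 = C ((2⁻¹ * e) ^ 2) * X ^ (2 * g) + X ^ (2 * g + 1) -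
      (X - C β) ^ (2 * g + 1) := by
    have h4 : C 2⁻¹ ^ 2 * 4 = (1 : k[X]) := by
      have : (2⁻¹ : k) ^ 2 * 4 = 1 := by
        have : (4 : k) = 2 ^ 2 := by norm_num
        rw [this, ← mul_pow, inv_mul_cancel₀ h2, one_pow]
      rw [← C_pow, ← C_ofNat, ← C_mul, this, C_1]
    simp only [C_pow, C_mul]
    linear_combination (-C 2⁻¹ ^ 2) * h1 -
      ((X - C β) ^ (2 * g + 1) - X ^ (2 * g + 1)) * h4
  let φ := algebraMap k (AlgebraicClosure k)
  have h5 := congrArg (Polynomial.map φ) h3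
  simp only [Polynomial.map_pow, Polynomial.map_sub, Polynomial.map_add, Polynomial.map_mul, map_C,
    map_X] at h5
  refine sq_ne_of_isAlgClosed hg ?_ (β := φ β) ?_ (C (φ 2⁻¹) * w.map φ) h5
  · rw [← map_natCast φ, _root_.map_ne_zero]
    exact hn
  · rwa [_root_.map_ne_zero]

open IsLocalRing in
/-- The case of `not_splitSum_eq` in which `ν` reduces to zero: then `ν / μ` is a unit, it reduces
to one because it maps roots to roots, and the equations divided by `ν - μ` force
`X q' = g q` for the polynomial `q` with roots in the complement of `I`. -/
theorem not_splitSum_eq_of_mem {O : Type*} [CommRing O] [IsDomain O] [ValuationRing O] [Algebra K O]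
    (hg : 2 ≤ g) (hK : IsAdmissible K g) (hI : I ∈ halves K g) (hJ : J ∈ halves K g)
    {μ μ' ν ν' : O} (hμ0 : μ ≠ 0) (hν0 : ν ≠ 0) (hμ : residue O μ = 0) (hν : residue O ν = 0)
    (hμ' : residue O μ' ≠ 0) (hne : μ * μ' ≠ ν * ν') :
    splitSum g I μ μ' ≠ splitSum g J ν ν' := by
  intro h
  have hadd := add_eq_add_of_splitSum_eq hK hI hJ h
  have hI' := complRoots_mem_halves hK hI
  have hJ' := complRoots_mem_halves hK hJ
  set e := residue O μ' with he
  have hν' : residue O ν' = e := by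
    have := congrArg (residue O) hadd
    rw [map_add, map_add, hμ, hν, zero_add, zero_add] at this
    exact this.symm
  have hres : ∀ c : K, residue O (algebraMap K O c) = algebraMap K (ResidueField O) c := fun _ =>
    rfl
  have hcoeff : ∀ i, (μ * μ') ^ (g - i) *
      (μ * algebraMap K O ((linProd I (1 : K)).coeff i) +
        μ' * algebraMap K O ((linProd (complRoots g I) (1 : K)).coeff i)) = (ν * ν') ^ (g - i) *
      (ν * algebraMap K O ((linProd J (1 : K)).coeff i) +
        ν' * algebraMap K O ((linProd (complRoots g J) (1 : K)).coeff i)) := by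
    intro i
    rw [← coeff_splitSum hK hI, ← coeff_splitSum hK hJ, h]
  -- `ν` is a unit multiple of `μ`.
  obtain ⟨τ, hτ, rfl⟩ : ∃ τ : O, residue O τ ≠ 0 ∧ ν = μ * τ := by
    have h0 := hcoeff 0
    rw [Nat.sub_zero] at h0
    set U := μ' ^ g * (μ * algebraMap K O ((linProd I (1 : K)).coeff 0) +
        μ' * algebraMap K O ((linProd (complRoots g I) (1 : K)).coeff 0)) with hU
    set W := ν' ^ g * (ν * algebraMap K O ((linProd J (1 : K)).coeff 0) +
        ν' * algebraMap K O ((linProd (complRoots g J) (1 : K)).coeff 0)) with hW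
    have hne0 : ∀ S ∈ halves K g, algebraMap K (ResidueField O) ((linProd S (1 : K)).coeff 0) ≠ 0 :=
      fun S hS => (_root_.map_ne_zero _).2 (coeff_zero_linProd_ne_zero fun ρ hρ =>
        ne_zero_of_mem_powDifferenceRoots hK.natCast_ne_zero (mem_roots_of_mem_halves hS hρ))
    have hUr : residue O U ≠ 0 := by
      rw [hU]
      simp only [map_mul, map_pow, map_add, hμ, hres, zero_mul, zero_add]
      exact mul_ne_zero (pow_ne_zero _ hμ') (mul_ne_zero hμ' (hne0 _ hI'))
    have hWr : residue O W ≠ 0 := by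
      rw [hW]
      simp only [map_mul, map_pow, map_add, hν, hν', hres, zero_mul, zero_add]
      exact mul_ne_zero (pow_ne_zero _ hμ') (mul_ne_zero hμ' (hne0 _ hJ'))
    have hUW : μ ^ g * U = ν ^ g * W := by
      rw [hU, hW, ← mul_assoc, ← mul_assoc, ← mul_pow, ← mul_pow, h0]
    have unit_of : ∀ {a b : O}, residue O (a * b) ≠ 0 → residue O a ≠ 0 := by
      intro a b hab ha
      exact hab (by rw [map_mul, ha, zero_mul])
    rcases ValuationRing.dvd_total μ ν with ⟨τ, rfl⟩ | ⟨τ, rfl⟩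
    · refine ⟨τ, ?_, rfl⟩
      have h1 : U = τ * (τ ^ (g - 1) * W) := by
        apply mul_left_cancel₀ (pow_ne_zero g hμ0)
        rw [hUW, mul_pow, ← mul_pow_sub_one (by omega : g ≠ 0) τ]
        ring
      exact unit_of (h1 ▸ hUr)
    · have h1 : W = τ * (τ ^ (g - 1) * U) := by
        apply mul_left_cancel₀ (pow_ne_zero g hν0)
        rw [← hUW, mul_pow, ← mul_pow_sub_one (by omega : g ≠ 0) τ]
        ring
      have hτ : residue O τ ≠ 0 := unit_of (h1 ▸ hWr)
      obtain ⟨σ, hσ⟩ := ((residue_ne_zero_iff_isUnit τ).1 hτ).exists_right_inv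
      exact ⟨σ, unit_of (b := τ) (by rw [mul_comm, hσ, map_one]; exact one_ne_zero),
        by rw [mul_assoc, hσ, mul_one]⟩
  have hτ0 : τ ≠ 0 := right_ne_zero_of_mul hν0
  -- The roots indexed by the complements of `I` and `J` agree up to the factor `τ`.
  have hlin : linProd (complRoots g I) (1 : ResidueField O) =
      linProd (complRoots g J) (residue O τ) := by
    ext i
    rw [coeff_linProd, coeff_linProd _ (residue O τ), one_pow, mul_one, card_of_mem_halves hJ']
    have h1 : μ' ^ (g - i) * (μ * algebraMap K O ((linProd I (1 : K)).coeff i) +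
        μ' * algebraMap K O ((linProd (complRoots g I) (1 : K)).coeff i)) = (τ * ν') ^ (g - i) *
        (μ * τ * algebraMap K O ((linProd J (1 : K)).coeff i) +
        ν' * algebraMap K O ((linProd (complRoots g J) (1 : K)).coeff i)) := by
      apply mul_left_cancel₀ (pow_ne_zero (g - i) hμ0)
      rw [← mul_assoc, ← mul_pow, hcoeff, mul_assoc, mul_pow μ]
      ring
    have h2 := congrArg (residue O) h1
    simp only [map_mul, map_pow, map_add, hμ, hν', hres, zero_mul, zero_add, ← he] at h2
    apply mul_left_cancel₀ (mul_ne_zero (pow_ne_zero (g - i) hμ') hμ')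
    rw [mul_pow] at h2
    linear_combination h2
  have hroots : ∀ ρ ∈ complRoots g I, ∃ σ ∈ complRoots g J,
      algebraMap K (ResidueField O) ρ = algebraMap K (ResidueField O) σ * residue O τ := by
    intro ρ hρ
    rw [← isRoot_linProd_iff, ← hlin, isRoot_linProd_iff]
    exact ⟨ρ, hρ, by simp⟩
  have hτ1 : residue O τ = 1 := by
    obtain ⟨ρ₁, hρ₁, ρ₂, hρ₂, hρ⟩ := Finset.one_lt_card.1
      (show 1 < (complRoots g I).card by rw [card_of_mem_halves hI']; omega)
    obtain ⟨σ₁, hσ₁, h1⟩ := hroots ρ₁ hρ₁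
    obtain ⟨σ₂, hσ₂, h2⟩ := hroots ρ₂ hρ₂
    have h3 : ρ₁ * σ₂ = ρ₂ * σ₁ := by
      apply (algebraMap K (ResidueField O)).injective
      rw [map_mul, map_mul, h1, h2]
      ring
    have h4 := hK.eq_of_mul_eq_mul (mem_roots_of_mem_halves hI' hρ₁)
      (mem_roots_of_mem_halves hI' hρ₂) (mem_roots_of_mem_halves hJ' hσ₁)
      (mem_roots_of_mem_halves hJ' hσ₂) hρ h3
    rw [← h4] at h1
    have h5 : algebraMap K (ResidueField O) ρ₁ ≠ 0 := (_root_.map_ne_zero _).2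
      (ne_zero_of_mem_powDifferenceRoots hK.natCast_ne_zero (mem_roots_of_mem_halves hI' hρ₁))
    exact mul_left_cancel₀ h5 (by rw [← h1, mul_one])
  have hIJ : I = J := by
    have hsub : complRoots g I ⊆ complRoots g J := by
      intro ρ hρ
      obtain ⟨σ, hσ, h1⟩ := hroots ρ hρ
      rw [hτ1, mul_one] at h1
      rwa [(algebraMap K (ResidueField O)).injective h1]
    have := Finset.eq_of_subset_of_card_le hsub
      (by rw [card_of_mem_halves hI', card_of_mem_halves hJ'])
    rw [← complRoots_complRoots hI, this, complRoots_complRoots hJ]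
  subst hIJ
  -- The equations are now divided by the common factor `δ μ ^ j`, where `δ = ν - μ = μ (τ - 1)`,
  -- before they are reduced.
  have hδ : μ * (τ - 1) ≠ 0 := by
    intro h0
    rw [mul_sub, mul_one, sub_eq_zero] at h0
    rw [h0] at hadd hne
    exact hne (by rw [add_left_cancel hadd])
  refine false_of_forall_mul_coeff_eq_zero hK (by omega) hI' fun i hi => ?_
  obtain ⟨j, hj⟩ : ∃ j, g - i = j + 1 := ⟨g - i - 1, by omega⟩
  have h1 := hcoeff i
  rw [hj] at h1 ⊢
  set E := algebraMap K O ((linProd I (1 : K)).coeff i)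
  set E' := algebraMap K O ((linProd (complRoots g I) (1 : K)).coeff i) with hE'
  set s := ∑ l ∈ Finset.range (j + 1), (τ * ν') ^ l * μ' ^ (j + 1 - 1 - l) with hs
  have hgeom : s * (τ * ν' - μ') = (τ * ν') ^ (j + 1) - μ' ^ (j + 1) := geom_sum₂_mul _ _ _
  have h2 : s * (μ' - μ * τ) * (μ * E + μ' * E') + μ * (τ * ν') ^ (j + 1) * (E - E') = 0 := by
    apply mul_left_cancel₀ (mul_ne_zero hδ (pow_ne_zero j hμ0))
    have hν'' : ν' = μ' - μ * (τ - 1) := by linear_combination -hadd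
    have h3 : μ * (τ * ν' - μ') = μ * (τ - 1) * (μ' - μ * τ) := by
      rw [hν'']; ring
    have h4 : (μ * (τ - 1)) * μ ^ j * (s * (μ' - μ * τ) * (μ * E + μ' * E')) =
        ((μ * τ * ν') ^ (j + 1) - (μ * μ') ^ (j + 1)) * (μ * E + μ' * E') := by
      rw [mul_pow μ μ', mul_assoc μ τ ν', mul_pow μ (τ * ν')]
      linear_combination (μ ^ (j + 1) * (μ * E + μ' * E')) * hgeom -
        μ ^ j * s * (μ * E + μ' * E') * h3
    have h5 : μ * τ * E + ν' * E' = μ * E + μ' * E' + μ * (τ - 1) * (E - E') := by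
      rw [hν'']; ring
    have h6 : μ * (τ - 1) * μ ^ j * (μ * (τ * ν') ^ (j + 1) * (E - E')) =
        (μ * τ * ν') ^ (j + 1) * (μ * (τ - 1) * (E - E')) := by
      rw [mul_assoc μ τ ν', mul_pow μ (τ * ν')]
      ring
    rw [mul_add, h4, h6, mul_zero]
    rw [h5] at h1
    linear_combination -h1
  have h3 := congrArg (residue O) h2
  have hs' : residue O s = (j + 1 : ℕ) * e ^ j := by
    rw [hs, map_sum]
    simp only [map_mul, map_pow, hτ1, hν', one_mul, ← he]
    rw [Finset.sum_congr rfl (g := fun _ => e ^ j) fun l hl => by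
      rw [Finset.mem_range] at hl
      rw [← pow_add]
      congr 1
      omega]
    simp
  simp only [map_add, map_mul, map_sub, hμ, zero_mul, zero_add, add_zero, sub_zero, map_zero, ← he,
    hs'] at h3
  have h4 : ((j + 1 : ℕ) : ResidueField O) * residue O E' = 0 := by
    have : e ^ j * e * e ≠ 0 := mul_ne_zero (mul_ne_zero (pow_ne_zero _ hμ') hμ') hμ'
    apply mul_left_cancel₀ this
    linear_combination h3
  apply (algebraMap K (ResidueField O)).injective
  rw [map_mul, map_natCast, map_zero, ← h4, hE', hres]

open IsLocalRing in
/-- The local form of rigidity: the parameter `μ` cannot reduce to zero at a valuation at which the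
other parameters are integral and not all of them reduce to zero. -/
theorem not_splitSum_eq {O : Type*} [CommRing O] [IsDomain O] [ValuationRing O] [Algebra K O]
    (hg : 2 ≤ g) (hK : IsAdmissible K g) (hI : I ∈ halves K g) (hJ : J ∈ halves K g)
    {μ μ' ν ν' : O} (hμ0 : μ ≠ 0) (hν0 : ν ≠ 0) (hν'0 : ν' ≠ 0) (hμ : residue O μ = 0)
    (hunit : residue O μ' ≠ 0 ∨ residue O ν ≠ 0 ∨ residue O ν' ≠ 0) (hne : μ * μ' ≠ ν * ν') :
    splitSum g I μ μ' ≠ splitSum g J ν ν' := by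
  intro h
  have hadd := congrArg (residue O) (add_eq_add_of_splitSum_eq hK hI hJ h)
  rw [map_add, map_add, hμ, zero_add] at hadd
  have h1 := congrArg (Polynomial.map (IsScalarTower.toAlgHom K O (ResidueField O)).toRingHom) h
  rw [map_splitSum, map_splitSum] at h1
  change splitSum g I (residue O μ) (residue O μ') = splitSum g J (residue O ν) (residue O ν') at h1
  rw [hμ] at h1
  rcases eq_zero_or_eq_zero_of_splitSum_eq hg hK hI hJ h1 with h0 | h0
  · refine not_splitSum_eq_of_mem hg hK hI hJ hμ0 hν0 hμ h0 ?_ hne h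
    rw [h0, zero_add] at hadd
    rw [h0, ← hadd] at hunit
    simpa using hunit
  · refine not_splitSum_eq_of_mem hg hK hI (complRoots_mem_halves hK hJ) hμ0 hν'0 hμ h0 ?_
      (by rwa [mul_comm ν' ν]) (by rw [splitSum_complRoots hJ, h])
    rw [h0, add_zero] at hadd
    rw [h0, ← hadd] at hunit
    simpa using hunit

/-- Rigidity: over an extension of `K`, the ratio of the parameters `μ` and `μ'` of two different
factorizations with equal `splitSum` is a constant. Otherwise `μ / μ'` is transcendental and has a
zero at some valuation, and the parameters can be scaled to become integral there. -/
theorem exists_eq_mul_of_splitSum_eq {L : Type*} [Field L] [Algebra K L] (hg : 2 ≤ g)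
    (hK : IsAdmissible K g) (hI : I ∈ halves K g) (hJ : J ∈ halves K g) {μ μ' ν ν' : L}
    (hμ : μ ≠ 0) (hμ' : μ' ≠ 0) (hν : ν ≠ 0) (hν' : ν' ≠ 0) (hne : μ * μ' ≠ ν * ν')
    (h : splitSum g I μ μ' = splitSum g J ν ν') : ∃ c : K, μ' = algebraMap K L c * μ := by
  by_contra! hc
  set t := μ / μ' with ht
  have ht0 : t ≠ 0 := div_ne_zero hμ hμ'
  have htK : ∀ p : K[X], aeval t p = 0 → p = 0 := by
    intro p hp
    by_contra hp0
    have hsp := (IsAlgClosed.splits p).eq_prod_roots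
    rw [hsp, map_mul, aeval_C, map_multiset_prod, Multiset.map_map, mul_eq_zero] at hp
    have hp1 := hp.resolve_left (by simpa using hp0)
    rw [Multiset.prod_eq_zero_iff, Multiset.mem_map] at hp1
    obtain ⟨a, -, ha⟩ := hp1
    have ha : t = algebraMap K L a := by simpa [sub_eq_zero] using ha
    apply hc a⁻¹
    rw [map_inv₀, ← ha, ht, inv_div]
    field_simp
  obtain ⟨V, hKV, htV⟩ : ∃ V : ValuationSubring L, (∀ c : K, algebraMap K L c ∈ V) ∧
      t ∈ V.nonunits := by
    let A := Algebra.adjoin K {t}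
    have htA : t ∈ A := Algebra.subset_adjoin rfl
    let Q : Ideal A.toSubring := Ideal.span {⟨t, htA⟩}
    have hQ : Q ≠ ⊤ := by
      rw [Ideal.ne_top_iff_one, Ideal.mem_span_singleton']
      rintro ⟨⟨z, hz⟩, hzt⟩
      have h1 : z * t = 1 := congrArg Subtype.val hzt
      have hz' : z ∈ Algebra.adjoin K {t} := hz
      rw [Algebra.adjoin_singleton_eq_range_aeval] at hz'
      obtain ⟨p, hp⟩ := hz'
      have hp : aeval t p = z := hp
      have := htK (p * X - 1) (by
        rw [map_sub, map_mul, aeval_X, map_one, hp]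
        exact sub_eq_zero.2 h1)
      have := congrArg (eval 0) this
      simp at this
    obtain ⟨V, hAV, hQV⟩ := Ideal.image_subset_nonunits_valuationSubring Q hQ
    exact ⟨V, fun c => hAV (A.algebraMap_mem c), hQV ⟨_, Ideal.subset_span rfl, rfl⟩⟩
  -- The scaling factor is the parameter of maximal valuation.
  obtain ⟨lam, hlam, hmax⟩ := Set.exists_max_image ({μ', ν, ν'} : Set L) V.valuation
    (Set.toFinite _) ⟨μ', by simp⟩
  have hlam0 : lam ≠ 0 := by
    rcases hlam with rfl | rfl | rfl <;> assumption
  have hmem : ∀ z ∈ ({μ', ν, ν'} : Set L), lam⁻¹ * z ∈ V := by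
    intro z hz
    rw [← V.valuation_le_one_iff, map_mul, map_inv₀]
    have h0 : V.valuation lam ≠ 0 := (V.valuation.ne_zero_iff).2 hlam0
    rw [inv_mul_le_iff₀ (zero_lt_iff.2 h0), mul_one]
    exact hmax z hz
  have h1 := hmem μ' (by simp)
  have h2 := hmem ν (by simp)
  have h3 := hmem ν' (by simp)
  have htV' : t ∈ V := V.nonunits_subset htV
  have h4 : lam⁻¹ * μ ∈ V := by
    have := mul_mem h1 htV'
    rwa [ht, mul_assoc, mul_div_cancel₀ _ hμ'] at this
  let _ : Algebra K V := ((algebraMap K L).codRestrict V.toSubring hKV).toAlgebra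
  let ι : V →ₐ[K] L := { V.subtype with commutes' := fun _ => rfl }
  have hι : Function.Injective ι := Subtype.val_injective
  have hl0 := inv_ne_zero hlam0
  refine not_splitSum_eq (O := V) hg hK hI hJ (μ := ⟨_, h4⟩) (μ' := ⟨_, h1⟩) (ν := ⟨_, h2⟩)
    (ν' := ⟨_, h3⟩) ?_ ?_ ?_ ?_ ?_ ?_ ?_
  · exact fun h0 => mul_ne_zero hl0 hμ (congrArg Subtype.val h0)
  · exact fun h0 => mul_ne_zero hl0 hν (congrArg Subtype.val h0)
  · exact fun h0 => mul_ne_zero hl0 hν' (congrArg Subtype.val h0)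
  · obtain ⟨_, htm⟩ := ValuationSubring.mem_nonunits_iff_exists_mem_maximalIdeal.1 htV
    have h5 : (⟨lam⁻¹ * μ, h4⟩ : V) = ⟨lam⁻¹ * μ', h1⟩ * ⟨t, htV'⟩ := Subtype.ext (by
      change lam⁻¹ * μ = lam⁻¹ * μ' * t
      rw [ht, mul_assoc, mul_div_cancel₀ _ hμ'])
    rw [h5, map_mul, (IsLocalRing.residue_eq_zero_iff _).2 htm, mul_zero]
  · have : ∀ z (hz : lam⁻¹ * z ∈ V), z = lam → IsLocalRing.residue V ⟨_, hz⟩ ≠ 0 := by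
      rintro z hz rfl
      have : (⟨z⁻¹ * z, hz⟩ : V) = 1 := Subtype.ext (inv_mul_cancel₀ hlam0)
      rw [this, map_one]
      exact one_ne_zero
    rcases hlam with h0 | h0 | h0
    · exact Or.inl (this _ _ h0.symm)
    · exact Or.inr (Or.inl (this _ _ h0.symm))
    · exact Or.inr (Or.inr (this _ _ h0.symm))
  · intro h0
    have h5 : lam⁻¹ * μ * (lam⁻¹ * μ') = lam⁻¹ * ν * (lam⁻¹ * ν') := congrArg Subtype.val h0
    apply hne
    apply mul_left_cancel₀ (pow_ne_zero 2 hl0)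
    linear_combination h5
  · apply Polynomial.map_injective ι.toRingHom hι
    rw [map_splitSum, map_splitSum]
    change splitSum g I (lam⁻¹ * μ) (lam⁻¹ * μ') = splitSum g J (lam⁻¹ * ν) (lam⁻¹ * ν')
    apply splitSum_eq_splitSum_of_mul hK hI hJ hlam0
    simp only [mul_inv_cancel_left₀ hlam0]
    exact h

end
end HyperellipticTorsion

namespace HyperellipticTorsion

/-! ### Bézout's inequality for plane curves -/

namespace Plane
open MvPolynomial
variable {K : Type*} [Field K]

/-- The polynomials in two variables of degree at most `m` form a space of dimension
`(m + 1)(m + 2) / 2`. -/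
theorem two_mul_finrank_restrictTotalDegree (m : ℕ) :
    2 * Module.finrank K (restrictTotalDegree (Fin 2) K m) = (m + 1) * (m + 2) := by
  classical
  let T : Finset (Σ _ : ℕ, ℕ × ℕ) :=
    (Finset.range (m + 1)).sigma fun k => Finset.HasAntidiagonal.antidiagonal k
  have hT : ∀ k a b, (⟨k, a, b⟩ : Σ _ : ℕ, ℕ × ℕ) ∈ T ↔ k ≤ m ∧ a + b = k := by
    intro k a b
    simp [T]
  have hsum : ∀ n : Fin 2 →₀ ℕ, (n.sum fun _ e => e) = n 0 + n 1 := fun n => by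
    rw [Finsupp.sum_fintype _ _ fun _ => rfl, Fin.sum_univ_two]
  let e : {n : Fin 2 →₀ ℕ | (n.sum fun _ e => e) ≤ m} ≃ T :=
    { toFun := fun n => ⟨⟨n.1 0 + n.1 1, n.1 0, n.1 1⟩, (hT _ _ _).2 ⟨hsum n.1 ▸ n.2, rfl⟩⟩
      invFun := fun t => ⟨Finsupp.equivFunOnFinite.symm ![t.1.2.1, t.1.2.2], by
        obtain ⟨⟨k, a, b⟩, ht⟩ := t
        rw [hT] at ht
        rw [Set.mem_ofPred_eq, hsum]
        simp only [Finsupp.equivFunOnFinite_symm_apply_apply, Matrix.cons_val]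
        omega⟩
      left_inv := fun n => by
        apply Subtype.ext
        ext i
        fin_cases i <;> simp
      right_inv := fun t => by
        obtain ⟨⟨k, a, b⟩, ht⟩ := t
        have := (hT _ _ _).1 ht
        apply Subtype.ext
        simp [this.2] }
  have hb := (basisRestrictSupport K {n : Fin 2 →₀ ℕ | (n.sum fun _ e => e) ≤ m}).reindex e
  have h1 : Module.finrank K (restrictTotalDegree (Fin 2) K m) = T.card := by
    rw [restrictTotalDegree, Module.finrank_eq_card_basis hb, Fintype.card_coe]
  have h2 : ∀ k : ℕ, 2 * ∑ j ∈ Finset.range k, (j + 1) = k * (k + 1) := by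
    intro k
    induction k with
    | zero => simp
    | succ k ih =>
      rw [Finset.sum_range_succ, mul_add, ih]
      ring
  rw [h1, Finset.card_sigma]
  simp only [Finset.Nat.card_antidiagonal]
  exact h2 (m + 1)

instance (m : ℕ) : Module.Finite K (restrictTotalDegree (Fin 2) K m) := by
  refine Module.finite_of_finrank_pos ?_
  have := two_mul_finrank_restrictTotalDegree (K := K) m
  have : 0 < (m + 1) * (m + 2) := by positivity
  omega

/-- Evaluation of polynomials of degree at most `m` at no more than `m + 1` points is surjective. -/
theorem exists_eval_eq {S : Finset (Fin 2 → K)} {m : ℕ} (hm : S.card ≤ m + 1) (φ : S → K) :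
    ∃ F ∈ restrictTotalDegree (Fin 2) K m, ∀ p : S, eval p.1 F = φ p := by
  classical
  have key : ∀ p ∈ S, ∃ F ∈ restrictTotalDegree (Fin 2) K m, eval p F = 1 ∧
      ∀ q ∈ S, q ≠ p → eval q F = 0 := by
    intro p hp
    have hi : ∀ q : Fin 2 → K, ∃ i, q ≠ p → q i ≠ p i := fun q => by
      by_cases h : q = p
      · exact ⟨0, fun h' => absurd h h'⟩
      · obtain ⟨i, hi⟩ := Function.ne_iff.1 h
        exact ⟨i, fun _ => hi⟩
    choose i hi using hi
    refine ⟨∏ q ∈ S.erase p, C (p (i q) - q (i q))⁻¹ * (X (i q) - C (q (i q))), ?_, ?_, ?_⟩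
    · rw [mem_restrictTotalDegree]
      refine (totalDegree_finsetProd _ _).trans ?_
      have h1 : ∀ q ∈ S.erase p,
          (C (p (i q) - q (i q))⁻¹ * (X (i q) - C (q (i q))) : MvPolynomial (Fin 2) K).totalDegree
            ≤ 1 := by
        intro q _
        refine (totalDegree_mul _ _).trans ?_
        rw [totalDegree_C, zero_add]
        refine (totalDegree_sub _ _).trans ?_
        rw [totalDegree_X, totalDegree_C]
        exact le_rfl
      refine (Finset.sum_le_sum h1).trans ?_
      rw [Finset.sum_const, smul_eq_mul, mul_one, Finset.card_erase_of_mem hp]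
      omega
    · rw [map_prod]
      refine Finset.prod_eq_one fun q hq => ?_
      have := hi q (Finset.ne_of_mem_erase hq)
      rw [map_mul, map_sub, eval_C, eval_C, eval_X]
      exact inv_mul_cancel₀ (sub_ne_zero.2 this.symm)
    · intro q hq hqp
      rw [map_prod]
      refine Finset.prod_eq_zero (Finset.mem_erase.2 ⟨hqp, hq⟩) ?_
      simp
  choose! F hF hF1 hF0 using key
  refine ⟨∑ p : S, C (φ p) * F p.1, ?_, fun q => ?_⟩
  · refine Submodule.sum_mem _ fun p _ => ?_
    rw [← smul_eq_C_mul]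
    exact Submodule.smul_mem _ _ (hF p.1 p.2)
  · rw [map_sum, Finset.sum_eq_single q]
    · rw [map_mul, eval_C, hF1 _ q.2, mul_one]
    · intro p _ hpq
      rw [map_mul, hF0 _ p.2 _ q.2 (fun h => hpq (Subtype.ext h.symm)), mul_zero]
    · intro h
      exact absurd (Finset.mem_univ _) h

/-- Bézout's inequality: the polynomials of large degree `m` that vanish at the common zeros of `F`
and `G` contain the `A F + B G`, and a dimension count bounds the number of zeros. -/
theorem card_le_of_forall_eval_eq_zero {F G : MvPolynomial (Fin 2) K} (hF : F ≠ 0)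
    (hFG : ∀ H, F ∣ H * G → F ∣ H) {S : Finset (Fin 2 → K)}
    (hS : ∀ p ∈ S, eval p F = 0 ∧ eval p G = 0) :
    S.card ≤ F.totalDegree * G.totalDegree := by
  classical
  set d := F.totalDegree with hd
  set e := G.totalDegree with he
  obtain ⟨k, hk⟩ : ∃ k, S.card ≤ k + d + e + 1 := ⟨S.card, by omega⟩
  set V := fun m => restrictTotalDegree (Fin 2) K m with hV
  let ev : V (k + d + e) →ₗ[K] (S → K) :=
    (LinearMap.pi fun p : S => (aeval p.1 : MvPolynomial (Fin 2) K →ₐ[K] K).toLinearMap) ∘ₗ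
      (V (k + d + e)).subtype
  have hev : ∀ (P : V (k + d + e)) (p : S), ev P p = eval p.1 P.1 := fun P p => rfl
  have hsurj : Function.Surjective ev := by
    intro φ
    obtain ⟨P, hP, h⟩ := exists_eval_eq hk φ
    exact ⟨⟨P, hP⟩, funext h⟩
  have mem_mul : ∀ {a b : ℕ} {A B : MvPolynomial (Fin 2) K}, A ∈ V a → B.totalDegree ≤ b →
      A * B ∈ V (a + b) := by
    intro a b A B hA hB
    rw [hV, mem_restrictTotalDegree] at hA ⊢
    exact (totalDegree_mul _ _).trans (Nat.add_le_add hA hB)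
  let ψ : V (k + e) × V (k + d) →ₗ[K] V (k + d + e) := LinearMap.codRestrict _
    ((LinearMap.mulRight K F ∘ₗ (V (k + e)).subtype).coprod
      (LinearMap.mulRight K G ∘ₗ (V (k + d)).subtype)) (by
    rintro ⟨⟨A, hA⟩, ⟨B, hB⟩⟩
    have h1 : A * F ∈ V (k + d + e) := by
      rw [add_right_comm]
      exact mem_mul hA hd.ge
    exact Submodule.add_mem _ h1 (mem_mul hB he.ge))
  have hψ : ∀ A B, (ψ (A, B)).1 = A.1 * F + B.1 * G := fun _ _ => rfl
  -- The syzygies `(-H G, H F)` are the whole kernel of `ψ`.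
  let χ : V k →ₗ[K] V (k + e) × V (k + d) :=
    (LinearMap.codRestrict (V (k + e)) (LinearMap.mulRight K (-G) ∘ₗ (V k).subtype) (by
      rintro ⟨A, hA⟩
      exact mem_mul hA (by rw [totalDegree_neg]))).prod
    (LinearMap.codRestrict (V (k + d)) (LinearMap.mulRight K F ∘ₗ (V k).subtype) (by
      rintro ⟨A, hA⟩
      exact mem_mul hA hd.ge))
  have hker : LinearMap.ker ψ ≤ LinearMap.range χ := by
    rintro ⟨⟨A, hA⟩, ⟨B, hB⟩⟩ hAB
    have h1 : A * F + B * G = 0 := congrArg Subtype.val (LinearMap.mem_ker.1 hAB)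
    obtain ⟨H, rfl⟩ := hFG B ⟨-A, by linear_combination h1⟩
    have h2 : A = H * -G := by
      apply mul_left_cancel₀ hF
      linear_combination h1
    have hH : H ∈ V k := by
      by_cases hH0 : H = 0
      · rw [hH0]; exact Submodule.zero_mem _
      rw [hV, mem_restrictTotalDegree] at hB ⊢
      rw [totalDegree_mul_of_isDomain hF hH0] at hB
      omega
    refine ⟨⟨H, hH⟩, ?_⟩
    refine Prod.ext (Subtype.ext h2.symm) (Subtype.ext (mul_comm _ _))
  have hrange : LinearMap.range ψ ≤ LinearMap.ker ev := by
    rintro _ ⟨⟨A, B⟩, rfl⟩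
    rw [LinearMap.mem_ker]
    funext p
    rw [hev, hψ, map_add, map_mul, map_mul, (hS p.1 p.2).1, (hS p.1 p.2).2]
    simp
  have e1 := LinearMap.finrank_range_add_finrank_ker ev
  rw [LinearMap.range_eq_top.2 hsurj, finrank_top, Module.finrank_fintype_fun_eq_card,
    Fintype.card_coe] at e1
  have e2 := LinearMap.finrank_range_add_finrank_ker ψ
  rw [Module.finrank_prod] at e2
  have e3 := Submodule.finrank_mono hrange
  have e4 := (Submodule.finrank_mono hker).trans (LinearMap.finrank_range_le χ)
  have f1 := two_mul_finrank_restrictTotalDegree (K := K) (k + d + e)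
  have f2 := two_mul_finrank_restrictTotalDegree (K := K) (k + e)
  have f3 := two_mul_finrank_restrictTotalDegree (K := K) (k + d)
  have f4 := two_mul_finrank_restrictTotalDegree (K := K) k
  nlinarith

/-- A version of Bézout's inequality for the solutions `Z` of a system of equations of degree at
most `e` that includes a nonzero equation `F`, provided that no solution lies on a common component
of all equations. -/
theorem finite_and_ncard_le {ι : Type*} {G : ι → MvPolynomial (Fin 2) K} {e : ℕ}
    (he : ∀ i, (G i).totalDegree ≤ e) {Z : Set (Fin 2 → K)} (hZ : ∀ z ∈ Z, ∀ i, eval z (G i) = 0)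
    (hD : ∀ D, Irreducible D → (∀ i, D ∣ G i) → ∀ z ∈ Z, eval z D ≠ 0)
    (F : MvPolynomial (Fin 2) K) (hF : F ≠ 0) :
    {z ∈ Z | eval z F = 0}.Finite ∧ {z ∈ Z | eval z F = 0}.ncard ≤ F.totalDegree * e := by
  classical
  have irr : ∀ D, Irreducible D → {z ∈ Z | eval z D = 0}.Finite ∧
      {z ∈ Z | eval z D = 0}.ncard ≤ D.totalDegree * e := by
    intro D hirr
    by_cases hall : ∀ i, D ∣ G i
    · have : {z ∈ Z | eval z D = 0} = ∅ := by
        ext z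
        simp only [Set.mem_ofPred_eq, Set.mem_empty_iff_false, iff_false, not_and]
        exact hD D hirr hall z
      rw [this]
      simp
    · push Not at hall
      obtain ⟨i, hi⟩ := hall
      have bound : ∀ S : Finset (Fin 2 → K), ↑S ⊆ {z ∈ Z | eval z D = 0} →
          S.card ≤ D.totalDegree * e := by
        intro S hS
        refine (card_le_of_forall_eval_eq_zero hirr.ne_zero
          (fun H h => (hirr.prime.dvd_or_dvd h).resolve_right hi)
          fun p hp => ⟨(hS hp).2, hZ p (hS hp).1 i⟩).trans ?_
        exact Nat.mul_le_mul_left _ (he i)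
      have hfin : {z ∈ Z | eval z D = 0}.Finite := by
        by_contra hinf
        obtain ⟨S, hS, hcard⟩ := Set.Infinite.exists_subset_card_eq hinf (D.totalDegree * e + 1)
        have := bound S hS
        omega
      refine ⟨hfin, ?_⟩
      rw [Set.ncard_eq_toFinset_card _ hfin]
      exact bound _ (by simp)
  induction F using WfDvdMonoid.induction_on_irreducible with
  | zero => exact absurd rfl hF
  | unit F hu =>
    have : {z ∈ Z | eval z F = 0} = ∅ := by
      ext z
      simp only [Set.mem_ofPred_eq, Set.mem_empty_iff_false, iff_false, not_and]
      intro _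
      exact (hu.map (eval z)).ne_zero
    rw [this]
    simp
  | mul F D hF0 hirr ih =>
    obtain ⟨h1, h2⟩ := ih hF0
    obtain ⟨h3, h4⟩ := irr D hirr
    have hsub : {z ∈ Z | eval z (D * F) = 0} ⊆
        {z ∈ Z | eval z D = 0} ∪ {z ∈ Z | eval z F = 0} := by
      rintro z ⟨hz, h⟩
      rw [map_mul, mul_eq_zero] at h
      exact h.imp (fun h => ⟨hz, h⟩) fun h => ⟨hz, h⟩
    refine ⟨(h3.union h1).subset hsub, ?_⟩
    refine (Set.ncard_le_ncard hsub (h3.union h1)).trans ((Set.ncard_union_le _ _).trans ?_)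
    rw [totalDegree_mul_of_isDomain hirr.ne_zero hF0, add_mul]
    omega

end Plane
end HyperellipticTorsion

namespace HyperellipticTorsion
open Polynomial

/-! ### The number of solutions -/

section
variable {K : Type*} [Field K] {g : ℕ} {I J : Finset K}

/-- The equation between the parameters `(I, 1, s)` and `(J, ν, ν')`, with the indeterminates
`s = X 0` and `ν = X 1`. The comparison of the leading coefficients gives `ν' = 1 + s - ν`. -/
noncomputable def equation (g : ℕ) (I J : Finset K) : (MvPolynomial (Fin 2) K)[X] :=
  splitSum g I 1 (MvPolynomial.X 0) -
    splitSum g J (MvPolynomial.X 1) (1 + MvPolynomial.X 0 - MvPolynomial.X 1)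

/-- The points `(s, ν)` of the plane that belong to a solution. -/
def solutionSet (g : ℕ) (I J : Finset K) : Set (Fin 2 → K) :=
  {z | IsSolution g I J (z 0) (z 1) (1 + z 0 - z 1)}

theorem map_equation {B : Type*} [CommRing B] [Algebra K B]
    (φ : MvPolynomial (Fin 2) K →ₐ[K] B) : (equation g I J).map φ.toRingHom =
      splitSum g I 1 (φ (.X 0)) - splitSum g J (φ (.X 1)) (1 + φ (.X 0) - φ (.X 1)) := by
  rw [equation, Polynomial.map_sub, map_splitSum, map_splitSum, map_sub, map_add, map_one]

theorem eval_coeff_equation {z : Fin 2 → K} (hz : z ∈ solutionSet g I J) (i : ℕ) :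
    MvPolynomial.eval z ((equation g I J).coeff i) = 0 := by
  have h := map_equation (g := g) (I := I) (J := J) (MvPolynomial.aeval z)
  simp only [MvPolynomial.aeval_X] at h
  rw [hz.eq, sub_self] at h
  have h1 := congrArg (fun p => p.coeff i) h
  simpa [coeff_map] using h1

variable [IsAlgClosed K]

/-- The shape of the equations. Those with `i < g` are the interesting ones: the equation for
`i = g` is trivial by the choice of `ν'`. -/
theorem coeff_equation (hK : IsAdmissible K g) (hI : I ∈ halves K g) (hJ : J ∈ halves K g) (i : ℕ) :
    ∃ a a' b b' : K, a = (linProd I (1 : K)).coeff i ∧ (equation g I J).coeff i =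
      .X 0 ^ (g - i) * (.C a + .X 0 * .C a') -
        (.X 1 * (1 + .X 0 - .X 1)) ^ (g - i) * (.X 1 * .C b + (1 + .X 0 - .X 1) * .C b') := by
  refine ⟨_, (linProd (complRoots g I) (1 : K)).coeff i, (linProd J (1 : K)).coeff i,
    (linProd (complRoots g J) (1 : K)).coeff i, rfl, ?_⟩
  rw [equation, coeff_sub, coeff_splitSum hK hI, coeff_splitSum hK hJ, one_mul, one_mul]
  rfl

theorem totalDegree_coeff_equation_le (hK : IsAdmissible K g) (hI : I ∈ halves K g)
    (hJ : J ∈ halves K g) (i : ℕ) :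
    ((equation g I J).coeff i).totalDegree ≤ 2 * (g - i) + 1 := by
  obtain ⟨a, a', b, b', -, h⟩ := coeff_equation hK hI hJ i
  rw [h]
  have hX : ∀ j, (MvPolynomial.X j : MvPolynomial (Fin 2) K).totalDegree ≤ 1 := fun j =>
    (MvPolynomial.totalDegree_X j).le
  have hν : (1 + .X 0 - .X 1 : MvPolynomial (Fin 2) K).totalDegree ≤ 1 :=
    (MvPolynomial.totalDegree_sub _ _).trans (max_le ((MvPolynomial.totalDegree_add _ _).trans
      (max_le (by simp) (hX 0))) (hX 1))
  have mul_le : ∀ {P Q : MvPolynomial (Fin 2) K} {m n : ℕ}, P.totalDegree ≤ m →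
      Q.totalDegree ≤ n → (P * Q).totalDegree ≤ m + n := fun h1 h2 =>
    (MvPolynomial.totalDegree_mul _ _).trans (Nat.add_le_add h1 h2)
  have pow_le : ∀ {P : MvPolynomial (Fin 2) K} {m : ℕ} (k : ℕ), P.totalDegree ≤ m →
      (P ^ k).totalDegree ≤ k * m := fun k h1 =>
    (MvPolynomial.totalDegree_pow _ _).trans (Nat.mul_le_mul_left k h1)
  have hC : ∀ {P : MvPolynomial (Fin 2) K} (c : K), P.totalDegree ≤ 1 →
      (P * .C c).totalDegree ≤ 1 := fun c h1 => mul_le (n := 0) h1 (by simp)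
  refine (MvPolynomial.totalDegree_sub _ _).trans (max_le ?_ ?_)
  · refine (mul_le (pow_le (g - i) (hX 0)) ((MvPolynomial.totalDegree_add _ _).trans
      (max_le (by simp) (hC a' (hX 0))) : _ ≤ 1)).trans ?_
    omega
  · refine (mul_le (pow_le (g - i) (mul_le (hX 1) hν)) ((MvPolynomial.totalDegree_add _ _).trans
      (max_le (hC b (hX 1)) (hC b' hν)) : _ ≤ 1)).trans ?_
    omega

/-- Along the line `ν = 0` the second term of the coefficient vanishes. -/
theorem coeff_equation_ne_zero (hK : IsAdmissible K g) (hI : I ∈ halves K g)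
    (hJ : J ∈ halves K g) {i : ℕ} (hi : i < g) (h0 : (linProd I (1 : K)).coeff i ≠ 0) :
    (equation g I J).coeff i ≠ 0 := by
  obtain ⟨a, a', b, b', ha, h⟩ := coeff_equation hK hI hJ i
  rw [← ha] at h0
  rw [h]
  intro h1
  have h2 := congrArg (MvPolynomial.aeval ![(X : K[X]), 0]) h1
  have hgi : g - i ≠ 0 := by omega
  simp only [map_sub, map_mul, map_pow, map_add, MvPolynomial.aeval_X, MvPolynomial.algHom_C,
    map_zero, Matrix.cons_val_zero, Matrix.cons_val_one, zero_mul, zero_pow hgi, sub_zero,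
    mul_eq_zero, pow_eq_zero_iff hgi, X_ne_zero, false_or] at h2
  have h3 := congrArg (Polynomial.eval 0) h2
  simp [h0] at h3

/-- A common component of the equations would be a curve of solutions, whose generic point
contradicts the rigidity of the solutions. -/
theorem eval_ne_zero_of_forall_dvd_coeff (hg : 2 ≤ g) (hK : IsAdmissible K g) (hI : I ∈ halves K g)
    (hJ : J ∈ halves K g) {D : MvPolynomial (Fin 2) K} (hD : Irreducible D)
    (hdvd : ∀ i, D ∣ (equation g I J).coeff i) {z : Fin 2 → K} (hz : z ∈ solutionSet g I J) :
    MvPolynomial.eval z D ≠ 0 := by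
  intro hDz
  let Q := MvPolynomial (Fin 2) K ⧸ Ideal.span {D}
  have hprime : (Ideal.span {D}).IsPrime := (Ideal.span_singleton_prime hD.ne_zero).2 hD.prime
  let L := FractionRing Q
  let φ : MvPolynomial (Fin 2) K →ₐ[K] L :=
    (IsScalarTower.toAlgHom K Q L).comp (Ideal.Quotient.mkₐ K (Ideal.span {D}))
  have hφ : ∀ P, φ P = 0 ↔ D ∣ P := fun P => by
    have h1 : φ P = algebraMap Q L (Ideal.Quotient.mk _ P) := rfl
    rw [h1, map_eq_zero_iff _ (IsFractionRing.injective Q L), Ideal.Quotient.eq_zero_iff_mem,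
      Ideal.mem_span_singleton]
  have hφz : ∀ P, MvPolynomial.eval z P ≠ 0 → φ P ≠ 0 := by
    intro P hP h0
    obtain ⟨E, rfl⟩ := (hφ P).1 h0
    rw [map_mul, hDz, zero_mul] at hP
    exact hP rfl
  have h := map_equation (g := g) (I := I) (J := J) φ
  have h0 : (equation g I J).map φ.toRingHom = 0 := by
    ext i
    rw [coeff_map, coeff_zero]
    exact (hφ _).2 (hdvd i)
  rw [h0, eq_comm, sub_eq_zero] at h
  have hs : φ (.X 0) ≠ 0 := hφz _ (by simpa using hz.s_ne_zero)
  have hν : φ (.X 1) ≠ 0 := hφz _ (by simpa using hz.ν_ne_zero)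
  have hν' : 1 + φ (.X 0) - φ (.X 1) ≠ 0 := by
    simpa using hφz (1 + .X 0 - .X 1) (by simpa using hz.ν'_ne_zero)
  have h1s : 1 + φ (.X 0) ≠ 0 := by
    simpa using hφz (1 + .X 0) (by simpa using hz.one_add_ne_zero)
  have hne : 1 * φ (.X 0) ≠ φ (.X 1) * (1 + φ (.X 0) - φ (.X 1)) := by
    have := hφz (.X 0 - .X 1 * (1 + .X 0 - .X 1)) (by simpa [sub_eq_zero] using hz.ne_mul)
    rw [one_mul]
    simpa [sub_eq_zero] using this
  -- Rigidity, applied in both directions, makes `s` and `ν` constant on the component.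
  obtain ⟨c, hc⟩ := exists_eq_mul_of_splitSum_eq hg hK hI hJ one_ne_zero hs hν hν' hne h
  obtain ⟨c', hc'⟩ := exists_eq_mul_of_splitSum_eq hg hK hJ hI hν hν' one_ne_zero hs hne.symm h.symm
  have hmul : 1 + φ (.X 0) = algebraMap K L (1 + c') * φ (.X 1) := by
    rw [map_add, map_one]
    linear_combination hc'
  have hc1 : 1 + c' ≠ 0 := by
    intro h0
    rw [h0, map_zero, zero_mul] at hmul
    exact h1s hmul
  have hd0 : D ∣ .X 0 - .C c := by
    rw [← hφ, map_sub, hc, mul_one, MvPolynomial.algHom_C, sub_self]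
  have hd1 : D ∣ .X 1 - .C ((1 + c) / (1 + c')) := by
    rw [← hφ, map_sub, MvPolynomial.algHom_C, sub_eq_zero, map_div₀]
    rw [eq_div_iff (_root_.map_ne_zero (algebraMap K L) |>.2 hc1), mul_comm, ← hmul, hc, mul_one,
      map_add, map_one]
  have hirr : Irreducible (.X 0 - .C c : MvPolynomial (Fin 2) K) := by
    have h1 : (.X 0 - .C c : MvPolynomial (Fin 2) K).coeff (Finsupp.single 0 1) = 1 := by
      have h2 : (0 : Fin 2 →₀ ℕ) ≠ Finsupp.single 0 1 := fun h0 =>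
        one_ne_zero (Finsupp.single_eq_zero.1 h0.symm)
      rw [MvPolynomial.coeff_sub, MvPolynomial.coeff_C, if_neg h2, sub_zero]
      simp
    apply MvPolynomial.irreducible_of_totalDegree_eq_one
    · apply le_antisymm
      · refine (MvPolynomial.totalDegree_sub _ _).trans ?_
        simp
      · have h2 := MvPolynomial.le_totalDegree (MvPolynomial.mem_support_iff.2
          (h1.trans_ne one_ne_zero))
        simpa using h2
    · intro x hx
      have := hx (Finsupp.single 0 1)
      rw [h1] at this
      exact isUnit_of_dvd_one this
  obtain ⟨E, hE⟩ := (hD.dvd_symm hirr hd0).trans hd1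
  have := congrArg (MvPolynomial.eval ![c, (1 + c) / (1 + c') + 1]) hE
  simp at this

theorem finite_and_ncard_solutionSet_le (hg : 2 ≤ g) (hK : IsAdmissible K g) (hI : I ∈ halves K g)
    (hJ : J ∈ halves K g) {i : ℕ} (hi : i < g) (h0 : (linProd I (1 : K)).coeff i ≠ 0) :
    (solutionSet g I J).Finite ∧
      (solutionSet g I J).ncard ≤ (2 * (g - i) + 1) * (2 * g + 1) := by
  have h := Plane.finite_and_ncard_le (G := fun i => (equation g I J).coeff i) (e := 2 * g + 1)
    (fun i => (totalDegree_coeff_equation_le hK hI hJ i).trans (by omega))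
    (fun z hz i => eval_coeff_equation hz i)
    (fun D hD hdvd z hz => eval_ne_zero_of_forall_dvd_coeff hg hK hI hJ hD hdvd hz)
    _ (coeff_equation_ne_zero hK hI hJ hi h0)
  rw [Set.sep_eq_self_iff_mem_true.2 fun z hz => eval_coeff_equation hz i] at h
  exact ⟨h.1, h.2.trans (Nat.mul_le_mul_right _ (totalDegree_coeff_equation_le hK hI hJ i))⟩

/-- The sets `I` of `g` roots with sum zero are rare: an element of `I` is determined by the other
elements, so that the pairs of such an `I` and an element of it embed into the sets of `g - 1`
roots. -/
theorem mul_card_filter_coeff_eq_zero_le [DecidableEq K] (hg : 2 ≤ g) (hK : IsAdmissible K g) :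
    g * ((halves K g).filter fun I => (linProd I (1 : K)).coeff (g - 1) = 0).card ≤
      (2 * g).choose g := by
  set B := (halves K g).filter fun I => (linProd I (1 : K)).coeff (g - 1) = 0 with hB
  have hcard : ∀ {I}, I ∈ B → I.card = g := fun hI =>
    card_of_mem_halves (Finset.mem_filter.1 hI).1
  have hρ : ∀ {I : Finset K} {ρ : K}, I ∈ B → ρ ∈ I →
      ρ = (linProd (I.erase ρ) (1 : K)).coeff (g - 2) := by
    intro I ρ hI hρ
    have h1 := (Finset.mem_filter.1 hI).2
    have h2 : (I.erase ρ).card = g - 1 := by rw [Finset.card_erase_of_mem hρ, hcard hI]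
    have h3 : linProd I (1 : K) = (X - C ρ) * linProd (I.erase ρ) (1 : K) := by
      rw [linProd, ← Finset.mul_prod_erase I _ hρ, linProd, mul_one]
      rfl
    obtain ⟨k, rfl⟩ := Nat.exists_eq_add_of_le' hg
    have h4 := coeff_card_linProd (I.erase ρ) (1 : K)
    rw [h2] at h4
    rw [h3, show k + 2 - 1 = k + 1 by omega, coeff_succ_X_sub_C_mul] at h1
    rw [show k + 2 - 1 = k + 1 by omega] at h4
    rw [h4] at h1
    rw [show k + 2 - 2 = k by omega]
    linear_combination -h1
  have h1 : (B.sigma fun I => I).card = g * B.card := by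
    rw [Finset.card_sigma, Finset.sum_congr rfl fun I hI => hcard hI, Finset.sum_const, smul_eq_mul,
      mul_comm]
  have h2 : (B.sigma fun I => I).card ≤ ((powDifferenceRoots K g).powersetCard (g - 1)).card := by
    refine Finset.card_le_card_of_injOn (fun t => t.1.erase t.2) ?_ ?_
    · rintro ⟨I, ρ⟩ ht
      rw [Finset.mem_coe, Finset.mem_sigma] at ht
      rw [Finset.mem_coe, Finset.mem_powersetCard, Finset.card_erase_of_mem ht.2, hcard ht.1]
      exact ⟨(Finset.erase_subset _ _).trans
        (Finset.mem_powersetCard.1 (Finset.mem_filter.1 ht.1).1).1, rfl⟩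
    · rintro ⟨I, ρ⟩ ht ⟨I', ρ'⟩ ht' h
      rw [Finset.mem_coe, Finset.mem_sigma] at ht ht'
      have h3 : I.erase ρ = I'.erase ρ' := h
      have h4 : ρ = ρ' := by
        have h5 := hρ ht.1 ht.2
        have h6 := hρ ht'.1 ht'.2
        simp only at h5 h6
        rw [h3] at h5
        exact h5.trans h6.symm
      subst h4
      have h5 : I = I' := by
        have h6 := congrArg (insert ρ) h3
        rwa [Finset.insert_erase ht.2, Finset.insert_erase ht'.2] at h6
      rw [h5]
  rw [Finset.card_powersetCard, card_powDifferenceRoots hK.natCast_ne_zero, h1] at h2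
  refine h2.trans ((Nat.choose_le_centralBinom _ _).trans ?_)
  rw [Nat.centralBinom]

/-- The pairs `(I, s)` that belong to a solution. The equation for `i = g - 1` has degree at most
three; only for the few `I` with sum zero it is replaced by the equation for `i = 0`, of degree at
most `2 g + 1`. -/
theorem exists_finset_solutions (hg : 2 ≤ g) (hK : IsAdmissible K g) :
    ∃ T : Finset (Finset K × K), T.card ≤ 9 * (4 * g - 1) * (2 * g).choose g ^ 2 ∧
      ∀ I ∈ halves K g, ∀ J ∈ halves K g, ∀ s ν ν', IsSolution g I J s ν ν' → (I, s) ∈ T := by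
  classical
  let bound : Finset K → ℕ := fun I =>
    if (linProd I (1 : K)).coeff (g - 1) = 0 then (2 * g + 1) ^ 2 else 3 * (2 * g + 1)
  have key : ∀ t ∈ halves K g ×ˢ halves K g, ∃ T : Finset (Fin 2 → K),
      (∀ z ∈ solutionSet g t.1 t.2, z ∈ T) ∧ T.card ≤ bound t.1 := by
    rintro ⟨I, J⟩ ht
    obtain ⟨hI, hJ⟩ := Finset.mem_product.1 ht
    have h : (solutionSet g I J).Finite ∧ (solutionSet g I J).ncard ≤ bound I := by
      by_cases h0 : (linProd I (1 : K)).coeff (g - 1) = 0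
      · have h1 := finite_and_ncard_solutionSet_le hg hK hI hJ (i := 0) (by omega)
          (coeff_zero_linProd_ne_zero fun ρ hρ => ne_zero_of_mem_powDifferenceRoots
            hK.natCast_ne_zero (mem_roots_of_mem_halves hI hρ))
        simp only [bound, h0, if_true]
        exact ⟨h1.1, h1.2.trans (by rw [Nat.sub_zero, sq])⟩
      · have h1 := finite_and_ncard_solutionSet_le hg hK hI hJ (by omega) h0
        rw [show g - (g - 1) = 1 by omega] at h1
        simp only [bound, h0, if_false]
        exact h1
    refine ⟨h.1.toFinset, fun z hz => h.1.mem_toFinset.2 hz, ?_⟩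
    rw [← Set.ncard_eq_toFinset_card _ h.1]
    exact h.2
  choose! T hT hTcard using key
  refine ⟨(halves K g ×ˢ halves K g).biUnion fun t => (T t).image fun z => (t.1, z 0), ?_, ?_⟩
  · have hN : (halves K g).card = (2 * g).choose g := by
      rw [halves, Finset.card_powersetCard, card_powDifferenceRoots hK.natCast_ne_zero]
    have hB := mul_card_filter_coeff_eq_zero_le hg hK
    set b := ((halves K g).filter fun I => (linProd I (1 : K)).coeff (g - 1) = 0).card
    set N := (2 * g).choose g
    have h1 : ∑ I ∈ halves K g, bound I ≤ b * (2 * g + 1) ^ 2 + N * (3 * (2 * g + 1)) := by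
      rw [Finset.sum_ite, Finset.sum_const, Finset.sum_const, smul_eq_mul, smul_eq_mul]
      exact Nat.add_le_add_left (Nat.mul_le_mul_right _ ((Finset.card_filter_le _ _).trans hN.le)) _
    have h2 : b * (2 * g + 1) ^ 2 + N * (3 * (2 * g + 1)) ≤ N * (9 * (4 * g - 1)) := by
      have h3 : b * (2 * g + 1) ^ 2 ≤ N * (4 * g + 5) := by
        have h4 : (2 * g + 1) ^ 2 ≤ g * (4 * g + 5) := by nlinarith
        calc b * (2 * g + 1) ^ 2 ≤ b * (g * (4 * g + 5)) := Nat.mul_le_mul_left _ h4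
          _ = g * b * (4 * g + 5) := by ring
          _ ≤ N * (4 * g + 5) := Nat.mul_le_mul_right _ hB
      refine (Nat.add_le_add_right h3 _).trans ?_
      rw [← Nat.mul_add]
      exact Nat.mul_le_mul_left _ (by omega)
    refine Finset.card_biUnion_le.trans ((Finset.sum_le_sum fun t ht =>
      Finset.card_image_le.trans (hTcard t ht)).trans ?_)
    rw [Finset.sum_product]
    simp only [Finset.sum_const, smul_eq_mul, hN]
    rw [← Finset.mul_sum]
    refine (Nat.mul_le_mul_left N (h1.trans h2)).trans (le_of_eq ?_)
    ring
  · intro I hI J hJ s ν ν' h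
    have hν' : ν' = 1 + s - ν := by
      have := add_eq_add_of_splitSum_eq hK hI hJ h.eq
      linear_combination -this
    subst hν'
    have ht : (I, J) ∈ halves K g ×ˢ halves K g := Finset.mem_product.2 ⟨hI, hJ⟩
    rw [Finset.mem_biUnion]
    refine ⟨(I, J), ht, Finset.mem_image.2 ⟨![s, ν], hT _ ht _ ?_, by simp⟩⟩
    rw [solutionSet, Set.mem_ofPred_eq]
    simpa using h

end
end HyperellipticTorsion

theorem theorem1p1 (g : ℕ) (hg : 1 < g) (K : Type u) [Field K] [IsAlgClosed K]
    (hK : CharZero K ∨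
      ((2 * g + 1).Prime ∧ ∃ p : ℕ, p.Prime ∧ Odd p ∧ CharP K p ∧
        IsPrimitiveRoot (p : ZMod (2 * g + 1)) (2 * g))) :
    ∃ S : Finset (HyperellipticTorsion.MarkedHyperellipticCurve K g),
      S.card ≤ 9 * (4 * g - 1) * (2 * g).choose g ^ 2 ∧
      ∀ C : HyperellipticTorsion.MarkedHyperellipticCurve K g,
        4 < (C.pointsOfOrder (2 * g + 1)).encard → ∃ D ∈ S, C.IsIsomorphic D := by
  classical
  have hK' := HyperellipticTorsion.isAdmissible_of_isAlgClosed (by omega) hK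
  rcases isEmpty_or_nonempty (HyperellipticTorsion.MarkedHyperellipticCurve K g) with hE | hE
  · exact ⟨∅, by simp, fun C => hE.elim C⟩
  obtain ⟨T, hT, hmem⟩ := HyperellipticTorsion.exists_finset_solutions hg hK'
  let HasModel (C : HyperellipticTorsion.MarkedHyperellipticCurve K g) (t : Finset K × K) : Prop :=
    ∃ x y, HyperellipticTorsion.IsQuadraticModel x y
      (HyperellipticTorsion.normalForm g t.1 t.2) ∧ C.toCurve.ord x C.pt < 0
  -- A curve with the given equation, if there is one.
  have hex : ∀ t, ∃ D, (∃ C, HasModel C t) → HasModel D t := fun t => by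
    by_cases h : ∃ C, HasModel C t
    · exact ⟨h.choose, fun _ => h.choose_spec⟩
    · exact ⟨hE.some, fun h' => absurd h' h⟩
  choose D hD using hex
  refine ⟨T.image D, Finset.card_image_le.trans hT, fun C hC => ?_⟩
  obtain ⟨I, hI, J, hJ, s, ν, ν', hsol, x, y, hM, hx⟩ := C.exists_normalForm (by omega) hK' hC
  refine ⟨D (I, s), Finset.mem_image_of_mem D (hmem I hI J hJ s ν ν' hsol), ?_⟩
  obtain ⟨x', y', hM', hx'⟩ := hD (I, s) ⟨C, x, y, hM, hx⟩
  exact C.isIsomorphic_of_model hK'.two_ne_zero hM hM'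
    (HyperellipticTorsion.natDegree_normalForm hK' hI s) hx hx'
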